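/- **Setting.** Let $\Sigma$ be a compact oriented smooth manifold without boundary of dimension $n-1\ge 0$, $B$ a smooth manifold of dimension $n$, and let $\pi_K:K\to\Sigma$ and $\pi_F:F\to B$ be smooth (finite-dimensional) bundles, i.e. surjective submersions, with vertical bundles $VK=\ker d\pi_K$ and $VF=\ker d\pi_F$. Let $s_F:\mathbb{R}\times K\to F$ and $s_B:\mathbb{R}\times\Sigma\to B$ be diffeomorphisms with $\pi_F\circ s_F=s_B\circ(\mathrm{id}\times\pi_K)$ (a compatible slicing), put $i_\tau:=s_F(\tau,\cdot):K\to F$, and let $\partial_0$ be the vector field on $F$ that corresponds to $\partial/\partial t$ under $s_F$. Let $\lambda$ be a smooth $n$-form on $F$ that is properly in $Z^n_1(F)$: $V_1\lrcorner V_2\lrcorner\lambda=0$ for all vertical vectors $V_1,V_2$, but $V\lrcorner\lambda\neq0$ for some vertical vector $V$. For $\tau\in\mathbb{R}$ put $$\Omega_\tau:=i_\tau^*(d\lambda)\in\Omega^{n+1}(K),\qquad \mathcal{H}_\tau:=i_\tau^*(\partial_0\lrcorner\lambda)\in\Omega^{n-1}(K).$$ Let $\Gamma(K)$ be the set of smooth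 sections of $K$ and, for $\sigma\in\Gamma(K)$, let $T_\sigma\Gamma(K):=\Gamma(\sigma^*(VK))$. Define $$H_\tau(\sigma):=\int_\Sigma\sigma^*\mathcal{H}_\tau,\qquad \omega_\tau|_\sigma(V_1,V_2):=\int_\Sigma\sigma^*\big(\Omega_\tau(V_1,V_2,\cdot)\big).$$ The differential $dH_\tau|_\sigma$ is the linear form on $T_\sigma\Gamma(K)$ with $dH_\tau|_\sigma(V)=\frac{d}{dt}\big|_{t=0}H_\tau(\sigma_t)$ for every smooth one-parameter family of sections $\sigma_t$ with $\sigma_0=\sigma$ and $\frac{d}{dt}\big|_{t=0}\sigma_t=V$. **Proposition.** Let $\tau\in\mathbb{R}$, $\sigma_\tau\in\Gamma(K)$ and $X_\tau\in T_{\sigma_\tau}\Gamma(K)$. 1. The differential $dH_\tau|_{\sigma_\tau}$ exists and is unique, and $(\sigma_\tau,X_\tau)$ satisfies the Hamilton equations $$(X_\tau\lrcorner\omega_\tau)|_{\sigma_\tau}=dH_\tau|_{\sigma_\tau}$$ if and only if $$\sigma_\tau^*\big(V\lrcorner(X_\tau\lrcorner\Omega_\tau-d\mathcal{H}_\tau)\big)=0\qquad\text{for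 all }V\in\Gamma(\sigma_\tau^*(VK)).$$ 2. Let $\mathcal{I}:=\langle Z\lrcorner d\lambda:Z\in\Gamma(VF)\rangle_{\mathrm{diff}}$ be the Hamilton–Cartan exterior differential system, i.e. the smallest ideal of $\Omega^\bullet(F)$ that contains these forms and is closed under $d$. For every $x\in\Sigma$ the subspace $E_x:=T_x(i_\tau\circ\sigma_\tau)(T_x\Sigma)$ of $T_{i_\tau(\sigma_\tau(x))}F$ is an integral element of dimension $n-1$ of $\mathcal{I}$ (it has this dimension and all forms in $\mathcal I$ vanish on it). If moreover $\mathcal{L}_{\partial_0}\lambda=0$, then the equivalent conditions of part 1 hold if and only if, for every $x\in\Sigma$, the vector $\partial_0+(i_\tau)_*X_\tau(x)$ belongs to the polar space of $E_x$, i.e. to the subspace spanned by all $n$-dimensional integral elements of $\mathcal{I}$ that contain $E_x$. -/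

import Mathlib

open scoped Manifold ContDiff Topology
open Set Filter MeasureTheory

noncomputable section

namespace FieldTheory

/-! ### Differential forms on manifolds without boundary -/

section Forms

variable {E : Type*} [NormedAddCommGroup E] [NormedSpace ℝ E]
  {M : Type*} [TopologicalSpace M] [ChartedSpace E M]
  {E' : Type*} [NormedAddCommGroup E'] [NormedSpace ℝ E']
  {N : Type*} [TopologicalSpace N] [ChartedSpace E' N]

variable (E M) in
/-- A (not necessarily smooth) differential `k`-form on `M`: an alternating `k`-linear form on each
tangent space. The tangent space `TangentSpace 𝓘(ℝ, E) x` is, by definition, the model space `E`,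
and it is written so here and below; the tangent bundle is nevertheless that of Mathlib, not a
trivial one. Smoothness is the predicate `DForm.IsSmooth`. -/
abbrev DForm (k : ℕ) : Type _ := M → E [⋀^Fin k]→L[ℝ] ℝ

/-- The tangent map `T_x M → T_{f(x)} N`. -/
abbrev tanMap (f : M → N) (x : M) : E →L[ℝ] E' := mfderiv 𝓘(ℝ, E) 𝓘(ℝ, E') f x

namespace DForm

/-- The pullback `f^* η`. -/
def pullback {k : ℕ} (f : M → N) (η : DForm E' N k) : DForm E M k := fun x =>
  (η (f x)).compContinuousLinearMap (tanMap f x)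

/-- The interior product `Z ⌟ η` with a vector field, which is inserted in the first slot. -/
def interior {k : ℕ} (Z : M → E) (η : DForm E M (k + 1)) : DForm E M k := fun x =>
  (η x).curryLeft (Z x)

/-- The expression of `η` in the preferred chart at `c`: a form on the model space `E`, meaningful
on the (open) target of the chart. -/
def inChart {k : ℕ} (c : M) (η : DForm E M k) : E → E [⋀^Fin k]→L[ℝ] ℝ := fun y =>
  (η ((extChartAt 𝓘(ℝ, E) c).symm y)).compContinuousLinearMap
    (tanMap (extChartAt 𝓘(ℝ, E) c).symm y)

/-- A form is smooth if all its chart expressions are. -/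
def IsSmooth {k : ℕ} (η : DForm E M k) : Prop :=
  ∀ c : M, ContDiffOn ℝ ∞ (inChart c η) (extChartAt 𝓘(ℝ, E) c).target

/-- The exterior derivative, computed at `x` in the chart at `x`. -/
def d {k : ℕ} (η : DForm E M k) : DForm E M (k + 1) := fun x =>
  (extDeriv (inChart x η) (extChartAt 𝓘(ℝ, E) x x)).compContinuousLinearMap
    (tanMap (extChartAt 𝓘(ℝ, E) x) x)

/-- `γ = α ∧ β`, with the normalisation
`(α ∧ β)(v₁, …, v_{a+b}) = 1/(a! b!) ∑_π sgn(π) α(v_π(1), …, v_π(a)) β(v_π(a+1), …, v_π(a+b))`. -/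
def IsWedge {a b : ℕ} (α : DForm E M a) (β : DForm E M b) (γ : DForm E M (a + b)) : Prop :=
  ∀ (x : M) (v : Fin (a + b) → E),
    γ x v = ((a.factorial * b.factorial : ℕ) : ℝ)⁻¹ *
      ∑ π : Equiv.Perm (Fin (a + b)), ((Equiv.Perm.sign π : ℤ) : ℝ) *
        (α x (fun i => v (π (Fin.castAdd b i))) * β x (fun j => v (π (Fin.natAdd a j))))

end DForm

/-! ### Exterior differential systems -/

/-- Membership in the differential ideal `⟨G⟩_diff` generated by a set `G` of homogeneous forms: the
smallest family of forms that contains `G`, is an ideal for the wedge product with smooth forms, and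
is closed under the exterior derivative. (The ideal is graded, so its homogeneous elements determine
it; multiplication by functions is the case `a = 0` of `wedge`.) -/
inductive DiffIdeal (G : (k : ℕ) → DForm E M k → Prop) : (k : ℕ) → DForm E M k → Prop
  | gen {k : ℕ} {α : DForm E M k} : G k α → DiffIdeal G k α
  | zero (k : ℕ) : DiffIdeal G k 0
  | add {k : ℕ} {α β : DForm E M k} :
      DiffIdeal G k α → DiffIdeal G k β → DiffIdeal G k (α + β)
  | wedge {a b : ℕ} {β : DForm E M a} {α : DForm E M b} {γ : DForm E M (a + b)} :
      β.IsSmooth → DiffIdeal G b α → DForm.IsWedge β α γ → DiffIdeal G (a + b) γ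
  | d {k : ℕ} {α : DForm E M k} : DiffIdeal G k α → DiffIdeal G (k + 1) α.d

/-- The subspace `W` of `T_x M` is an integral element of dimension `p` of the system `J`. -/
def IsIntegralElement (J : (k : ℕ) → DForm E M k → Prop) (p : ℕ) (x : M)
    (W : Submodule ℝ E) : Prop :=
  Module.finrank ℝ W = p ∧ ∀ (k : ℕ) (α : DForm E M k), J k α →
    ∀ v : Fin k → E, (∀ i, v i ∈ W) → α x v = 0

/-- The polar space of an integral element `W ⊆ T_x M` of dimension `p`: the subspace generated by all
integral elements of dimension `p + 1` that contain `W`. -/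
def polarSpace (J : (k : ℕ) → DForm E M k → Prop) (p : ℕ) (x : M)
    (W : Submodule ℝ E) : Submodule ℝ E :=
  sSup {W' | IsIntegralElement J (p + 1) x W' ∧ W ≤ W'}

end Forms

/-! ### Integration over a compact oriented manifold -/

section Integration

variable {m : ℕ} {S : Type*} [TopologicalSpace S] [ChartedSpace (EuclideanSpace ℝ (Fin m)) S]

/-- The coefficient function of a top-degree form in the chart at `c`. -/
def DForm.coeff (c : S) (η : DForm (EuclideanSpace ℝ (Fin m)) S m)
    (y : EuclideanSpace ℝ (Fin m)) : ℝ :=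
  η.inChart c y (fun i => EuclideanSpace.single i (1 : ℝ))

variable (m S) in
/-- An orientation of `S`, given by a nowhere vanishing smooth form of top degree. Only its sign
enters the integral below. For `m = 0` this is the choice of a sign at every point. -/
structure OrientationForm where
  form : DForm (EuclideanSpace ℝ (Fin m)) S m
  smooth : form.IsSmooth
  ne_zero : ∀ x, form x ≠ 0

variable [IsManifold (𝓡 m) ∞ S] [T2Space S] [CompactSpace S]

variable (m S) in
/-- A smooth partition of unity subordinate to the cover of `S` by the domains of its preferred
charts. -/
def chartPartition : SmoothPartitionOfUnity S (𝓡 m) S univ :=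
  Classical.choose (SmoothPartitionOfUnity.exists_isSubordinate_chartAt_source (𝓡 m) S)

/-- The integral `∫_S η` of a form of top degree over the compact oriented manifold `S`: the sum
over the partition of unity `ρ` of the integrals of `ρ_c η` in the chart at `c`, with the sign of
that chart with respect to the orientation. -/
def DForm.integral (o : OrientationForm m S) (η : DForm (EuclideanSpace ℝ (Fin m)) S m) : ℝ :=
  ∑ᶠ c : S, ∫ y in (extChartAt (𝓡 m) c).target,
    (SignType.sign (o.form.coeff c y) : ℝ) *
      (chartPartition m S c ((extChartAt (𝓡 m) c).symm y) * η.coeff c y)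

end Integration

/-! ### Bundles, vertical vectors, semibasic forms -/

section Bundles

variable {EB : Type*} [NormedAddCommGroup EB] [NormedSpace ℝ EB]
  {B : Type*} [TopologicalSpace B] [ChartedSpace EB B]
  {EF : Type*} [NormedAddCommGroup EF] [NormedSpace ℝ EF]
  {F : Type*} [TopologicalSpace F] [ChartedSpace EF F]

variable (EB EF) in
/-- A smooth bundle `F → B`, in the general sense of a surjective submersion. -/
structure IsBundle (π : F → B) : Prop where
  submersion : Manifold.IsSubmersion 𝓘(ℝ, EF) 𝓘(ℝ, EB) ∞ π
  surjective : Function.Surjective π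

variable (EB) in
/-- `v ∈ V_p F`, the kernel of the differential of the projection. -/
def IsVertical (π : F → B) (p : F) (v : EF) : Prop :=
  tanMap (E' := EB) π p v = 0

variable (EB) in
/-- Every contraction of the form `α` with `j` vertical vectors vanishes (they may be inserted in
any `j` slots since `α` is alternating; if `j` exceeds the degree, this holds trivially). -/
def KilledByVertical {k : ℕ} (π : F → B) (j : ℕ) (α : DForm EF F k) : Prop :=
  ∀ (p : F) (v : Fin k → EF) (s : Finset (Fin k)), s.card = j →
    (∀ i ∈ s, IsVertical EB π p (v i)) → α p v = 0

variable (EB) in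
/-- `α ∈ Z_l(F)`, that is, `α` is an `l`-semibasic form. -/
def IsSemibasic {k : ℕ} (π : F → B) (l : ℕ) (α : DForm EF F k) : Prop :=
  KilledByVertical EB π (l + 1) α

variable (EB) in
/-- `α ∈ Z_l(F)` properly: `α` is in `Z_l(F)` but not in `Z_{l-1}(F)` (where `Z_{-1}(F) = 0`). -/
def IsProperlySemibasic {k : ℕ} (π : F → B) (l : ℕ) (α : DForm EF F k) : Prop :=
  IsSemibasic EB π l α ∧ ¬ KilledByVertical EB π l α

variable [IsManifold 𝓘(ℝ, EF) ∞ F]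

variable (EB) in
/-- The generators `Z ⌟ dλ` of the Hamilton-Cartan system, `Z` a smooth vertical vector field. -/
inductive HamiltonCartanGen {k : ℕ} (π : F → B) (lam : DForm EF F k) :
    (j : ℕ) → DForm EF F j → Prop
  | mk (Z : F → EF)
      (smooth : ContMDiff 𝓘(ℝ, EF) 𝓘(ℝ, EF).tangent ∞
        (fun p => (⟨p, Z p⟩ : TangentBundle 𝓘(ℝ, EF) F)))
      (vertical : ∀ p, IsVertical EB π p (Z p)) :
      HamiltonCartanGen π lam k (DForm.interior Z lam.d)

variable (EB) in
/-- The Hamilton-Cartan exterior differential system `⟨Z ⌟ dλ : Z ∈ Γ(VF)⟩_diff`. -/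
def hamiltonCartan {k : ℕ} (π : F → B) (lam : DForm EF F k) : (j : ℕ) → DForm EF F j → Prop :=
  DiffIdeal (HamiltonCartanGen EB π lam)

end Bundles

/-! ### The space of sections, its tangent spaces, and derivatives of functionals -/

section Sections

variable {ES : Type*} [NormedAddCommGroup ES] [NormedSpace ℝ ES]
  {S : Type*} [TopologicalSpace S] [ChartedSpace ES S]
  {EK : Type*} [NormedAddCommGroup EK] [NormedSpace ℝ EK]
  {K : Type*} [TopologicalSpace K] [ChartedSpace EK K]

variable (ES EK) in
/-- `Γ(K)`: the smooth sections of `π : K → S`. -/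
structure BundleSection (π : K → S) where
  toFun : S → K
  smooth : ContMDiff 𝓘(ℝ, ES) 𝓘(ℝ, EK) ∞ toFun
  section_eq : ∀ x, π (toFun x) = x

instance (π : K → S) : CoeFun (BundleSection ES EK π) (fun _ => S → K) := ⟨BundleSection.toFun⟩

variable [IsManifold 𝓘(ℝ, EK) ∞ K]

theorem contMDiff_along_combination {f : S → K} (hf : ContMDiff 𝓘(ℝ, ES) 𝓘(ℝ, EK) ∞ f)
    {V W : S → EK}
    (hV : ContMDiff 𝓘(ℝ, ES) 𝓘(ℝ, EK).tangent ∞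
      (fun x => (⟨f x, V x⟩ : TangentBundle 𝓘(ℝ, EK) K)))
    (hW : ContMDiff 𝓘(ℝ, ES) 𝓘(ℝ, EK).tangent ∞
      (fun x => (⟨f x, W x⟩ : TangentBundle 𝓘(ℝ, EK) K))) (a b : ℝ) :
    ContMDiff 𝓘(ℝ, ES) 𝓘(ℝ, EK).tangent ∞
      (fun x => (⟨f x, a • V x + b • W x⟩ : TangentBundle 𝓘(ℝ, EK) K)) := by
  intro x₀
  have h1 := (Bundle.contMDiffAt_totalSpace.1 (hV x₀)).2
  have h2 := (Bundle.contMDiffAt_totalSpace.1 (hW x₀)).2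
  refine Bundle.contMDiffAt_totalSpace.2 ⟨hf x₀, ?_⟩
  have h3 : ContMDiffAt 𝓘(ℝ, ES) 𝓘(ℝ, EK) ∞ (fun x =>
      a • (trivializationAt EK (TangentSpace 𝓘(ℝ, EK) : K → Type _) (f x₀) ⟨f x, V x⟩).2 +
      b • (trivializationAt EK (TangentSpace 𝓘(ℝ, EK) : K → Type _) (f x₀) ⟨f x, W x⟩).2) x₀ :=
    ((contMDiffAt_const (I' := 𝓘(ℝ, ℝ)) (c := a)).smul h1).add
      ((contMDiffAt_const (I' := 𝓘(ℝ, ℝ)) (c := b)).smul h2)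
  refine h3.congr_of_eventuallyEq ?_
  set e := trivializationAt EK (TangentSpace 𝓘(ℝ, EK) : K → Type _) (f x₀) with he
  have hmem : ∀ᶠ x in 𝓝 x₀, f x ∈ e.baseSet :=
    hf.continuous.continuousAt.eventually
      (e.open_baseSet.mem_nhds (FiberBundle.mem_baseSet_trivializationAt' (f x₀)))
  filter_upwards [hmem] with x hx
  have hl := e.linear ℝ hx
  exact (hl.map_add (a • V x) (b • W x)).trans
    (congrArg₂ (fun p q : EK => p + q) (hl.map_smul a (V x)) (hl.map_smul b (W x)))

theorem contMDiff_along_zero {f : S → K} (hf : ContMDiff 𝓘(ℝ, ES) 𝓘(ℝ, EK) ∞ f) :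
    ContMDiff 𝓘(ℝ, ES) 𝓘(ℝ, EK).tangent ∞
      (fun x => (⟨f x, (0 : EK)⟩ : TangentBundle 𝓘(ℝ, EK) K)) := by
  intro x₀
  refine Bundle.contMDiffAt_totalSpace.2 ⟨hf x₀, ?_⟩
  refine (contMDiffAt_const (c := (0 : EK))).congr_of_eventuallyEq ?_
  set e := trivializationAt EK (TangentSpace 𝓘(ℝ, EK) : K → Type _) (f x₀) with he
  have hmem : ∀ᶠ x in 𝓝 x₀, f x ∈ e.baseSet :=
    hf.continuous.continuousAt.eventually
      (e.open_baseSet.mem_nhds (FiberBundle.mem_baseSet_trivializationAt' (f x₀)))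
  filter_upwards [hmem] with x hx
  exact (e.linear ℝ hx).map_zero

/-- `T_σ Γ(K) = Γ(σ^*(VK))`: the smooth fields of vertical vectors along `σ`. -/
def BundleSection.tangent {π : K → S} (σ : BundleSection ES EK π) :
    Submodule ℝ (S → EK) where
  carrier := {V | ContMDiff 𝓘(ℝ, ES) 𝓘(ℝ, EK).tangent ∞
      (fun x => (⟨σ x, V x⟩ : TangentBundle 𝓘(ℝ, EK) K)) ∧ ∀ x, IsVertical ES π (σ x) (V x)}
  zero_mem' := ⟨contMDiff_along_zero σ.smooth, fun x => map_zero _⟩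
  add_mem' := by
    intro V W hV hW
    refine ⟨?_, fun x => ?_⟩
    · simpa using contMDiff_along_combination σ.smooth hV.1 hW.1 1 1
    · have h1 := hV.2 x
      have h2 := hW.2 x
      unfold IsVertical at h1 h2 ⊢
      rw [Pi.add_apply, map_add, h1, h2, add_zero]
  smul_mem' := by
    intro a V hV
    refine ⟨?_, fun x => ?_⟩
    · simpa using contMDiff_along_combination σ.smooth hV.1 hV.1 a 0
    · have h1 := hV.2 x
      unfold IsVertical at h1 ⊢
      rw [Pi.smul_apply, map_smul, h1, smul_zero]

/-- `γ` is a smooth one-parameter family of sections with `γ 0 = σ` and velocity `V` at `0`. -/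
structure IsVariation {π : K → S} (σ : BundleSection ES EK π) (V : σ.tangent)
    (γ : ℝ → BundleSection ES EK π) : Prop where
  smooth : ContMDiff (𝓘(ℝ, ℝ).prod 𝓘(ℝ, ES)) 𝓘(ℝ, EK) ∞ (fun q : ℝ × S => γ q.1 q.2)
  start : γ 0 = σ
  velocity : ∀ x, tanMap (E := ℝ) (E' := EK) (fun t : ℝ => γ t x) 0 1 = V.1 x

/-- The linear form `D` on `T_σ Γ(K)` is the differential (variational derivative) of the functional
`A` at `σ`: for every `V`, `D V` is the derivative at `0` of `A` along every smooth one-parameter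
family of sections through `σ` with velocity `V`. -/
def HasDifferentialAt {π : K → S} (A : BundleSection ES EK π → ℝ) (σ : BundleSection ES EK π)
    (D : σ.tangent →ₗ[ℝ] ℝ) : Prop :=
  ∀ (V : σ.tangent) (γ : ℝ → BundleSection ES EK π), IsVariation σ V γ →
    HasDerivAt (fun t => A (γ t)) (D V) 0

end Sections

/-! ### Slicings and the Hamiltonian data on the space of sections -/

section Slicing

variable {ES : Type*} [NormedAddCommGroup ES] [NormedSpace ℝ ES]
  {S : Type*} [TopologicalSpace S] [ChartedSpace ES S]
  {EK : Type*} [NormedAddCommGroup EK] [NormedSpace ℝ EK]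
  {K : Type*} [TopologicalSpace K] [ChartedSpace EK K]
  {EB : Type*} [NormedAddCommGroup EB] [NormedSpace ℝ EB]
  {B : Type*} [TopologicalSpace B] [ChartedSpace EB B]
  {EF : Type*} [NormedAddCommGroup EF] [NormedSpace ℝ EF]
  {F : Type*} [TopologicalSpace F] [ChartedSpace EF F]

variable (ES EK EB EF) in
/-- A compatible slicing of `πF : F → B` by `πK : K → S`: diffeomorphisms `ℝ × K ≅ F` and
`ℝ × S ≅ B` that intertwine `id × πK` and `πF`. -/
structure Slicing (πK : K → S) (πF : F → B) where
  sF : (ℝ × K) ≃ₘ^∞⟮𝓘(ℝ, ℝ).prod 𝓘(ℝ, EK), 𝓘(ℝ, EF)⟯ F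
  sB : (ℝ × S) ≃ₘ^∞⟮𝓘(ℝ, ℝ).prod 𝓘(ℝ, ES), 𝓘(ℝ, EB)⟯ B
  compat : ∀ (t : ℝ) (k : K), πF (sF (t, k)) = sB (t, πK k)

namespace Slicing

variable {πK : K → S} {πF : F → B} (s : Slicing ES EK EB EF πK πF)

/-- The embedding `i_τ : K → F` of the slice at time `τ`. -/
def incl (τ : ℝ) : K → F := fun k => s.sF (τ, k)

/-- The flow of `∂₀`: translation by `r` in the time direction. -/
def flow (r : ℝ) : F → F := fun p => s.sF ((s.sF.symm p).1 + r, (s.sF.symm p).2)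

/-- The vector field `∂₀` on `F`, tangent to the time direction. -/
def timeField : F → EF := fun p =>
  tanMap (E := ℝ) (E' := EF) (fun t : ℝ => s.sF (t, (s.sF.symm p).2)) (s.sF.symm p).1 1

/-- The Lie derivative of `η` along `∂₀`. -/
def timeLieDeriv {k : ℕ} (η : DForm EF F k) : DForm EF F k := fun p =>
  deriv (fun r : ℝ => DForm.pullback (s.flow r) η p) 0

/-- `Ω_τ = i_τ^* dλ`. -/
def Omega {k : ℕ} (lam : DForm EF F k) (τ : ℝ) : DForm EK K (k + 1) :=
  DForm.pullback (s.incl τ) lam.d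

/-- `𝓗_τ = i_τ^* (∂₀ ⌟ λ)`. -/
def hamForm {k : ℕ} (lam : DForm EF F (k + 1)) (τ : ℝ) : DForm EK K k :=
  DForm.pullback (s.incl τ) (DForm.interior s.timeField lam)

variable [IsManifold 𝓘(ℝ, EK) ∞ K]

/-- The form `σ^* (V ⌟ (X ⌟ Ω_τ - d𝓗_τ))` on `S`, for fields `X`, `V` of vertical vectors
along `σ`. -/
def hamEqForm {k : ℕ} (lam : DForm EF F (k + 1)) (τ : ℝ) (σ : BundleSection ES EK πK)
    (X V : σ.tangent) : DForm ES S k := fun x =>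
  (((s.Omega lam τ (σ x)).curryLeft (X.1 x) - (s.hamForm lam τ).d (σ x)).curryLeft (V.1 x))
    |>.compContinuousLinearMap (tanMap (E := ES) (E' := EK) σ x)

/-- The tangent space `T(i_τ ∘ σ)(T_x S)` of the lifted slice, a subspace of the tangent space
of `F`. -/
def sliceElement (τ : ℝ) (σ : BundleSection ES EK πK) (x : S) :
    Submodule ℝ EF :=
  LinearMap.range (tanMap (E := ES) (E' := EF) (fun y => s.incl τ (σ y)) x).toLinearMap

/-- The vector `∂₀ + X` at the point `i_τ(σ(x))`. -/
def evolutionVector (τ : ℝ) (σ : BundleSection ES EK πK) (X : σ.tangent) (x : S) :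
    EF :=
  s.timeField (s.incl τ (σ x)) + tanMap (E := EK) (E' := EF) (s.incl τ) (σ x) (X.1 x)

end Slicing

end Slicing

section Hamiltonian

variable {m : ℕ}
  {S : Type*} [TopologicalSpace S] [ChartedSpace (EuclideanSpace ℝ (Fin m)) S]
  [IsManifold (𝓡 m) ∞ S] [T2Space S] [CompactSpace S]
  {EK : Type*} [NormedAddCommGroup EK] [NormedSpace ℝ EK]
  {K : Type*} [TopologicalSpace K] [ChartedSpace EK K] [IsManifold 𝓘(ℝ, EK) ∞ K]
  {EB : Type*} [NormedAddCommGroup EB] [NormedSpace ℝ EB]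
  {B : Type*} [TopologicalSpace B] [ChartedSpace EB B]
  {EF : Type*} [NormedAddCommGroup EF] [NormedSpace ℝ EF]
  {F : Type*} [TopologicalSpace F] [ChartedSpace EF F]
  {πK : K → S} {πF : F → B}

namespace Slicing

variable (s : Slicing (EuclideanSpace ℝ (Fin m)) EK EB EF πK πF) (o : OrientationForm m S)
  (lam : DForm EF F (m + 1)) (τ : ℝ)

/-- The Hamiltonian `H_τ(σ) = ∫_S σ^* 𝓗_τ` on `Γ(K)`. -/
def hamiltonian (σ : BundleSection (EuclideanSpace ℝ (Fin m)) EK πK) : ℝ :=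
  DForm.integral o (DForm.pullback σ (s.hamForm lam τ))

/-- The presymplectic form `ω_τ|_σ (V₁, V₂) = ∫_S σ^* (Ω_τ(V₁, V₂, ·))` on `Γ(K)`. The integrand
depends on the values of `V₁`, `V₂` along `σ` only, so that no extension to `K` has to be chosen. -/
def presymplectic (σ : BundleSection (EuclideanSpace ℝ (Fin m)) EK πK)
    (V₁ V₂ : σ.tangent) : ℝ :=
  DForm.integral o fun x =>
    (((s.Omega lam τ (σ x)).curryLeft (V₁.1 x)).curryLeft (V₂.1 x)).compContinuousLinearMap
      (tanMap (E := EuclideanSpace ℝ (Fin m)) (E' := EK) σ x)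

end Slicing

end Hamiltonian

end FieldTheory

end

open FieldTheory

/-! Part 1 is the first variation formula followed by the fundamental lemma of the calculus of
variations. For a family of sections with velocity `V`, Cartan's homotopy formula
(`DForm.IsSmooth.hasDerivAt_pullback_family`) gives the derivative of `σ^* 𝓗_τ` as `σ^*(V ⌟ d𝓗_τ) +
d(σ^*(V ⌟ 𝓗_τ))`. The exact term integrates to zero by Stokes' theorem
(`DForm.IsSmooth.integral_d_eq_zero`), so `V ↦ ∫ σ^*(V ⌟ d𝓗_τ)` is a differential of `H_τ`. It is
the only one because every tangent vector is a finite sum of velocities of variations: a vertical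
field supported in one adapted chart is integrated by moving along straight lines in the fibre
coordinates (`exists_variation_of_tsupport_subset`), and a partition of unity does the rest.

The two sides of the Hamilton equations at `V` therefore differ by the integral of `σ^*(V ⌟ (X ⌟ Ω_τ
- d𝓗_τ))`. This integrand is linear in `V` over the smooth functions on `S`. If its integral
vanishes for all `V`, it also vanishes after multiplication with any function, and the form itself
is zero (`DForm.IsSmooth.eq_zero_of_integral_smul`).

Part 2 rests on a count of degrees. The generators `Z ⌟ dλ` have degree `n = m + 1`, so the system
contains no nonzero form of degree at most `m`, and every `m`-dimensional subspace is an integral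
element. On a subspace of dimension `m + 1`, forms of higher degree vanish automatically, so only
the generators have to be tested (`isIntegralElement_succ_iff`).

If `λ` is invariant under the flow of `∂₀`, Cartan's formula on a slice reads `i_τ^*(∂₀ ⌟ dλ) =
-d𝓗_τ`. Hence `X ⌟ Ω_τ - d𝓗_τ` is the restriction to the slice of `(∂₀ + X) ⌟ dλ`, and the Hamilton
equations say that `dλ(V, ∂₀ + X, e₁, …, e_m) = 0` for all vertical `V` and a frame `e` of `E_x`
(`hamEqForm_apply`). Vertical vectors of `F` are tangent to the slices and come from vertical
vectors of `K`, so this says that `E_x` together with `∂₀ + X` spans an integral element.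
Conversely, `w ↦ dλ(V, w, e₁, …, e_m)` is linear and kills every `n`-dimensional integral element
containing `E_x`, hence the whole polar space. -/

noncomputable section

set_option linter.unusedSectionVars false

namespace FieldTheory

/-! ### Calculus of alternating forms on vector spaces -/

section VectorSpaceCalculus

variable {A : Type*} [NormedAddCommGroup A] [NormedSpace ℝ A]
  {E : Type*} [NormedAddCommGroup E] [NormedSpace ℝ E]

variable (E) in
/-- Insertion of a vector in the first slot, as a continuous linear map. -/
def curryLeftCLM (k : ℕ) : (E [⋀^Fin (k + 1)]→L[ℝ] ℝ) →L[ℝ] (E →L[ℝ] E [⋀^Fin k]→L[ℝ] ℝ) :=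
  (ContinuousAlternatingMap.curryLeftLI (𝕜 := ℝ) (E := E) (F := ℝ)
    (n := k)).toContinuousLinearMap

theorem ContDiffAt.curryLeft {n : WithTop ℕ∞} {k : ℕ} {L : A → E [⋀^Fin (k + 1)]→L[ℝ] ℝ} {a : A}
    (hL : ContDiffAt ℝ n L a) : ContDiffAt ℝ n (fun y => (L y).curryLeft) a :=
  have h : ContDiff ℝ n (fun l : E [⋀^Fin (k + 1)]→L[ℝ] ℝ => curryLeftCLM E k l) := by
    exact ContinuousLinearMap.contDiff (𝕜 := ℝ) (n := n) (E := E [⋀^Fin (k + 1)]→L[ℝ] ℝ)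
      (F := E →L[ℝ] E [⋀^Fin k]→L[ℝ] ℝ) (curryLeftCLM E k)
  h.contDiffAt.comp a hL

theorem DifferentiableAt.curryLeft {k : ℕ} {L : A → E [⋀^Fin (k + 1)]→L[ℝ] ℝ} {a : A}
    (hL : DifferentiableAt ℝ L a) : DifferentiableAt ℝ (fun y => (L y).curryLeft) a :=
  DifferentiableAt.comp a (g := fun l : E [⋀^Fin (k + 1)]→L[ℝ] ℝ => l.curryLeft)
    (ContinuousLinearMap.differentiableAt (E := E [⋀^Fin (k + 1)]→L[ℝ] ℝ)
      (F := E →L[ℝ] E [⋀^Fin k]→L[ℝ] ℝ) (curryLeftCLM E k)) hL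

/-- Currying off one argument at a time reduces the claim to applying a smooth family of continuous
linear maps to a smooth vector. -/
theorem contDiffAt_alternating_apply {n : WithTop ℕ∞} {k : ℕ} {L : A → E [⋀^Fin k]→L[ℝ] ℝ}
    {u : Fin k → A → E} {a : A} (hL : ContDiffAt ℝ n L a) (hu : ∀ i, ContDiffAt ℝ n (u i) a) :
    ContDiffAt ℝ n (fun y => L y (fun i => u i y)) a := by
  induction k with
  | zero =>
    have h : (fun y => L y (fun i => u i y)) = fun y =>
        (ContinuousAlternatingMap.apply ℝ E ℝ (![] : Fin 0 → E)) (L y) := by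
      funext y
      simp only [ContinuousAlternatingMap.apply_apply]
      congr 1
      exact Subsingleton.elim _ _
    rw [h]
    exact (ContinuousLinearMap.contDiff _).contDiffAt.comp a hL
  | succ k ih =>
    have h : (fun y => L y (fun i => u i y)) = fun y =>
        ((L y).curryLeft (u 0 y)) (fun i => u (Fin.succ i) y) := by
      funext y
      rw [ContinuousAlternatingMap.curryLeft_apply_apply]
      congr 1
      funext i
      refine Fin.cases ?_ (fun j => ?_) i <;> simp
    rw [h]
    exact ih ((ContDiffAt.curryLeft hL).clm_apply (hu 0)) (fun i => hu _)

theorem contDiffAt_clm_of_apply {F : Type*} [NormedAddCommGroup F] [NormedSpace ℝ F]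
    [FiniteDimensional ℝ E] {n : WithTop ℕ∞} {f : A → E →L[ℝ] F} {a : A}
    (h : ∀ v, ContDiffAt ℝ n (fun y => f y v) a) : ContDiffAt ℝ n f a := by
  let d := Module.finrank ℝ E
  have hd : d = Module.finrank ℝ (Fin d → ℝ) := (Module.finrank_fin_fun ℝ).symm
  let e₁ := ContinuousLinearEquiv.ofFinrankEq hd
  let e₂ := (e₁.arrowCongr (1 : F ≃L[ℝ] F)).trans (ContinuousLinearEquiv.piRing (Fin d))
  rw [← Function.id_comp f, ← e₂.symm_comp_self]
  exact e₂.symm.contDiff.contDiffAt.comp a (contDiffAt_pi.mpr fun i => h _)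

theorem contDiffAt_alternatizeUncurryFin {n : WithTop ℕ∞} {k : ℕ}
    {L : A → E →L[ℝ] E [⋀^Fin k]→L[ℝ] ℝ} {a : A} (hL : ContDiffAt ℝ n L a) :
    ContDiffAt ℝ n
      (fun y => ContinuousAlternatingMap.alternatizeUncurryFinCLM ℝ E ℝ (L y)) a :=
  have h : ContDiff ℝ n (fun l : E →L[ℝ] E [⋀^Fin k]→L[ℝ] ℝ =>
      ContinuousAlternatingMap.alternatizeUncurryFinCLM ℝ E ℝ l) := by
    exact ContinuousLinearMap.contDiff (𝕜 := ℝ) (n := n) (E := E →L[ℝ] E [⋀^Fin k]→L[ℝ] ℝ)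
      (F := E [⋀^Fin (k + 1)]→L[ℝ] ℝ)
      (ContinuousAlternatingMap.alternatizeUncurryFinCLM ℝ E ℝ)
  h.contDiffAt.comp a hL

theorem contDiffAt_alternating_of_apply [FiniteDimensional ℝ E] {n : WithTop ℕ∞} {k : ℕ}
    {L : A → E [⋀^Fin k]→L[ℝ] ℝ} {a : A} (h : ∀ v, ContDiffAt ℝ n (fun y => L y v) a) :
    ContDiffAt ℝ n L a := by
  induction k with
  | zero =>
    have hL : L = fun y => ContinuousAlternatingMap.constOfIsEmptyLIE ℝ E ℝ (Fin 0) (L y ![]) := by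
      funext y
      ext v
      simp only [ContinuousAlternatingMap.constOfIsEmptyLIE_apply,
        ContinuousAlternatingMap.constOfIsEmpty_apply]
      congr 1
      exact Subsingleton.elim _ _
    rw [hL]
    exact (ContinuousAlternatingMap.constOfIsEmptyLIE ℝ E ℝ (Fin 0)).contDiff.contDiffAt.comp a
      (h ![])
  | succ k ih =>
    have hc : ContDiffAt ℝ n (fun y => (L y).curryLeft) a :=
      contDiffAt_clm_of_apply fun v => ih fun w => h (Matrix.vecCons v w)
    -- Alternatizing the curried form returns `k + 1` times the form, so `L` is recovered linearly
    -- from `(L y).curryLeft`.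
    have hL : L = fun y => ((k : ℝ) + 1)⁻¹ •
        ContinuousAlternatingMap.alternatizeUncurryFinCLM ℝ E ℝ (L y).curryLeft := by
      funext y
      ext v
      have hk : (k : ℝ) + 1 ≠ 0 := by positivity
      simp [hk, ContinuousAlternatingMap.smul_apply]
    rw [hL]
    exact (contDiffAt_alternatizeUncurryFin hc).const_smul ((k : ℝ) + 1)⁻¹

theorem contDiffAt_extDeriv {k : ℕ} {w : E → E [⋀^Fin k]→L[ℝ] ℝ} {y : E}
    (h : ContDiffAt ℝ ∞ w y) : ContDiffAt ℝ ∞ (extDeriv w) y :=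
  contDiffAt_alternatizeUncurryFin (h.fderiv_right (m := ∞) (by simp))

/-- Cartan's formula for the translations in the first factor of `ℝ × E`. -/
theorem hasDerivAt_slice_form {k : ℕ} {w : ℝ × E → (ℝ × E) [⋀^Fin (k + 1)]→L[ℝ] ℝ} {t : ℝ} {y : E}
    (h : DifferentiableAt ℝ w (t, y)) (v : Fin (k + 1) → E) :
    HasDerivAt (fun r : ℝ => w (r, y) (fun i => ((0 : ℝ), v i)))
      (extDeriv w (t, y) (Matrix.vecCons ((1 : ℝ), (0 : E)) (fun i => ((0 : ℝ), v i))) +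
        extDeriv (fun z => ((w (t, z)).curryLeft ((1 : ℝ), (0 : E))).compContinuousLinearMap
          (ContinuousLinearMap.inr ℝ ℝ E)) y v) t := by
  have h1 : HasFDerivAt (fun q => w q (fun i => ((0 : ℝ), v i)))
      (fderiv ℝ (fun q => w q (fun i => ((0 : ℝ), v i))) (t, y)) (t, y) :=
    (h.continuousAlternatingMap_apply (fun i => differentiableAt_const _)).hasFDerivAt
  have h2 : HasDerivAt (fun r : ℝ => ((r, y) : ℝ × E)) ((1 : ℝ), (0 : E)) t :=
    (hasDerivAt_id t).prodMk (hasDerivAt_const t y)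
  have h3 := h1.comp_hasDerivAt t h2
  refine h3.congr_deriv (Eq.symm ?_)
  have hsl : DifferentiableAt ℝ (fun z : E => w (t, z)) y :=
    h.comp y ((differentiableAt_const t).prodMk differentiableAt_id)
  have hd : DifferentiableAt ℝ (fun z => ((w (t, z)).curryLeft
      ((1 : ℝ), (0 : E))).compContinuousLinearMap (ContinuousLinearMap.inr ℝ ℝ E)) y := by
    have hL : DifferentiableAt ℝ (fun z => (w (t, z)).curryLeft ((1 : ℝ), (0 : E))) y :=
      (DifferentiableAt.curryLeft hsl).clm_apply (differentiableAt_const _)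
    exact hL.continuousAlternatingMapCompContinuousLinearMap (differentiableAt_const _)
  -- Index `0` is the time derivative. Each later index has the sign `(-1)^(i+1)` and cancels the
  -- matching term of the exterior derivative of the contracted form.
  rw [extDeriv_apply h, extDeriv_apply hd, Fin.sum_univ_succ, add_assoc, ← Finset.sum_add_distrib]
  rw [Finset.sum_eq_zero, add_zero]
  · simp [Fin.removeNth_zero]
  · intro i _
    have e1 : ∀ q, w q ((Fin.succ i).removeNth (Matrix.vecCons ((1 : ℝ), (0 : E))
        (fun i => ((0 : ℝ), v i)))) =
        w q (Matrix.vecCons ((1 : ℝ), (0 : E)) (fun j => ((0 : ℝ), i.removeNth v j))) := by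
      intro q
      congr 1
      funext j
      refine Fin.cases ?_ (fun j => ?_) j <;> simp [Fin.removeNth]
    simp only [e1]
    have hv : DifferentiableAt ℝ (fun q => w q (Matrix.vecCons ((1 : ℝ), (0 : E))
        (fun j => ((0 : ℝ), i.removeNth v j)))) (t, y) :=
      h.continuousAlternatingMap_apply (fun i => differentiableAt_const _)
    have e2 : fderiv ℝ (fun z => (((w (t, z)).curryLeft
        ((1 : ℝ), (0 : E))).compContinuousLinearMap (ContinuousLinearMap.inr ℝ ℝ E))
          (i.removeNth v)) y (v i) =
        fderiv ℝ (fun q => w q (Matrix.vecCons ((1 : ℝ), (0 : E))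
        (fun j => ((0 : ℝ), i.removeNth v j)))) (t, y) ((0 : ℝ), v i) := by
      have hin : HasFDerivAt (fun z : E => ((t, z) : ℝ × E)) (ContinuousLinearMap.inr ℝ ℝ E) y :=
        hasFDerivAt_prodMk_right t y
      have := (hv.hasFDerivAt.comp y hin).fderiv
      have h4 := congrArg (fun l : E →L[ℝ] ℝ => l (v i)) this
      simpa [Function.comp_def] using h4
    rw [e2]
    simp [pow_succ]

/-- Integration by parts against the constant function `1`; compact support makes every term
integrable. -/
theorem integral_fderiv_apply_eq_zero [FiniteDimensional ℝ E] [MeasurableSpace E] [BorelSpace E]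
    (μ : Measure E) [μ.IsAddHaarMeasure] {f : E → ℝ} (hf : ContDiff ℝ 1 f)
    (hs : HasCompactSupport f) (v : E) : ∫ x, fderiv ℝ f x v ∂μ = 0 := by
  have hc : Continuous fun x => fderiv ℝ f x v :=
    (hf.continuous_fderiv one_ne_zero).clm_apply continuous_const
  have hcs : HasCompactSupport fun x => fderiv ℝ f x v := hs.fderiv_apply (𝕜 := ℝ) v
  have := integral_mul_fderiv_eq_neg_fderiv_mul_of_integrable (μ := μ) (f := fun _ : E => (1 : ℝ))
    (g := f) (v := v) (by simp) (by simpa using hc.integrable_of_hasCompactSupport hcs)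
    (by simpa using hf.continuous.integrable_of_hasCompactSupport hs)
    (fun x _ => differentiableAt_const _) (fun x _ => hf.differentiable one_ne_zero x)
  simpa using this

end VectorSpaceCalculus

/-! ### Tangent maps and charts -/

section TangentMaps

variable {A : Type*} [NormedAddCommGroup A] [NormedSpace ℝ A]
  {E : Type*} [NormedAddCommGroup E] [NormedSpace ℝ E]
  {M : Type*} [TopologicalSpace M] [ChartedSpace E M]
  {E' : Type*} [NormedAddCommGroup E'] [NormedSpace ℝ E']
  {N : Type*} [TopologicalSpace N] [ChartedSpace E' N]
  {E'' : Type*} [NormedAddCommGroup E''] [NormedSpace ℝ E'']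
  {P : Type*} [TopologicalSpace P] [ChartedSpace E'' P]

theorem tanMap_comp {g : N → P} {f : M → N} {x : M}
    (hg : MDifferentiableAt 𝓘(ℝ, E') 𝓘(ℝ, E'') g (f x))
    (hf : MDifferentiableAt 𝓘(ℝ, E) 𝓘(ℝ, E') f x) :
    tanMap (E := E) (E' := E'') (fun y => g (f y)) x =
      (tanMap (E := E') (E' := E'') g (f x)).comp (tanMap (E := E) (E' := E') f x) :=
  mfderiv_comp x hg hf

theorem tanMap_eq_fderiv {f : A → E} {a : A} : tanMap (E := A) (E' := E) f a = fderiv ℝ f a :=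
  mfderiv_eq_fderiv

theorem extChartAt_target_mem_nhds_of_mem {c : M} {y : E}
    (hy : y ∈ (extChartAt 𝓘(ℝ, E) c).target) : (extChartAt 𝓘(ℝ, E) c).target ∈ 𝓝 y :=
  (isOpen_extChartAt_target c).mem_nhds hy

variable [IsManifold 𝓘(ℝ, E) ∞ M] [IsManifold 𝓘(ℝ, E') ∞ N]

theorem contMDiffAt_chart {c x : M} (hx : x ∈ (extChartAt 𝓘(ℝ, E) c).source) :
    ContMDiffAt 𝓘(ℝ, E) 𝓘(ℝ, E) ∞ (extChartAt 𝓘(ℝ, E) c) x :=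
  contMDiffAt_extChartAt' (by simpa using hx)

theorem contMDiffAt_chart_symm {c : M} {y : E} (hy : y ∈ (extChartAt 𝓘(ℝ, E) c).target) :
    ContMDiffAt 𝓘(ℝ, E) 𝓘(ℝ, E) ∞ (extChartAt 𝓘(ℝ, E) c).symm y :=
  (contMDiffOn_extChartAt_symm c).contMDiffAt (extChartAt_target_mem_nhds_of_mem hy)

theorem mdifferentiableAt_chart {c x : M} (hx : x ∈ (extChartAt 𝓘(ℝ, E) c).source) :
    MDifferentiableAt 𝓘(ℝ, E) 𝓘(ℝ, E) (extChartAt 𝓘(ℝ, E) c) x :=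
  (contMDiffAt_chart hx).mdifferentiableAt (by simp)

theorem mdifferentiableAt_chart_symm {c : M} {y : E} (hy : y ∈ (extChartAt 𝓘(ℝ, E) c).target) :
    MDifferentiableAt 𝓘(ℝ, E) 𝓘(ℝ, E) (extChartAt 𝓘(ℝ, E) c).symm y :=
  (contMDiffAt_chart_symm hy).mdifferentiableAt (by simp)

theorem tanMap_id_of_eventuallyEq {f : M → M} {x : M} (h : f =ᶠ[𝓝 x] id) :
    tanMap (E := E) (E' := E) f x = ContinuousLinearMap.id ℝ E := by
  unfold tanMap
  rw [h.mfderiv_eq]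
  exact mfderiv_id

theorem tanMap_symm_comp_chart {c x : M} (hx : x ∈ (extChartAt 𝓘(ℝ, E) c).source) :
    (tanMap (E := E) (E' := E) (extChartAt 𝓘(ℝ, E) c).symm (extChartAt 𝓘(ℝ, E) c x)).comp
      (tanMap (E := E) (E' := E) (extChartAt 𝓘(ℝ, E) c) x) = ContinuousLinearMap.id ℝ E := by
  rw [← tanMap_comp (mdifferentiableAt_chart_symm ((extChartAt 𝓘(ℝ, E) c).map_source hx))
    (mdifferentiableAt_chart hx)]
  apply tanMap_id_of_eventuallyEq
  filter_upwards [(isOpen_extChartAt_source c).mem_nhds hx] with z hz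
  exact (extChartAt 𝓘(ℝ, E) c).left_inv hz

/-- The fibre of the tangent bundle at `c` is identified with `E` through the preferred chart at
`c`. Forms evaluated at the centre of a chart therefore agree with their chart expressions. -/
theorem tanMap_chart_self (c : M) :
    tanMap (E := E) (E' := E) (extChartAt 𝓘(ℝ, E) c) c = ContinuousLinearMap.id ℝ E := by
  have : IsManifold 𝓘(ℝ, E) 1 M := IsManifold.of_le (n := ∞) (by simp)
  exact mfderiv_extChartAt_self

theorem tanMap_chart_symm_self (c : M) :
    tanMap (E := E) (E' := E) (extChartAt 𝓘(ℝ, E) c).symm (extChartAt 𝓘(ℝ, E) c c) =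
      ContinuousLinearMap.id ℝ E := by
  have h := tanMap_symm_comp_chart (E := E) (mem_extChartAt_source (I := 𝓘(ℝ, E)) c)
  rwa [tanMap_chart_self, ContinuousLinearMap.comp_id] at h

/-- Smoothness of a vector field along a map, in terms of coordinates on the target. -/
theorem contMDiffAt_along_iff {H : Type*} [TopologicalSpace H] {I : ModelWithCorners ℝ A H}
    {L : Type*} [TopologicalSpace L] [ChartedSpace H L] {f : L → N} {u : L → E'} {a : L} :
    ContMDiffAt I 𝓘(ℝ, E').tangent ∞ (fun y => (⟨f y, u y⟩ : TangentBundle 𝓘(ℝ, E') N)) a ↔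
      ContMDiffAt I 𝓘(ℝ, E') ∞ f a ∧ ContMDiffAt I 𝓘(ℝ, E') ∞
        (fun y => tanMap (E := E') (E' := E') (extChartAt 𝓘(ℝ, E') (f a)) (f y) (u y)) a := by
  have : IsManifold 𝓘(ℝ, E') 1 N := IsManifold.of_le (n := ∞) (by simp)
  rw [Bundle.contMDiffAt_totalSpace]
  refine and_congr_right fun hf => ?_
  apply Filter.EventuallyEq.contMDiffAt_iff
  filter_upwards [hf.continuousAt.eventually ((chartAt E' (f a)).open_source.mem_nhds
    (mem_chart_source E' (f a)))] with y hy
  have h := TangentBundle.continuousLinearMapAt_trivializationAt (I := 𝓘(ℝ, E')) hy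
  have h2 := congrArg (fun l : E' →L[ℝ] E' => l (u y)) h
  refine Eq.trans ?_ h2
  have hb : f y ∈ (trivializationAt E' (TangentSpace 𝓘(ℝ, E') : N → Type _) (f a)).baseSet := by
    exact hy
  exact (congrFun (Bundle.Trivialization.coe_linearMapAt_of_mem (R := ℝ)
    (trivializationAt E' (TangentSpace 𝓘(ℝ, E') : N → Type _) (f a)) hb) (u y)).symm

theorem eventually_mdifferentiableAt {f : M → N} {a : M}
    (hf : ContMDiffAt 𝓘(ℝ, E) 𝓘(ℝ, E') ∞ f a) :
    ∀ᶠ y in 𝓝 a, MDifferentiableAt 𝓘(ℝ, E) 𝓘(ℝ, E') f y := by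
  have : IsManifold 𝓘(ℝ, E) 1 M := IsManifold.of_le (n := ∞) (by simp)
  have : IsManifold 𝓘(ℝ, E') 1 N := IsManifold.of_le (n := ∞) (by simp)
  have h1 : ContMDiffAt 𝓘(ℝ, E) 𝓘(ℝ, E') 1 f a := hf.of_le (by simp)
  filter_upwards [(contMDiffAt_iff_contMDiffAt_nhds (by simp)).1 h1] with y hy
  exact hy.mdifferentiableAt (by simp)

variable (E') in
theorem eventually_mem_chart_source {f : A → N} {a : A} (hf : ContinuousAt f a) :
    ∀ᶠ y in 𝓝 a, f y ∈ (extChartAt 𝓘(ℝ, E') (f a)).source :=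
  hf.eventually ((isOpen_extChartAt_source (f a)).mem_nhds (mem_extChartAt_source (f a)))

/-- In a chart of the target the field is the derivative of the coordinate expression of `f`,
applied to a constant vector. -/
theorem contMDiffAt_along_tanMap {f : A → N} {a : A} (hf : ContMDiffAt 𝓘(ℝ, A) 𝓘(ℝ, E') ∞ f a)
    (w : A) : ContMDiffAt 𝓘(ℝ, A) 𝓘(ℝ, E').tangent ∞
      (fun y => (⟨f y, tanMap (E := A) (E' := E') f y w⟩ : TangentBundle 𝓘(ℝ, E') N)) a := by
  refine contMDiffAt_along_iff.2 ⟨hf, ?_⟩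
  have hg : ContDiffAt ℝ ∞ (fun y => extChartAt 𝓘(ℝ, E') (f a) (f y)) a :=
    (ContMDiffAt.comp a (contMDiffAt_chart (mem_extChartAt_source (f a))) hf).contDiffAt
  have h2 : ContDiffAt ℝ ∞ (fun y => fderiv ℝ (fun y => extChartAt 𝓘(ℝ, E') (f a) (f y)) y w) a :=
    (hg.fderiv_right (m := ∞) (by simp)).clm_apply contDiffAt_const
  refine h2.contMDiffAt.congr_of_eventuallyEq ?_
  filter_upwards [eventually_mdifferentiableAt hf, eventually_mem_chart_source E' hf.continuousAt]
    with y h3 h4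
  rw [← tanMap_eq_fderiv, tanMap_comp (mdifferentiableAt_chart h4) h3]
  rfl

end TangentMaps

/-! ### Smooth forms, pullbacks and naturality of the exterior derivative -/

section FormsOnManifolds

variable {A : Type*} [NormedAddCommGroup A] [NormedSpace ℝ A]
  {E : Type*} [NormedAddCommGroup E] [NormedSpace ℝ E]
  {M : Type*} [TopologicalSpace M] [ChartedSpace E M]
  {E' : Type*} [NormedAddCommGroup E'] [NormedSpace ℝ E']
  {N : Type*} [TopologicalSpace N] [ChartedSpace E' N]
  {E'' : Type*} [NormedAddCommGroup E''] [NormedSpace ℝ E'']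
  {P : Type*} [TopologicalSpace P] [ChartedSpace E'' P]

theorem DForm.pullback_comp_apply {k : ℕ} {g : N → P} {f : M → N} {x : M} (η : DForm E'' P k)
    (hg : MDifferentiableAt 𝓘(ℝ, E') 𝓘(ℝ, E'') g (f x))
    (hf : MDifferentiableAt 𝓘(ℝ, E) 𝓘(ℝ, E') f x) :
    DForm.pullback (E := E) (fun y => g (f y)) η x =
      (DForm.pullback (E := E') g η (f x)).compContinuousLinearMap
        (tanMap (E := E) (E' := E') f x) := by
  unfold DForm.pullback
  rw [tanMap_comp hg hf]
  rfl

variable [IsManifold 𝓘(ℝ, E) ∞ M] [IsManifold 𝓘(ℝ, E') ∞ N]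

theorem DForm.apply_eq_inChart {k : ℕ} (η : DForm E' N k) {c p : N}
    (hp : p ∈ (extChartAt 𝓘(ℝ, E') c).source) (v : Fin k → E') :
    η p v = η.inChart c (extChartAt 𝓘(ℝ, E') c p)
      (fun i => tanMap (E := E') (E' := E') (extChartAt 𝓘(ℝ, E') c) p (v i)) := by
  unfold DForm.inChart
  have h : ∀ w, tanMap (E := E') (E' := E') (extChartAt 𝓘(ℝ, E') c).symm
      (extChartAt 𝓘(ℝ, E') c p) (tanMap (E := E') (E' := E') (extChartAt 𝓘(ℝ, E') c) p w) = w :=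
    fun w => congrArg (fun l : E' →L[ℝ] E' => l w) (tanMap_symm_comp_chart hp)
  rw [ContinuousAlternatingMap.compContinuousLinearMap_apply, (extChartAt 𝓘(ℝ, E') c).left_inv hp]
  congr 1
  funext i
  exact (h (v i)).symm

theorem DForm.eq_inChart_comp {k : ℕ} (η : DForm E' N k) {c p : N}
    (hp : p ∈ (extChartAt 𝓘(ℝ, E') c).source) :
    η p = (η.inChart c (extChartAt 𝓘(ℝ, E') c p)).compContinuousLinearMap
      (tanMap (E := E') (E' := E') (extChartAt 𝓘(ℝ, E') c) p) :=
  ContinuousAlternatingMap.ext fun v => η.apply_eq_inChart hp v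

theorem DForm.IsSmooth.contDiffAt {k : ℕ} {η : DForm E' N k} (hη : η.IsSmooth) {c : N} {y : E'}
    (hy : y ∈ (extChartAt 𝓘(ℝ, E') c).target) : ContDiffAt ℝ ∞ (η.inChart c) y :=
  (hη c).contDiffAt (extChartAt_target_mem_nhds_of_mem hy)

theorem DForm.IsSmooth.of_apply [FiniteDimensional ℝ E] {k : ℕ} {θ : DForm E M k}
    (h : ∀ (c : M), ∀ y ∈ (extChartAt 𝓘(ℝ, E) c).target, ∀ v : Fin k → E,
      ContDiffAt ℝ ∞ (fun z => θ.inChart c z v) y) : θ.IsSmooth := fun c y hy =>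
  (contDiffAt_alternating_of_apply (h c y hy)).contDiffWithinAt

/-- The function `y ↦ η(u₁(y), …, u_k(y))` is smooth for a smooth form `η` and smooth vector
fields `u_i` along a smooth map. -/
theorem DForm.IsSmooth.contDiffAt_along {k : ℕ} {η : DForm E' N k} (hη : η.IsSmooth) {f : A → N}
    {a : A} (hf : ContMDiffAt 𝓘(ℝ, A) 𝓘(ℝ, E') ∞ f a) {u : Fin k → A → E'}
    (hu : ∀ i, ContMDiffAt 𝓘(ℝ, A) 𝓘(ℝ, E').tangent ∞
      (fun y => (⟨f y, u i y⟩ : TangentBundle 𝓘(ℝ, E') N)) a) :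
    ContDiffAt ℝ ∞ (fun y => η (f y) (fun i => u i y)) a := by
  have hg : ContDiffAt ℝ ∞ (fun y => extChartAt 𝓘(ℝ, E') (f a) (f y)) a :=
    (ContMDiffAt.comp a (contMDiffAt_chart (mem_extChartAt_source (f a))) hf).contDiffAt
  have h1 : ContDiffAt ℝ ∞ (fun y => η.inChart (f a) (extChartAt 𝓘(ℝ, E') (f a) (f y))) a :=
    ContDiffAt.comp a (hη.contDiffAt (mem_extChartAt_target (f a))) hg
  have h2 := contDiffAt_alternating_apply h1 (u := fun i y =>
    tanMap (E := E') (E' := E') (extChartAt 𝓘(ℝ, E') (f a)) (f y) (u i y))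
    (fun i => (contMDiffAt_along_iff.1 (hu i)).2.contDiffAt)
  refine h2.congr_of_eventuallyEq ?_
  filter_upwards [eventually_mem_chart_source E' hf.continuousAt] with y hy
  exact η.apply_eq_inChart hy _

theorem DForm.IsSmooth.contDiffAt_pullback [FiniteDimensional ℝ A] {k : ℕ} {η : DForm E' N k}
    (hη : η.IsSmooth) {f : A → N} {a : A} (hf : ContMDiffAt 𝓘(ℝ, A) 𝓘(ℝ, E') ∞ f a) :
    ContDiffAt ℝ ∞ (DForm.pullback (E := A) f η) a :=
  contDiffAt_alternating_of_apply fun v => hη.contDiffAt_along hf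
    (fun i => contMDiffAt_along_tanMap hf (v i))

/-- The exterior derivative commutes with the pullback to a vector space. -/
theorem DForm.IsSmooth.extDeriv_pullback {k : ℕ} {η : DForm E' N k} (hη : η.IsSmooth) {f : A → N}
    {a : A} (hf : ContMDiffAt 𝓘(ℝ, A) 𝓘(ℝ, E') ∞ f a) :
    extDeriv (DForm.pullback (E := A) f η) a = DForm.pullback (E := A) f η.d a := by
  have hg : ContDiffAt ℝ ∞ (fun y => extChartAt 𝓘(ℝ, E') (f a) (f y)) a :=
    (ContMDiffAt.comp a (contMDiffAt_chart (mem_extChartAt_source (f a))) hf).contDiffAt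
  have hd : ∀ᶠ y in 𝓝 a, fderiv ℝ (fun y => extChartAt 𝓘(ℝ, E') (f a) (f y)) y =
      (tanMap (E := E') (E' := E') (extChartAt 𝓘(ℝ, E') (f a)) (f y)).comp
        (tanMap (E := A) (E' := E') f y) := by
    filter_upwards [eventually_mdifferentiableAt hf, eventually_mem_chart_source E' hf.continuousAt]
      with y h3 h4
    rw [← tanMap_eq_fderiv, tanMap_comp (mdifferentiableAt_chart h4) h3]
  -- Near `a` the map stays in one chart of `N`, so the pullback factors through the chart
  -- expression of `η` and a map between vector spaces.
  have he : DForm.pullback (E := A) f η =ᶠ[𝓝 a] fun y =>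
      (η.inChart (f a) (extChartAt 𝓘(ℝ, E') (f a) (f y))).compContinuousLinearMap
        (fderiv ℝ (fun y => extChartAt 𝓘(ℝ, E') (f a) (f y)) y) := by
    filter_upwards [hd, eventually_mem_chart_source E' hf.continuousAt] with y h3 h4
    rw [h3]
    unfold DForm.pullback
    rw [η.eq_inChart_comp h4]
    rfl
  rw [he.extDeriv_eq, _root_.extDeriv_pullback (r := ∞)
    (f := fun y => extChartAt 𝓘(ℝ, E') (f a) (f y))
    ((hη.contDiffAt (mem_extChartAt_target (f a))).differentiableAt (by simp)) hg (by simpa using ENat.LEInfty.out),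
    hd.self_of_nhds]
  rfl

/-- Since `d` is computed at each point in that point's own chart, independence of the chart has to
be shown; it is naturality of `d` applied to the inverse chart at `c`. -/
theorem DForm.IsSmooth.inChart_d {k : ℕ} {η : DForm E' N k} (hη : η.IsSmooth) {c : N} {y : E'}
    (hy : y ∈ (extChartAt 𝓘(ℝ, E') c).target) : η.d.inChart c y = extDeriv (η.inChart c) y :=
  (hη.extDeriv_pullback (contMDiffAt_chart_symm hy)).symm

theorem DForm.IsSmooth.d {k : ℕ} {η : DForm E' N k} (hη : η.IsSmooth) : η.d.IsSmooth := by
  intro c y hy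
  refine ((contDiffAt_extDeriv (hη.contDiffAt hy)).congr_of_eventuallyEq ?_).contDiffWithinAt
  filter_upwards [extChartAt_target_mem_nhds_of_mem hy] with z hz
  exact hη.inChart_d hz

theorem DForm.d_apply {k : ℕ} (η : DForm E M k) (x : M) :
    η.d x = extDeriv (η.inChart x) (extChartAt 𝓘(ℝ, E) x x) := by
  unfold DForm.d
  rw [tanMap_chart_self]
  rfl

theorem DForm.d_zero (k : ℕ) : DForm.d (0 : DForm E M k) = 0 := by
  funext x
  have h : DForm.inChart x (0 : DForm E M k) = fun _ => 0 := rfl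
  rw [DForm.d_apply, h, extDeriv, fderiv_fun_const]
  exact map_zero (ContinuousAlternatingMap.alternatizeUncurryFinCLM ℝ E ℝ)

theorem DForm.d_add {k : ℕ} {η θ : DForm E M k} (hη : η.IsSmooth) (hθ : θ.IsSmooth) :
    (η + θ).d = η.d + θ.d := by
  funext x
  have hx := mem_extChartAt_target (I := 𝓘(ℝ, E)) x
  have h : DForm.inChart x (η + θ) = DForm.inChart x η + DForm.inChart x θ := rfl
  rw [Pi.add_apply, DForm.d_apply, DForm.d_apply, DForm.d_apply, h,
    extDeriv_add ((hη.contDiffAt hx).differentiableAt (by simp))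
      ((hθ.contDiffAt hx).differentiableAt (by simp))]

theorem contMDiffAt_along_comp_chart_symm {f : M → N} {u : M → E'} {c : M} {y : E}
    (hy : y ∈ (extChartAt 𝓘(ℝ, E) c).target) (hu : ContMDiff 𝓘(ℝ, E) 𝓘(ℝ, E').tangent ∞
      (fun x => (⟨f x, u x⟩ : TangentBundle 𝓘(ℝ, E') N))) :
    ContMDiffAt 𝓘(ℝ, E) 𝓘(ℝ, E').tangent ∞ (fun z =>
      (⟨f ((extChartAt 𝓘(ℝ, E) c).symm z), u ((extChartAt 𝓘(ℝ, E) c).symm z)⟩ :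
        TangentBundle 𝓘(ℝ, E') N)) y :=
  ContMDiffAt.comp y (hu _) (contMDiffAt_chart_symm hy)

theorem DForm.IsSmooth.pullback [FiniteDimensional ℝ E] {k : ℕ} {η : DForm E' N k}
    (hη : η.IsSmooth) {f : M → N} (hf : ContMDiff 𝓘(ℝ, E) 𝓘(ℝ, E') ∞ f) :
    (DForm.pullback (E := E) f η).IsSmooth := by
  intro c y hy
  have hs := contMDiffAt_chart_symm hy
  have h : ContMDiffAt 𝓘(ℝ, E) 𝓘(ℝ, E') ∞ (fun z => f ((extChartAt 𝓘(ℝ, E) c).symm z)) y :=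
    ContMDiffAt.comp y (hf _) hs
  refine ((hη.contDiffAt_pullback h).congr_of_eventuallyEq ?_).contDiffWithinAt
  filter_upwards [extChartAt_target_mem_nhds_of_mem hy] with z hz
  exact (DForm.pullback_comp_apply η ((hf _).mdifferentiableAt (by simp))
    (mdifferentiableAt_chart_symm hz)).symm

/-- The pullback of `V ⌟ η` for a vector field `V` along `f`. -/
def DForm.pullbackAlong {k : ℕ} (f : M → N) (V : M → E') (η : DForm E' N (k + 1)) : DForm E M k :=
  fun x => ((η (f x)).curryLeft (V x)).compContinuousLinearMap (tanMap f x)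

theorem DForm.inChart_pullbackAlong {k : ℕ} {f : M → N} (hf : ContMDiff 𝓘(ℝ, E) 𝓘(ℝ, E') ∞ f)
    (V : M → E') (η : DForm E' N (k + 1)) {c : M} {y : E}
    (hy : y ∈ (extChartAt 𝓘(ℝ, E) c).target) :
    (DForm.pullbackAlong (E := E) f V η).inChart c y =
      DForm.pullbackAlong (E := E) (fun z => f ((extChartAt 𝓘(ℝ, E) c).symm z))
        (fun z => V ((extChartAt 𝓘(ℝ, E) c).symm z)) η y := by
  unfold DForm.inChart DForm.pullbackAlong
  rw [tanMap_comp ((hf _).mdifferentiableAt (by simp)) (mdifferentiableAt_chart_symm hy)]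
  rfl

theorem DForm.IsSmooth.pullbackAlong [FiniteDimensional ℝ E] {k : ℕ} {η : DForm E' N (k + 1)}
    (hη : η.IsSmooth) {f : M → N} (hf : ContMDiff 𝓘(ℝ, E) 𝓘(ℝ, E') ∞ f) {V : M → E'}
    (hV : ContMDiff 𝓘(ℝ, E) 𝓘(ℝ, E').tangent ∞
      (fun x => (⟨f x, V x⟩ : TangentBundle 𝓘(ℝ, E') N))) :
    (DForm.pullbackAlong (E := E) f V η).IsSmooth := by
  refine DForm.IsSmooth.of_apply fun c y hy v => ?_
  have h : ContMDiffAt 𝓘(ℝ, E) 𝓘(ℝ, E') ∞ (fun z => f ((extChartAt 𝓘(ℝ, E) c).symm z)) y :=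
    ContMDiffAt.comp y (hf _) (contMDiffAt_chart_symm hy)
  have h2 := hη.contDiffAt_along h (u := Fin.cons (fun z => V ((extChartAt 𝓘(ℝ, E) c).symm z))
    (fun i z => tanMap (E := E) (E' := E') (fun z => f ((extChartAt 𝓘(ℝ, E) c).symm z)) z (v i)))
    (Fin.cases (contMDiffAt_along_comp_chart_symm hy hV)
      (fun i => contMDiffAt_along_tanMap h (v i)))
  refine h2.congr_of_eventuallyEq ?_
  filter_upwards [extChartAt_target_mem_nhds_of_mem hy] with z hz
  rw [DForm.inChart_pullbackAlong hf V η hz]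
  unfold DForm.pullbackAlong
  rw [ContinuousAlternatingMap.compContinuousLinearMap_apply,
    ContinuousAlternatingMap.curryLeft_apply_apply]
  congr 1
  funext i
  refine Fin.cases ?_ (fun j => ?_) i <;> rfl

/-- The pullback of `W ⌟ V ⌟ η` for vector fields `V`, `W` along `f`. -/
def DForm.pullbackAlong₂ {k : ℕ} (f : M → N) (V W : M → E') (η : DForm E' N (k + 2)) :
    DForm E M k :=
  fun x => (((η (f x)).curryLeft (V x)).curryLeft (W x)).compContinuousLinearMap (tanMap f x)

theorem DForm.IsSmooth.pullbackAlong₂ [FiniteDimensional ℝ E] {k : ℕ} {η : DForm E' N (k + 2)}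
    (hη : η.IsSmooth) {f : M → N} (hf : ContMDiff 𝓘(ℝ, E) 𝓘(ℝ, E') ∞ f) {V W : M → E'}
    (hV : ContMDiff 𝓘(ℝ, E) 𝓘(ℝ, E').tangent ∞
      (fun x => (⟨f x, V x⟩ : TangentBundle 𝓘(ℝ, E') N)))
    (hW : ContMDiff 𝓘(ℝ, E) 𝓘(ℝ, E').tangent ∞
      (fun x => (⟨f x, W x⟩ : TangentBundle 𝓘(ℝ, E') N))) :
    (DForm.pullbackAlong₂ (E := E) f V W η).IsSmooth := by
  refine DForm.IsSmooth.of_apply fun c y hy v => ?_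
  have h : ContMDiffAt 𝓘(ℝ, E) 𝓘(ℝ, E') ∞ (fun z => f ((extChartAt 𝓘(ℝ, E) c).symm z)) y :=
    ContMDiffAt.comp y (hf _) (contMDiffAt_chart_symm hy)
  have h2 := hη.contDiffAt_along h (u := Fin.cons (fun z => V ((extChartAt 𝓘(ℝ, E) c).symm z))
    (Fin.cons (fun z => W ((extChartAt 𝓘(ℝ, E) c).symm z)) (fun i z =>
      tanMap (E := E) (E' := E') (fun z => f ((extChartAt 𝓘(ℝ, E) c).symm z)) z (v i))))
    (Fin.cases (contMDiffAt_along_comp_chart_symm hy hV)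
      (Fin.cases (contMDiffAt_along_comp_chart_symm hy hW)
        (fun i => contMDiffAt_along_tanMap h (v i))))
  refine h2.congr_of_eventuallyEq ?_
  filter_upwards [extChartAt_target_mem_nhds_of_mem hy] with z hz
  unfold DForm.inChart DForm.pullbackAlong₂
  rw [ContinuousAlternatingMap.compContinuousLinearMap_apply,
    ContinuousAlternatingMap.compContinuousLinearMap_apply,
    ContinuousAlternatingMap.curryLeft_apply_apply, ContinuousAlternatingMap.curryLeft_apply_apply]
  congr 1
  funext i
  refine Fin.cases rfl (Fin.cases rfl (fun j => ?_)) i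
  change _ = tanMap (E := E) (E' := E') (fun z => f ((extChartAt 𝓘(ℝ, E) c).symm z)) z (v j)
  rw [tanMap_comp ((hf _).mdifferentiableAt (by simp)) (mdifferentiableAt_chart_symm hz)]
  rfl

end FormsOnManifolds

/-! ### Families of maps and Cartan's homotopy formula -/

section Families

variable {E : Type*} [NormedAddCommGroup E] [NormedSpace ℝ E]
  {M : Type*} [TopologicalSpace M] [ChartedSpace E M] [IsManifold 𝓘(ℝ, E) ∞ M]
  {E' : Type*} [NormedAddCommGroup E'] [NormedSpace ℝ E']
  {N : Type*} [TopologicalSpace N] [ChartedSpace E' N] [IsManifold 𝓘(ℝ, E') ∞ N]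

variable (E') in
/-- The velocity at time `t` of the family of maps `G (t, ·)`. -/
def timeVelocity (G : ℝ × M → N) (t : ℝ) : M → E' := fun x =>
  tanMap (E := ℝ) (E' := E') (fun r : ℝ => G (r, x)) t 1

variable (E) in
/-- A family of maps on `M`, read in the preferred chart at `c`. -/
def familyInChart (G : ℝ × M → N) (c : M) : ℝ × E → N := fun q =>
  G (q.1, (extChartAt 𝓘(ℝ, E) c).symm q.2)

theorem DForm.inChart_self {k : ℕ} (θ : DForm E M k) (x : M) :
    θ.inChart x (extChartAt 𝓘(ℝ, E) x x) = θ x := by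
  unfold DForm.inChart
  rw [tanMap_chart_symm_self, extChartAt_to_inv]
  rfl

variable {G : ℝ × M → N} (hG : ContMDiff (𝓘(ℝ, ℝ).prod 𝓘(ℝ, E)) 𝓘(ℝ, E') ∞ G)
include hG

theorem contMDiff_family_slice (t : ℝ) :
    ContMDiff 𝓘(ℝ, E) 𝓘(ℝ, E') ∞ (fun x => G (t, x)) :=
  hG.comp (contMDiff_const.prodMk contMDiff_id)

theorem contMDiff_family_curve (x : M) :
    ContMDiff 𝓘(ℝ, ℝ) 𝓘(ℝ, E') ∞ (fun t => G (t, x)) :=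
  hG.comp (contMDiff_id.prodMk contMDiff_const)

theorem contMDiffAt_familyInChart {c : M} {y : E} (hy : y ∈ (extChartAt 𝓘(ℝ, E) c).target)
    (t : ℝ) : ContMDiffAt 𝓘(ℝ, ℝ × E) 𝓘(ℝ, E') ∞ (familyInChart E G c) (t, y) := by
  have h1 : ContMDiffAt 𝓘(ℝ, ℝ × E) 𝓘(ℝ, ℝ) ∞ (fun q : ℝ × E => q.1) (t, y) :=
    contDiff_fst.contMDiff.contMDiffAt
  have h2 : ContMDiffAt 𝓘(ℝ, ℝ × E) 𝓘(ℝ, E) ∞ (fun q : ℝ × E => q.2) (t, y) :=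
    contDiff_snd.contMDiff.contMDiffAt
  have h3 : ContMDiffAt 𝓘(ℝ, ℝ × E) 𝓘(ℝ, E) ∞
      (fun q : ℝ × E => (extChartAt 𝓘(ℝ, E) c).symm q.2) (t, y) :=
    ContMDiffAt.comp (t, y) (g := (extChartAt 𝓘(ℝ, E) c).symm) (contMDiffAt_chart_symm hy) h2
  exact ContMDiffAt.comp (t, y) (hG _) (h1.prodMk h3)

theorem tanMap_familyInChart_time {c : M} {y : E} (hy : y ∈ (extChartAt 𝓘(ℝ, E) c).target)
    (t : ℝ) : tanMap (E := ℝ × E) (E' := E') (familyInChart E G c) (t, y) ((1 : ℝ), (0 : E)) =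
      timeVelocity E' G t ((extChartAt 𝓘(ℝ, E) c).symm y) := by
  have hd : HasFDerivAt (fun r : ℝ => ((r, y) : ℝ × E)) (ContinuousLinearMap.inl ℝ ℝ E) t :=
    hasFDerivAt_prodMk_left t y
  have h := tanMap_comp (f := fun r : ℝ => ((r, y) : ℝ × E)) (x := t)
    ((contMDiffAt_familyInChart hG hy t).mdifferentiableAt (by simp))
    hd.differentiableAt.mdifferentiableAt
  rw [tanMap_eq_fderiv, hd.fderiv] at h
  have h2 := congrArg (fun l : ℝ →L[ℝ] E' => l 1) h
  exact h2.symm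

theorem tanMap_familyInChart_space {c : M} {y : E} (hy : y ∈ (extChartAt 𝓘(ℝ, E) c).target)
    (t : ℝ) (w : E) : tanMap (E := ℝ × E) (E' := E') (familyInChart E G c) (t, y) ((0 : ℝ), w) =
      tanMap (E := E) (E' := E') (fun x => G (t, x)) ((extChartAt 𝓘(ℝ, E) c).symm y)
        (tanMap (E := E) (E' := E) (extChartAt 𝓘(ℝ, E) c).symm y w) := by
  have hd : HasFDerivAt (fun z : E => ((t, z) : ℝ × E)) (ContinuousLinearMap.inr ℝ ℝ E) y :=
    hasFDerivAt_prodMk_right t y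
  have h := tanMap_comp (f := fun z : E => ((t, z) : ℝ × E)) (x := y)
    ((contMDiffAt_familyInChart hG hy t).mdifferentiableAt (by simp))
    hd.differentiableAt.mdifferentiableAt
  rw [tanMap_eq_fderiv, hd.fderiv] at h
  have h3 := tanMap_comp (f := (extChartAt 𝓘(ℝ, E) c).symm) (x := y) (g := fun x => G (t, x))
    ((contMDiff_family_slice hG t _).mdifferentiableAt (by simp))
    (mdifferentiableAt_chart_symm hy)
  have h2 := congrArg (fun l : E →L[ℝ] E' => l w) (h.symm.trans h3)
  exact h2

/-- In a chart of `M` the velocity is the image of the constant vector `(1, 0)` under the tangent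
map of the family, so its smoothness follows from that of a tangent map. -/
theorem contMDiff_along_timeVelocity (t : ℝ) :
    ContMDiff 𝓘(ℝ, E) 𝓘(ℝ, E').tangent ∞
      (fun x => (⟨G (t, x), timeVelocity E' G t x⟩ : TangentBundle 𝓘(ℝ, E') N)) := by
  intro x
  have hx := mem_extChartAt_target (I := 𝓘(ℝ, E)) x
  have h1 := contMDiffAt_along_tanMap (contMDiffAt_familyInChart hG hx t) ((1 : ℝ), (0 : E))
  have h2 : ContMDiffAt 𝓘(ℝ, E) 𝓘(ℝ, ℝ × E) ∞
      (fun z => ((t, extChartAt 𝓘(ℝ, E) x z) : ℝ × E)) x :=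
    ContMDiffAt.prodMk_space contMDiffAt_const (contMDiffAt_chart (mem_extChartAt_source x))
  refine (ContMDiffAt.comp x h1 h2).congr_of_eventuallyEq ?_
  filter_upwards [(isOpen_extChartAt_source (I := 𝓘(ℝ, E)) x).mem_nhds (mem_extChartAt_source x)]
    with z hz
  have h3 := tanMap_familyInChart_time hG ((extChartAt 𝓘(ℝ, E) x).map_source hz) t
  have h4 := (extChartAt 𝓘(ℝ, E) x).left_inv hz
  have h5 : ∀ z', z' = z → (⟨G (t, z'), timeVelocity E' G t z'⟩ : TangentBundle 𝓘(ℝ, E') N) =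
      ⟨G (t, z), timeVelocity E' G t z⟩ := by
    rintro _ rfl
    rfl
  simp only [Function.comp_apply, h3]
  exact (h5 _ h4).symm

theorem DForm.pullback_familyInChart_apply {k : ℕ} (η : DForm E' N k) {c : M} {y : E}
    (hy : y ∈ (extChartAt 𝓘(ℝ, E) c).target) (t : ℝ) (v : Fin k → E) :
    DForm.pullback (E := ℝ × E) (familyInChart E G c) η (t, y) (fun i => ((0 : ℝ), v i)) =
      (DForm.pullback (E := E) (fun x => G (t, x)) η).inChart c y v := by
  unfold DForm.inChart DForm.pullback
  simp only [ContinuousAlternatingMap.compContinuousLinearMap_apply]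
  change η _ _ = η _ _
  congr 1
  funext i
  exact tanMap_familyInChart_space hG hy t (v i)

/-- Cartan's homotopy formula for a smooth family of maps and a form of positive degree. -/
theorem DForm.IsSmooth.hasDerivAt_pullback_family [FiniteDimensional ℝ E] {k : ℕ}
    {η : DForm E' N (k + 1)} (hη : η.IsSmooth) (t : ℝ) (x : M) (v : Fin (k + 1) → E) :
    HasDerivAt (fun r => DForm.pullback (E := E) (fun z => G (r, z)) η x v)
      (DForm.pullbackAlong (E := E) (fun z => G (t, z)) (timeVelocity E' G t) η.d x v +
        (DForm.pullbackAlong (E := E) (fun z => G (t, z)) (timeVelocity E' G t) η).d x v) t := by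
  have hx := mem_extChartAt_target (I := 𝓘(ℝ, E)) x
  set F := familyInChart E G x with hF
  have hFt := contMDiffAt_familyInChart hG hx t
  have hw : DifferentiableAt ℝ (DForm.pullback (E := ℝ × E) F η) (t, extChartAt 𝓘(ℝ, E) x x) :=
    (hη.contDiffAt_pullback hFt).differentiableAt (by simp)
  -- The family turns `η` into a form on `ℝ × E`, for which the formula is the one for translations
  -- in time; the identities below translate its three terms back to `M`.
  have h := hasDerivAt_slice_form hw v
  rw [hη.extDeriv_pullback hFt] at h
  have e1 : (fun r : ℝ => DForm.pullback (E := ℝ × E) F η (r, extChartAt 𝓘(ℝ, E) x x)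
      (fun i => ((0 : ℝ), v i))) = fun r => DForm.pullback (E := E) (fun z => G (r, z)) η x v := by
    funext r
    rw [DForm.pullback_familyInChart_apply hG η hx, DForm.inChart_self]
  have e2 : DForm.pullback (E := ℝ × E) F η.d (t, extChartAt 𝓘(ℝ, E) x x)
      (Matrix.vecCons ((1 : ℝ), (0 : E)) (fun i => ((0 : ℝ), v i))) =
      DForm.pullbackAlong (E := E) (fun z => G (t, z)) (timeVelocity E' G t) η.d x v := by
    have hl := extChartAt_to_inv (I := 𝓘(ℝ, E)) x
    unfold DForm.pullback DForm.pullbackAlong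
    rw [ContinuousAlternatingMap.compContinuousLinearMap_apply,
      ContinuousAlternatingMap.compContinuousLinearMap_apply,
      ContinuousAlternatingMap.curryLeft_apply_apply]
    have hp : F (t, extChartAt 𝓘(ℝ, E) x x) = G (t, x) := by rw [hF, familyInChart, hl]
    rw [hp]
    congr 1
    funext i
    refine Fin.cases ?_ (fun j => ?_) i
    · refine (tanMap_familyInChart_time hG hx t).trans ?_
      rw [hl]
      rfl
    · refine (tanMap_familyInChart_space hG hx t (v j)).trans ?_
      rw [hl, tanMap_chart_symm_self]
      rfl
  have e3 : extDeriv (fun z => ((DForm.pullback (E := ℝ × E) F η (t, z)).curryLeft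
      ((1 : ℝ), (0 : E))).compContinuousLinearMap (ContinuousLinearMap.inr ℝ ℝ E))
      (extChartAt 𝓘(ℝ, E) x x) =
      (DForm.pullbackAlong (E := E) (fun z => G (t, z)) (timeVelocity E' G t) η).d x := by
    rw [DForm.d_apply]
    apply Filter.EventuallyEq.extDeriv_eq
    filter_upwards [extChartAt_target_mem_nhds_of_mem hx] with y hy
    ext u
    unfold DForm.inChart DForm.pullbackAlong DForm.pullback
    simp only [ContinuousAlternatingMap.compContinuousLinearMap_apply,
      ContinuousAlternatingMap.curryLeft_apply_apply]
    change η _ _ = η _ _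
    congr 1
    funext i
    refine Fin.cases ?_ (fun j => ?_) i
    · exact tanMap_familyInChart_time hG hy t
    · exact tanMap_familyInChart_space hG hy t (u j)
  rw [e1, e2, e3] at h
  exact h

/-- Cartan's homotopy formula for a smooth family of maps and a function. -/
theorem DForm.IsSmooth.hasDerivAt_pullback_family_zero {η : DForm E' N 0} (hη : η.IsSmooth)
    (t : ℝ) (x : M) (v : Fin 0 → E) :
    HasDerivAt (fun r => DForm.pullback (E := E) (fun z => G (r, z)) η x v)
      (DForm.pullbackAlong (E := E) (fun z => G (t, z)) (timeVelocity E' G t) η.d x v) t := by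
  have hc := contMDiff_family_curve hG x
  have hs := hη.extDeriv_pullback (hc t)
  have hd : DifferentiableAt ℝ (DForm.pullback (E := ℝ) (fun r => G (r, x)) η) t := by
    refine ContDiffAt.differentiableAt (n := ∞) ?_ (by simp)
    exact hη.contDiffAt_pullback (hc t)
  have h1 : DifferentiableAt ℝ
      (fun r => DForm.pullback (E := ℝ) (fun r => G (r, x)) η r ![]) t :=
    hd.continuousAlternatingMap_apply (fun i => i.elim0)
  -- A function has no contraction term; the formula is naturality of `d` along the curve `r ↦ G (r,
  -- x)`, evaluated on the unit vector of `ℝ`.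
  have h2 := congrArg (fun l : ℝ [⋀^Fin 1]→L[ℝ] ℝ => l ![1]) hs
  simp only [extDeriv_apply hd] at h2
  have h3 : DForm.pullback (E := ℝ) (fun r => G (r, x)) η.d t ![1] =
      DForm.pullbackAlong (E := E) (fun z => G (t, z)) (timeVelocity E' G t) η.d x v := by
    unfold DForm.pullback DForm.pullbackAlong
    rw [ContinuousAlternatingMap.compContinuousLinearMap_apply,
      ContinuousAlternatingMap.compContinuousLinearMap_apply,
      ContinuousAlternatingMap.curryLeft_apply_apply]
    congr 1
    funext i
    refine Fin.cases rfl (fun j => j.elim0) i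
  rw [← h3, ← h2]
  have h4 := h1.hasDerivAt
  have h5 : (fun r => DForm.pullback (E := E) (fun z => G (r, z)) η x v) =
      fun r => DForm.pullback (E := ℝ) (fun r => G (r, x)) η r ![] := by
    funext r
    unfold DForm.pullback
    rw [ContinuousAlternatingMap.compContinuousLinearMap_apply,
      ContinuousAlternatingMap.compContinuousLinearMap_apply]
    congr 1
    exact Subsingleton.elim _ _
  rw [h5]
  refine h4.congr_deriv ?_
  rw [Fin.sum_univ_one]
  have h6 : (fun r => DForm.pullback (E := ℝ) (fun r => G (r, x)) η r ((0 : Fin 1).removeNth ![1])) =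
      fun r => DForm.pullback (E := ℝ) (fun r => G (r, x)) η r ![] := by
    funext r
    congr 1
  rw [h6]
  simp [fderiv_eq_smul_deriv]

end Families

/-! ### Algebra of smooth forms and locality of the exterior derivative -/

section SmoothForms

variable {E : Type*} [NormedAddCommGroup E] [NormedSpace ℝ E]
  {M : Type*} [TopologicalSpace M] [ChartedSpace E M]

theorem DForm.isSmooth_zero (k : ℕ) : (0 : DForm E M k).IsSmooth := fun _ => by
  have h : ∀ c : M, DForm.inChart c (0 : DForm E M k) = fun _ => 0 := fun _ => rfl
  rw [h]
  exact contDiffOn_const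

theorem DForm.IsSmooth.add {k : ℕ} {η θ : DForm E M k} (hη : η.IsSmooth) (hθ : θ.IsSmooth) :
    (η + θ).IsSmooth := fun c => (hη c).add (hθ c)

theorem DForm.IsSmooth.sub {k : ℕ} {η θ : DForm E M k} (hη : η.IsSmooth) (hθ : θ.IsSmooth) :
    (η - θ).IsSmooth := fun c => (hη c).sub (hθ c)

variable [IsManifold 𝓘(ℝ, E) ∞ M]

theorem DForm.IsSmooth.smul {k : ℕ} {η : DForm E M k} (hη : η.IsSmooth) {f : M → ℝ}
    (hf : ContMDiff 𝓘(ℝ, E) 𝓘(ℝ, ℝ) ∞ f) : DForm.IsSmooth (fun x => f x • η x) := by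
  intro c
  have h : ContDiffOn ℝ ∞ (fun y => f ((extChartAt 𝓘(ℝ, E) c).symm y))
      (extChartAt 𝓘(ℝ, E) c).target :=
    (hf.comp_contMDiffOn (contMDiffOn_extChartAt_symm c)).contDiffOn
  exact h.smul (hη c)

theorem DForm.d_eq_zero_of_eventuallyEq {k : ℕ} {η : DForm E M k} {x : M}
    (h : ∀ᶠ z in 𝓝 x, η z = 0) : η.d x = 0 := by
  have hs : Tendsto (extChartAt 𝓘(ℝ, E) x).symm (𝓝 (extChartAt 𝓘(ℝ, E) x x)) (𝓝 x) := by
    have := (contMDiffAt_chart_symm (E := E) (mem_extChartAt_target x)).continuousAt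
    rwa [ContinuousAt, extChartAt_to_inv] at this
  have h2 : DForm.inChart x η =ᶠ[𝓝 (extChartAt 𝓘(ℝ, E) x x)] DForm.inChart x (0 : DForm E M k) := by
    filter_upwards [hs.eventually h] with y hy
    unfold DForm.inChart
    rw [hy]
    rfl
  rw [DForm.d_apply, h2.extDeriv_eq, ← DForm.d_apply, DForm.d_zero]
  rfl

end SmoothForms

/-! ### Coefficients of top-degree forms and signs of charts -/

section Coefficients

variable {m : ℕ} {S : Type*} [TopologicalSpace S] [ChartedSpace (EuclideanSpace ℝ (Fin m)) S]

/-- A top-degree alternating form is a multiple of the determinant of a basis. -/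
theorem alternating_comp_single (f : EuclideanSpace ℝ (Fin m) [⋀^Fin m]→L[ℝ] ℝ)
    (L : EuclideanSpace ℝ (Fin m) →L[ℝ] EuclideanSpace ℝ (Fin m)) :
    f (fun i => L (EuclideanSpace.single i (1 : ℝ))) =
      L.det * f (fun i => EuclideanSpace.single i (1 : ℝ)) := by
  set b := (EuclideanSpace.basisFun (Fin m) ℝ).toBasis with hb
  have hbi : ∀ i, b i = EuclideanSpace.single i (1 : ℝ) := fun i => by simp [hb]
  have h := f.toAlternatingMap.eq_smul_basis_det b
  have h1 := congrArg (fun g => g (fun i => L (b i))) h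
  have h2 : b.det (fun i => L (b i)) = L.det := by
    have := b.det_comp L.toLinearMap b
    rw [b.det_self, mul_one] at this
    exact this
  simp only [AlternatingMap.smul_apply, h2, smul_eq_mul] at h1
  have hbf : ⇑b = fun i => EuclideanSpace.single i (1 : ℝ) := funext hbi
  rw [hbf] at h1
  rw [mul_comm]
  exact h1

theorem alternating_eq_zero_of_single {f : EuclideanSpace ℝ (Fin m) [⋀^Fin m]→L[ℝ] ℝ}
    (h : f (fun i => EuclideanSpace.single i (1 : ℝ)) = 0) : f = 0 := by
  set b := (EuclideanSpace.basisFun (Fin m) ℝ).toBasis with hb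
  have hbi : (fun i => EuclideanSpace.single i (1 : ℝ)) = b := funext fun i => by simp [hb]
  have h1 := (f.toAlternatingMap.map_basis_eq_zero_iff b).1 (by rw [hbi] at h; exact h)
  ext v
  exact congrArg (fun g => g v) h1

variable [IsManifold (𝓡 m) ∞ S]

theorem DForm.IsSmooth.contDiffAt_coeff {η : DForm (EuclideanSpace ℝ (Fin m)) S m}
    (hη : η.IsSmooth) {c : S} {y : EuclideanSpace ℝ (Fin m)}
    (hy : y ∈ (extChartAt (𝓡 m) c).target) : ContDiffAt ℝ ∞ (η.coeff c) y :=
  contDiffAt_alternating_apply (hη.contDiffAt hy) (fun _ => contDiffAt_const)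

theorem DForm.IsSmooth.continuousOn_coeff {η : DForm (EuclideanSpace ℝ (Fin m)) S m}
    (hη : η.IsSmooth) (c : S) : ContinuousOn (η.coeff c) (extChartAt (𝓡 m) c).target :=
  fun _ hy => (hη.contDiffAt_coeff hy).continuousAt.continuousWithinAt

theorem DForm.coeff_change (η : DForm (EuclideanSpace ℝ (Fin m)) S m) {c c' : S}
    {y : EuclideanSpace ℝ (Fin m)} (hy : y ∈ (extChartAt (𝓡 m) c').target)
    (hy' : (extChartAt (𝓡 m) c').symm y ∈ (extChartAt (𝓡 m) c).source) :
    η.coeff c' y = (fderiv ℝ (fun z => extChartAt (𝓡 m) c ((extChartAt (𝓡 m) c').symm z)) y).det *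
      η.coeff c (extChartAt (𝓡 m) c ((extChartAt (𝓡 m) c').symm y)) := by
  unfold DForm.coeff
  rw [← alternating_comp_single, ← tanMap_eq_fderiv,
    tanMap_comp (mdifferentiableAt_chart hy') (mdifferentiableAt_chart_symm hy)]
  exact DForm.apply_eq_inChart η hy' _

theorem DForm.apply_eq_coeff (η : DForm (EuclideanSpace ℝ (Fin m)) S m) {c : S}
    {y : EuclideanSpace ℝ (Fin m)} :
    η.coeff c y = (tanMap (E := EuclideanSpace ℝ (Fin m)) (E' := EuclideanSpace ℝ (Fin m))
      (extChartAt (𝓡 m) c).symm y).det *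
        η ((extChartAt (𝓡 m) c).symm y) (fun i => EuclideanSpace.single i (1 : ℝ)) :=
  alternating_comp_single _ _

theorem DForm.coeff_eq_zero_iff (η : DForm (EuclideanSpace ℝ (Fin m)) S m) {c : S}
    {y : EuclideanSpace ℝ (Fin m)} (hy : y ∈ (extChartAt (𝓡 m) c).target) :
    η.coeff c y = 0 ↔ η ((extChartAt (𝓡 m) c).symm y) = 0 := by
  refine ⟨fun h => ?_, fun h => ?_⟩
  · have h1 : η.inChart c y = 0 := alternating_eq_zero_of_single h
    have h2 := η.eq_inChart_comp ((extChartAt (𝓡 m) c).map_target hy)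
    rw [(extChartAt (𝓡 m) c).right_inv hy, h1] at h2
    rw [h2]
    rfl
  · rw [DForm.apply_eq_coeff, h]
    simp

theorem OrientationForm.coeff_ne_zero (o : OrientationForm m S) {c : S}
    {y : EuclideanSpace ℝ (Fin m)} (hy : y ∈ (extChartAt (𝓡 m) c).target) :
    o.form.coeff c y ≠ 0 := fun h => o.ne_zero _ ((o.form.coeff_eq_zero_iff hy).1 h)

/-- The sign of the chart at `c` with respect to the orientation. -/
def OrientationForm.chartSign (o : OrientationForm m S) (c : S)
    (y : EuclideanSpace ℝ (Fin m)) : ℝ := (SignType.sign (o.form.coeff c y) : ℝ)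

/-- The coefficient of the orientation form is continuous and nonzero, so its sign is locally
constant. This keeps the sign factor from spoiling smoothness of the integrands. -/
theorem OrientationForm.eventually_chartSign_eq (o : OrientationForm m S) {c : S}
    {y : EuclideanSpace ℝ (Fin m)} (hy : y ∈ (extChartAt (𝓡 m) c).target) :
    ∀ᶠ z in 𝓝 y, o.chartSign c z = o.chartSign c y := by
  have h1 : ContinuousAt (fun z => SignType.sign (o.form.coeff c z)) y :=
    ContinuousAt.comp (continuousAt_sign_of_ne_zero (o.coeff_ne_zero hy))
      (o.smooth.contDiffAt_coeff hy).continuousAt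
  have h2 : ∀ᶠ z in 𝓝 y, SignType.sign (o.form.coeff c z) = SignType.sign (o.form.coeff c y) := by
    have := h1.eventually (IsOpen.mem_nhds (isOpen_discrete
      {SignType.sign (o.form.coeff c y)}) rfl)
    exact this
  filter_upwards [h2] with z hz
  unfold chartSign
  rw [hz]

theorem OrientationForm.continuousOn_chartSign (o : OrientationForm m S) (c : S) :
    ContinuousOn (o.chartSign c) (extChartAt (𝓡 m) c).target := fun _ hy =>
  (continuousAt_const.congr ((o.eventually_chartSign_eq hy).mono
    fun _ hz => hz.symm)).continuousWithinAt

end Coefficients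

/-! ### Extension by zero -/

section Extension

variable {X : Type*} [TopologicalSpace X] [T2Space X]

theorem continuous_indicator_of_eq_zero {U K : Set X} (hU : IsOpen U) (hK : IsCompact K)
    (hKU : K ⊆ U) {g : X → ℝ} (hg : ContinuousOn g U) (h0 : ∀ x ∈ U, x ∉ K → g x = 0) :
    Continuous (U.indicator g) ∧ HasCompactSupport (U.indicator g) := by
  have hz : ∀ x ∉ K, U.indicator g x = 0 := fun x hx => by
    by_cases hxU : x ∈ U
    · rw [indicator_of_mem hxU, h0 x hxU hx]
    · exact indicator_of_notMem hxU g
  have hs : tsupport (U.indicator g) ⊆ K :=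
    closure_minimal (fun x hx => by_contra fun hxK => hx (hz x hxK)) hK.isClosed
  refine ⟨?_, HasCompactSupport.intro hK hz⟩
  refine continuous_iff_continuousAt.2 fun x => ?_
  by_cases hx : x ∈ K
  · have : U.indicator g =ᶠ[𝓝 x] g := by
      filter_upwards [hU.mem_nhds (hKU hx)] with z hz
      exact indicator_of_mem hz g
    exact (hg.continuousAt (hU.mem_nhds (hKU hx))).congr this.symm
  · have : U.indicator g =ᶠ[𝓝 x] fun _ => 0 := by
      filter_upwards [hK.isClosed.isOpen_compl.mem_nhds hx] with z h
      exact hz z h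
    exact continuousAt_const.congr this.symm

end Extension

/-! ### Linearity of the integral and the fundamental lemma -/

section IntegralBasics

variable {m : ℕ} {S : Type*} [TopologicalSpace S] [ChartedSpace (EuclideanSpace ℝ (Fin m)) S]
  [IsManifold (𝓡 m) ∞ S] [T2Space S] [CompactSpace S]

theorem chartPartition_tsupport (c : S) :
    tsupport (chartPartition m S c) ⊆ (extChartAt (𝓡 m) c).source := by
  rw [extChartAt_source]
  exact Classical.choose_spec
    (SmoothPartitionOfUnity.exists_isSubordinate_chartAt_source (𝓡 m) S) c

theorem chartPartition_eq_zero {c x : S} (hx : x ∉ (extChartAt (𝓡 m) c).source) :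
    chartPartition m S c x = 0 :=
  image_eq_zero_of_notMem_tsupport fun h => hx (chartPartition_tsupport c h)

variable (m S) in
theorem finite_chartPartition :
    {c : S | (Function.support (chartPartition m S c)).Nonempty}.Finite :=
  (chartPartition m S).locallyFinite.finite_nonempty_of_compact

variable (m S) in
/-- The finitely many charts that enter the partition of unity. -/
def activeCharts : Finset S := (finite_chartPartition m S).toFinset

theorem chartPartition_eq_zero_of_notMem {c : S} (hc : c ∉ activeCharts m S) (x : S) :
    chartPartition m S c x = 0 := by
  by_contra h
  exact hc ((finite_chartPartition m S).mem_toFinset.2 ⟨x, h⟩)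

theorem sum_chartPartition (x : S) : ∑ c ∈ activeCharts m S, chartPartition m S c x = 1 := by
  rw [← (chartPartition m S).sum_eq_one (mem_univ x)]
  refine (finsum_eq_sum_of_support_subset _ fun c hc => ?_).symm
  exact by_contra fun h => hc (chartPartition_eq_zero_of_notMem h x)

theorem DForm.integral_eq_sum (o : OrientationForm m S)
    (η : DForm (EuclideanSpace ℝ (Fin m)) S m) :
    DForm.integral o η = ∑ c ∈ activeCharts m S, ∫ y in (extChartAt (𝓡 m) c).target,
      o.chartSign c y * (chartPartition m S c ((extChartAt (𝓡 m) c).symm y) * η.coeff c y) := by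
  unfold DForm.integral
  refine finsum_eq_sum_of_support_subset _ fun c hc => ?_
  refine by_contra fun h => hc ?_
  simp [chartPartition_eq_zero_of_notMem h]

theorem continuousOn_comp_chart_symm {f : S → ℝ} (hf : Continuous f) (c : S) :
    ContinuousOn (fun y => f ((extChartAt (𝓡 m) c).symm y)) (extChartAt (𝓡 m) c).target :=
  hf.comp_continuousOn (continuousOn_extChartAt_symm c)

theorem isCompact_image_chart {c : S} {K : Set S} (hK : IsClosed K)
    (hKc : K ⊆ (extChartAt (𝓡 m) c).source) :
    IsCompact (extChartAt (𝓡 m) c '' K) ∧ extChartAt (𝓡 m) c '' K ⊆ (extChartAt (𝓡 m) c).target :=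
  ⟨hK.isCompact.image_of_continuousOn ((continuousOn_extChartAt c).mono hKc),
    fun _ ⟨_, hx, h⟩ => h ▸ (extChartAt (𝓡 m) c).map_source (hKc hx)⟩

theorem notMem_of_notMem_image_chart {c : S} {K : Set S} {y : EuclideanSpace ℝ (Fin m)}
    (hy : y ∈ (extChartAt (𝓡 m) c).target) (h : y ∉ extChartAt (𝓡 m) c '' K) :
    (extChartAt (𝓡 m) c).symm y ∉ K := fun hK =>
  h ⟨_, hK, (extChartAt (𝓡 m) c).right_inv hy⟩

/-- Integrands supported in the domain of the chart at `c` extend by zero to continuous functions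
with compact support. -/
theorem continuous_chart_density (o : OrientationForm m S) {c : S} {f : S → ℝ} {K : Set S}
    (hf : Continuous f) (hK : IsClosed K) (hKc : K ⊆ (extChartAt (𝓡 m) c).source)
    {g : EuclideanSpace ℝ (Fin m) → ℝ} (hg : ContinuousOn g (extChartAt (𝓡 m) c).target)
    (h0 : ∀ y ∈ (extChartAt (𝓡 m) c).target, (extChartAt (𝓡 m) c).symm y ∉ K →
      f ((extChartAt (𝓡 m) c).symm y) * g y = 0) :
    Continuous ((extChartAt (𝓡 m) c).target.indicator
      fun y => o.chartSign c y * (f ((extChartAt (𝓡 m) c).symm y) * g y)) ∧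
    HasCompactSupport ((extChartAt (𝓡 m) c).target.indicator
      fun y => o.chartSign c y * (f ((extChartAt (𝓡 m) c).symm y) * g y)) := by
  refine continuous_indicator_of_eq_zero (isOpen_extChartAt_target c)
    (isCompact_image_chart hK hKc).1 (isCompact_image_chart hK hKc).2
    ((o.continuousOn_chartSign c).mul ((continuousOn_comp_chart_symm hf c).mul hg)) ?_
  intro y hy hyK
  rw [h0 y hy (notMem_of_notMem_image_chart hy hyK), mul_zero]

theorem integrableOn_chart_density (o : OrientationForm m S) {c : S} {f : S → ℝ} {K : Set S}
    (hf : Continuous f) (hK : IsClosed K) (hKc : K ⊆ (extChartAt (𝓡 m) c).source)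
    {g : EuclideanSpace ℝ (Fin m) → ℝ} (hg : ContinuousOn g (extChartAt (𝓡 m) c).target)
    (h0 : ∀ y ∈ (extChartAt (𝓡 m) c).target, (extChartAt (𝓡 m) c).symm y ∉ K →
      f ((extChartAt (𝓡 m) c).symm y) * g y = 0) :
    IntegrableOn (fun y => o.chartSign c y * (f ((extChartAt (𝓡 m) c).symm y) * g y))
      (extChartAt (𝓡 m) c).target := by
  have h := continuous_chart_density o hf hK hKc hg h0
  exact (integrable_indicator_iff (isOpen_extChartAt_target c).measurableSet).1
    (h.1.integrable_of_hasCompactSupport h.2)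

theorem chartPartition_mul_eq_zero {c : S} {g : EuclideanSpace ℝ (Fin m) → ℝ}
    (y : EuclideanSpace ℝ (Fin m))
    (h : (extChartAt (𝓡 m) c).symm y ∉ tsupport (chartPartition m S c)) :
    chartPartition m S c ((extChartAt (𝓡 m) c).symm y) * g y = 0 := by
  rw [image_eq_zero_of_notMem_tsupport h, zero_mul]

theorem integrableOn_chartPartition_density (o : OrientationForm m S) {c : S}
    {g : EuclideanSpace ℝ (Fin m) → ℝ} (hg : ContinuousOn g (extChartAt (𝓡 m) c).target) :
    IntegrableOn (fun y => o.chartSign c y *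
      (chartPartition m S c ((extChartAt (𝓡 m) c).symm y) * g y)) (extChartAt (𝓡 m) c).target :=
  integrableOn_chart_density o (chartPartition m S c).contMDiff.continuous (isClosed_tsupport _)
    (chartPartition_tsupport c) hg (fun y _ => chartPartition_mul_eq_zero y)

theorem DForm.integral_add (o : OrientationForm m S) {η θ : DForm (EuclideanSpace ℝ (Fin m)) S m}
    (hη : η.IsSmooth) (hθ : θ.IsSmooth) :
    DForm.integral o (η + θ) = DForm.integral o η + DForm.integral o θ := by
  rw [DForm.integral_eq_sum, DForm.integral_eq_sum, DForm.integral_eq_sum,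
    ← Finset.sum_add_distrib]
  refine Finset.sum_congr rfl fun c _ => ?_
  rw [← MeasureTheory.integral_add
    (integrableOn_chartPartition_density o (hη.continuousOn_coeff c))
    (integrableOn_chartPartition_density o (hθ.continuousOn_coeff c))]
  congr 1
  funext y
  have h : (η + θ).coeff c y = η.coeff c y + θ.coeff c y := rfl
  rw [h]
  ring

theorem DForm.integral_smul (o : OrientationForm m S) (a : ℝ)
    (η : DForm (EuclideanSpace ℝ (Fin m)) S m) :
    DForm.integral o (a • η) = a * DForm.integral o η := by
  rw [DForm.integral_eq_sum, DForm.integral_eq_sum, Finset.mul_sum]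
  refine Finset.sum_congr rfl fun c _ => ?_
  rw [← MeasureTheory.integral_const_mul]
  congr 1
  funext y
  have h : (a • η).coeff c y = a * η.coeff c y := rfl
  rw [h]
  ring

theorem DForm.integral_sub (o : OrientationForm m S) {η θ : DForm (EuclideanSpace ℝ (Fin m)) S m}
    (hη : η.IsSmooth) (hθ : θ.IsSmooth) :
    DForm.integral o (η - θ) = DForm.integral o η - DForm.integral o θ := by
  have h := DForm.integral_add o (hη.sub hθ) hθ
  rw [sub_add_cancel] at h
  rw [h, add_sub_cancel_right]

theorem DForm.integral_zero (o : OrientationForm m S) :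
    DForm.integral o (0 : DForm (EuclideanSpace ℝ (Fin m)) S m) = 0 := by
  have h := DForm.integral_smul o 0 (0 : DForm (EuclideanSpace ℝ (Fin m)) S m)
  rwa [zero_smul, zero_mul] at h

/-- The fundamental lemma of the calculus of variations. -/
theorem DForm.IsSmooth.eq_zero_of_integral_smul (o : OrientationForm m S)
    {η : DForm (EuclideanSpace ℝ (Fin m)) S m} (hη : η.IsSmooth)
    (h : ∀ f : S → ℝ, ContMDiff (𝓡 m) 𝓘(ℝ, ℝ) ∞ f →
      DForm.integral o (fun x => f x • η x) = 0) : η = 0 := by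
  set e : Fin m → EuclideanSpace ℝ (Fin m) := fun i => EuclideanSpace.single i (1 : ℝ) with he
  -- The test function is the ratio of `η` to the orientation form. It is independent of the chart,
  -- and it turns the density of `f • η` into `f ^ 2` times the absolute value of the orientation
  -- coefficient.
  set f : S → ℝ := fun x => η x e / o.form x e with hfdef
  have ho : ∀ x, o.form x e ≠ 0 := fun x hx => o.ne_zero x (alternating_eq_zero_of_single hx)
  have hfo : ∀ x, η x = f x • o.form x := fun x => by
    refine sub_eq_zero.1 (alternating_eq_zero_of_single ?_)
    change η x e - f x * o.form x e = 0
    rw [hfdef, div_mul_cancel₀ _ (ho x), sub_self]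
  have hcoeff : ∀ c y, η.coeff c y = f ((extChartAt (𝓡 m) c).symm y) * o.form.coeff c y := by
    intro c y
    rw [DForm.apply_eq_coeff, DForm.apply_eq_coeff, hfo]
    simp only [ContinuousAlternatingMap.smul_apply, smul_eq_mul]
    ring
  have hf : ContMDiff (𝓡 m) 𝓘(ℝ, ℝ) ∞ f := by
    intro x
    have hx := mem_extChartAt_target (I := 𝓡 m) x
    have h1 : ContDiffAt ℝ ∞ (fun y => η.coeff x y / o.form.coeff x y) (extChartAt (𝓡 m) x x) :=
      (hη.contDiffAt_coeff hx).div (o.smooth.contDiffAt_coeff hx) (o.coeff_ne_zero hx)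
    have h2 := ContMDiffAt.comp x h1.contMDiffAt
      (contMDiffAt_chart (E := EuclideanSpace ℝ (Fin m)) (mem_extChartAt_source x))
    refine h2.congr_of_eventuallyEq ?_
    filter_upwards [(isOpen_extChartAt_source (I := 𝓡 m) x).mem_nhds (mem_extChartAt_source x)]
      with z hz
    have hz' := (extChartAt (𝓡 m) x).map_source hz
    rw [Function.comp_apply, hcoeff, (extChartAt (𝓡 m) x).left_inv hz,
      mul_div_cancel_right₀ _ (o.coeff_ne_zero hz')]
  have hfη := hη.smul hf
  have hpos : ∀ c, ∀ y ∈ (extChartAt (𝓡 m) c).target, o.chartSign c y *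
      (chartPartition m S c ((extChartAt (𝓡 m) c).symm y) *
        DForm.coeff c (fun x => f x • η x) y) =
      chartPartition m S c ((extChartAt (𝓡 m) c).symm y) *
        (f ((extChartAt (𝓡 m) c).symm y) ^ 2 * |o.form.coeff c y|) := by
    intro c y hy
    have h1 : DForm.coeff c (fun x => f x • η x) y =
        f ((extChartAt (𝓡 m) c).symm y) * η.coeff c y := rfl
    rw [h1, hcoeff, OrientationForm.chartSign, ← sign_mul_self]
    ring
  have hsum := h f hf
  rw [DForm.integral_eq_sum] at hsum
  have hnn : ∀ c, ∀ y ∈ (extChartAt (𝓡 m) c).target, 0 ≤ o.chartSign c y *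
      (chartPartition m S c ((extChartAt (𝓡 m) c).symm y) *
        DForm.coeff c (fun x => f x • η x) y) := by
    intro c y hy
    rw [hpos c y hy]
    have := (chartPartition m S).nonneg c ((extChartAt (𝓡 m) c).symm y)
    positivity
  -- All summands are nonnegative, so each chart contributes zero separately.
  have hz := (Finset.sum_eq_zero_iff_of_nonneg fun c _ =>
    setIntegral_nonneg (isOpen_extChartAt_target c).measurableSet (hnn c)).1 hsum
  funext x
  obtain ⟨c, hc⟩ := (chartPartition m S).exists_pos_of_mem (mem_univ x)
  have hxc : x ∈ (extChartAt (𝓡 m) c).source := by_contra fun hx => by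
    rw [chartPartition_eq_zero hx] at hc
    exact lt_irrefl _ hc
  have hcT : c ∈ activeCharts m S := by_contra fun hx => by
    rw [chartPartition_eq_zero_of_notMem hx] at hc
    exact lt_irrefl _ hc
  -- Extended by zero, the nonnegative density is continuous, so vanishing of its integral forces it
  -- to vanish at every point and not only almost everywhere.
  have hd := continuous_chart_density o (chartPartition m S c).contMDiff.continuous (isClosed_tsupport _)
    (chartPartition_tsupport c) (hfη.continuousOn_coeff c)
    (fun y _ => chartPartition_mul_eq_zero y)
  have h0 := hz c hcT
  rw [← integral_indicator (isOpen_extChartAt_target c).measurableSet,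
    integral_eq_zero_iff_of_nonneg (fun y => indicator_nonneg (hnn c) y)
      (hd.1.integrable_of_hasCompactSupport hd.2)] at h0
  have h1 := congrFun ((Continuous.ae_eq_iff_eq _ hd.1 continuous_const).1 h0)
    (extChartAt (𝓡 m) c x)
  have hy := (extChartAt (𝓡 m) c).map_source hxc
  rw [indicator_of_mem hy, hpos c _ hy, (extChartAt (𝓡 m) c).left_inv hxc] at h1
  have h2 : f x = 0 := by
    have h3 := o.coeff_ne_zero hy
    change _ = (0 : ℝ) at h1
    have h4 := (mul_eq_zero.1 h1).resolve_left hc.ne'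
    exact pow_eq_zero_iff two_ne_zero |>.1 ((mul_eq_zero.1 h4).resolve_right (abs_ne_zero.2 h3))
  rw [hfo, h2, zero_smul]
  rfl

end IntegralBasics

/-! ### Independence of the integral from the chart -/

section ChartChange

variable {m : ℕ} {S : Type*} [TopologicalSpace S] [ChartedSpace (EuclideanSpace ℝ (Fin m)) S]
  [IsManifold (𝓡 m) ∞ S] [T2Space S] [CompactSpace S]

/-- Both coefficients are multiplied by the Jacobian determinant, so the sign of the orientation
contributes the sign of that determinant. The product scales by its absolute value, as the change of
variables formula demands. -/
theorem chartSign_mul_coeff_change (o : OrientationForm m S)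
    (η : DForm (EuclideanSpace ℝ (Fin m)) S m) {c c' : S}
    {y : EuclideanSpace ℝ (Fin m)} (hy : y ∈ (extChartAt (𝓡 m) c').target)
    (hy' : (extChartAt (𝓡 m) c').symm y ∈ (extChartAt (𝓡 m) c).source) :
    o.chartSign c' y * η.coeff c' y =
      |(fderiv ℝ (fun z => extChartAt (𝓡 m) c ((extChartAt (𝓡 m) c').symm z)) y).det| *
        (o.chartSign c (extChartAt (𝓡 m) c ((extChartAt (𝓡 m) c').symm y)) *
          η.coeff c (extChartAt (𝓡 m) c ((extChartAt (𝓡 m) c').symm y))) := by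
  unfold OrientationForm.chartSign
  rw [η.coeff_change hy hy', o.form.coeff_change hy hy', sign_mul, SignType.coe_mul,
    ← sign_mul_self]
  ring

/-- Integrands supported in the overlap of two charts have the same integral in both. -/
theorem setIntegral_chart_change (o : OrientationForm m S)
    (η : DForm (EuclideanSpace ℝ (Fin m)) S m) (f : S → ℝ) (c c' : S)
    (h : ∀ p, p ∉ (extChartAt (𝓡 m) c).source → η p = 0)
    (h' : ∀ p, p ∉ (extChartAt (𝓡 m) c').source → f p = 0) :
    ∫ y in (extChartAt (𝓡 m) c').target,
      o.chartSign c' y * (f ((extChartAt (𝓡 m) c').symm y) * η.coeff c' y) =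
    ∫ y in (extChartAt (𝓡 m) c).target,
      o.chartSign c y * (f ((extChartAt (𝓡 m) c).symm y) * η.coeff c y) := by
  set φ := extChartAt (𝓡 m) c with hφ
  set φ' := extChartAt (𝓡 m) c' with hφ'
  set U' := φ'.target ∩ φ'.symm ⁻¹' φ.source with hU'
  set U := φ.target ∩ φ.symm ⁻¹' φ'.source with hU
  have hopen : IsOpen U' := (continuousOn_extChartAt_symm c').isOpen_inter_preimage
    (isOpen_extChartAt_target c') (isOpen_extChartAt_source c)
  set ψ : EuclideanSpace ℝ (Fin m) → EuclideanSpace ℝ (Fin m) := fun z => φ (φ'.symm z) with hψ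
  have himage : ψ '' U' = U := by
    ext z
    constructor
    · rintro ⟨y, ⟨hy1, hy2⟩, rfl⟩
      refine ⟨φ.map_source hy2, ?_⟩
      rw [mem_preimage, hψ]
      simp only
      rw [φ.left_inv hy2]
      exact φ'.map_target hy1
    · rintro ⟨hz1, hz2⟩
      have e1 : φ'.symm (φ' (φ.symm z)) = φ.symm z := φ'.left_inv hz2
      refine ⟨φ' (φ.symm z), ⟨φ'.map_source hz2, ?_⟩, ?_⟩
      · rw [mem_preimage, e1]
        exact φ.map_target hz1
      · rw [hψ]
        simp only
        rw [e1, φ.right_inv hz1]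
  have hinj : InjOn ψ U' := by
    intro a ha b hb hab
    exact φ'.symm.injOn ha.1 hb.1 (φ.injOn ha.2 hb.2 hab)
  have hder : ∀ y ∈ U', HasFDerivWithinAt ψ (fderiv ℝ ψ y) U' y := by
    intro y hy
    have h1 : MDifferentiableAt (𝓡 m) (𝓡 m) ψ y :=
      MDifferentiableAt.comp y (mdifferentiableAt_chart hy.2)
        (mdifferentiableAt_chart_symm hy.1)
    exact h1.differentiableAt.hasFDerivAt.hasFDerivWithinAt
  -- Only the overlap of the charts matters: outside it the integrand dies in the chart at `c'`
  -- because of `η`, and in the chart at `c` because of `f`.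
  have e1 : ∫ y in φ'.target, o.chartSign c' y * (f (φ'.symm y) * η.coeff c' y) =
      ∫ y in U', o.chartSign c' y * (f (φ'.symm y) * η.coeff c' y) := by
    refine setIntegral_eq_of_subset_of_forall_sdiff_eq_zero
      (isOpen_extChartAt_target c').measurableSet inter_subset_left ?_
    rintro y ⟨hy, hyU⟩
    have h1 : φ'.symm y ∉ φ.source := fun h2 => hyU ⟨hy, h2⟩
    rw [(η.coeff_eq_zero_iff hy).2 (h _ h1), mul_zero, mul_zero]
  have e2 : ∫ y in φ.target, o.chartSign c y * (f (φ.symm y) * η.coeff c y) =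
      ∫ y in U, o.chartSign c y * (f (φ.symm y) * η.coeff c y) := by
    refine setIntegral_eq_of_subset_of_forall_sdiff_eq_zero
      (isOpen_extChartAt_target c).measurableSet inter_subset_left ?_
    rintro y ⟨hy, hyU⟩
    have h1 : φ.symm y ∉ φ'.source := fun h2 => hyU ⟨hy, h2⟩
    rw [h' _ h1, zero_mul, mul_zero]
  rw [e1, e2, ← himage, integral_image_eq_integral_abs_det_fderiv_smul volume
    hopen.measurableSet hder hinj]
  refine setIntegral_congr_fun hopen.measurableSet fun y hy => ?_
  simp only [smul_eq_mul]
  have h1 := chartSign_mul_coeff_change o η hy.1 hy.2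
  have h2 : φ.symm (ψ y) = φ'.symm y := φ.left_inv hy.2
  rw [h2]
  calc o.chartSign c' y * (f (φ'.symm y) * η.coeff c' y)
      = f (φ'.symm y) * (o.chartSign c' y * η.coeff c' y) := by ring
    _ = _ := by rw [h1]; ring

/-- The integral of a form supported in one chart is computed in that chart. -/
theorem DForm.IsSmooth.integral_eq_chart (o : OrientationForm m S)
    {η : DForm (EuclideanSpace ℝ (Fin m)) S m} (hη : η.IsSmooth) {c : S} {K : Set S}
    (hK : IsClosed K) (hKc : K ⊆ (extChartAt (𝓡 m) c).source) (h0 : ∀ p ∉ K, η p = 0) :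
    DForm.integral o η =
      ∫ y in (extChartAt (𝓡 m) c).target, o.chartSign c y * η.coeff c y := by
  rw [DForm.integral_eq_sum]
  have h1 : ∀ c' ∈ activeCharts m S, ∫ y in (extChartAt (𝓡 m) c').target,
      o.chartSign c' y * (chartPartition m S c' ((extChartAt (𝓡 m) c').symm y) * η.coeff c' y) =
      ∫ y in (extChartAt (𝓡 m) c).target,
      o.chartSign c y * (chartPartition m S c' ((extChartAt (𝓡 m) c).symm y) * η.coeff c y) :=
    fun c' _ => setIntegral_chart_change o η (chartPartition m S c') c c'
      (fun p hp => h0 p fun h => hp (hKc h)) (fun p hp => chartPartition_eq_zero hp)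
  -- Every piece is now written in the chart at `c`, where the functions of the partition add up to
  -- `1`.
  rw [Finset.sum_congr rfl h1, ← integral_finsetSum]
  · refine setIntegral_congr_fun (isOpen_extChartAt_target c).measurableSet fun y _ => ?_
    rw [← Finset.mul_sum, ← Finset.sum_mul, sum_chartPartition, one_mul]
  · intro c' _
    refine integrableOn_chart_density o (chartPartition m S c').contMDiff.continuous hK hKc
      (hη.continuousOn_coeff c) fun y hy hyK => ?_
    rw [(η.coeff_eq_zero_iff hy).2 (h0 _ hyK), mul_zero]

end ChartChange

/-! ### Stokes' theorem -/

section Stokes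

variable {m : ℕ} {S : Type*} [TopologicalSpace S]
  [ChartedSpace (EuclideanSpace ℝ (Fin (m + 1))) S]
  [IsManifold (𝓡 (m + 1)) ∞ S] [T2Space S] [CompactSpace S]

/-- In the chart, the coefficient of `dβ` is an alternating sum of partial derivatives of compactly
supported functions, and each of these integrates to zero. -/
theorem integral_d_eq_zero_of_chart (o : OrientationForm (m + 1) S)
    {β : DForm (EuclideanSpace ℝ (Fin (m + 1))) S m} (hβ : β.IsSmooth) {c : S} {K : Set S}
    (hK : IsClosed K) (hKc : K ⊆ (extChartAt (𝓡 (m + 1)) c).source) (h0 : ∀ p ∉ K, β p = 0) :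
    DForm.integral o β.d = 0 := by
  have hd0 : ∀ p ∉ K, β.d p = 0 := fun p hp => DForm.d_eq_zero_of_eventuallyEq (by
    filter_upwards [hK.isOpen_compl.mem_nhds hp] with z hz
    exact h0 z hz)
  rw [hβ.d.integral_eq_chart o hK hKc hd0]
  set U := (extChartAt (𝓡 (m + 1)) c).target with hU
  have hUo : IsOpen U := isOpen_extChartAt_target c
  set e : Fin (m + 1) → EuclideanSpace ℝ (Fin (m + 1)) :=
    fun i => EuclideanSpace.single i (1 : ℝ) with he
  -- The locally constant sign is absorbed into the components of `β` before they are extended by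
  -- zero to the whole model space.
  set b : Fin (m + 1) → EuclideanSpace ℝ (Fin (m + 1)) → ℝ :=
    fun i y => o.chartSign c y * β.inChart c y (i.removeNth e) with hb
  have hbs : ∀ i, ∀ y ∈ U, ContDiffAt ℝ ∞ (b i) y := fun i y hy => by
    have h1 : ContDiffAt ℝ ∞ (fun z => β.inChart c z (i.removeNth e)) y :=
      contDiffAt_alternating_apply (hβ.contDiffAt hy) (fun _ => contDiffAt_const)
    refine (contDiffAt_const (c := o.chartSign c y)|>.mul h1).congr_of_eventuallyEq ?_
    filter_upwards [o.eventually_chartSign_eq hy] with z hz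
    simp only [hb, hz]
  have hb0 : ∀ i, ∀ y ∈ U, y ∉ extChartAt (𝓡 (m + 1)) c '' K → b i y = 0 := fun i y hy hyK => by
    have h1 := h0 _ (notMem_of_notMem_image_chart hy hyK)
    have h2 : β.inChart c y = 0 := by
      unfold DForm.inChart
      rw [h1]
      rfl
    simp [hb, h2]
  have hKi := isCompact_image_chart hK hKc
  have hB : ∀ i, Continuous (U.indicator (b i)) ∧ HasCompactSupport (U.indicator (b i)) :=
    fun i => continuous_indicator_of_eq_zero hUo hKi.1 hKi.2
      (fun y hy => (hbs i y hy).continuousAt.continuousWithinAt) (hb0 i)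
  have hBe : ∀ i, ∀ y ∈ U, U.indicator (b i) =ᶠ[𝓝 y] b i := fun i y hy => by
    filter_upwards [hUo.mem_nhds hy] with z hz
    exact indicator_of_mem hz _
  have hBz : ∀ i, ∀ y ∉ extChartAt (𝓡 (m + 1)) c '' K, U.indicator (b i) =ᶠ[𝓝 y] fun _ => 0 :=
    fun i y hy => by
      filter_upwards [hKi.1.isClosed.isOpen_compl.mem_nhds hy] with z hz
      by_cases hzU : z ∈ U
      · rw [indicator_of_mem hzU, hb0 i z hzU hz]
      · exact indicator_of_notMem hzU _
  have hBs : ∀ i, ContDiff ℝ 1 (U.indicator (b i)) := fun i => contDiff_iff_contDiffAt.2 fun y => by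
    by_cases hy : y ∈ extChartAt (𝓡 (m + 1)) c '' K
    · exact ((hbs i y (hKi.2 hy)).of_le (by simp)).congr_of_eventuallyEq (hBe i y (hKi.2 hy))
    · exact contDiffAt_const.congr_of_eventuallyEq (hBz i y hy)
  have hpt : ∀ y ∈ U, o.chartSign c y * β.d.coeff c y =
      ∑ i : Fin (m + 1), (-1) ^ (i : ℕ) * fderiv ℝ (U.indicator (b i)) y (e i) := fun y hy => by
    have h1 : β.d.coeff c y = extDeriv (β.inChart c) y e := by
      unfold DForm.coeff
      rw [hβ.inChart_d hy]
    rw [h1, extDeriv_apply ((hβ.contDiffAt hy).differentiableAt (by simp)), Finset.mul_sum]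
    refine Finset.sum_congr rfl fun i _ => ?_
    have h2 : U.indicator (b i) =ᶠ[𝓝 y] fun z => o.chartSign c y *
        β.inChart c z (i.removeNth e) := by
      filter_upwards [hBe i y hy, o.eventually_chartSign_eq hy] with z hz1 hz2
      rw [hz1]
      simp only [hb, hz2]
    have h3 : DifferentiableAt ℝ (fun z => β.inChart c z (i.removeNth e)) y :=
      ((hβ.contDiffAt hy).differentiableAt (by simp)).continuousAlternatingMap_apply
        (fun _ => differentiableAt_const _)
    rw [h2.fderiv_eq, fderiv_const_mul h3]
    simp only [smul_apply, smul_eq_mul]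
    ring
  have hout : ∀ y ∉ U, ∑ i : Fin (m + 1), (-1) ^ (i : ℕ) * fderiv ℝ (U.indicator (b i)) y (e i) = 0 :=
    fun y hy => Finset.sum_eq_zero fun i _ => by
      rw [(hBz i y fun h => hy (hKi.2 h)).fderiv_eq]
      simp
  rw [setIntegral_congr_fun hUo.measurableSet hpt,
    setIntegral_eq_integral_of_forall_compl_eq_zero hout, integral_finsetSum]
  · refine Finset.sum_eq_zero fun i _ => ?_
    rw [integral_const_mul, integral_fderiv_apply_eq_zero volume (hBs i) (hB i).2, mul_zero]
  · intro i _
    refine Integrable.const_mul ?_ _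
    exact (((hBs i).continuous_fderiv one_ne_zero).clm_apply
      continuous_const).integrable_of_hasCompactSupport ((hB i).2.fderiv_apply (𝕜 := ℝ) (e i))

/-- **Stokes' theorem** on a compact oriented manifold without boundary. -/
theorem DForm.IsSmooth.integral_d_eq_zero (o : OrientationForm (m + 1) S)
    {β : DForm (EuclideanSpace ℝ (Fin (m + 1))) S m} (hβ : β.IsSmooth) :
    DForm.integral o β.d = 0 := by
  have hs : ∀ c : S, DForm.IsSmooth (fun x => chartPartition (m + 1) S c x • β x) :=
    fun c => hβ.smul (chartPartition (m + 1) S c).contMDiff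
  -- Smoothness is carried through the induction because additivity of `d` and of the integral is
  -- available for smooth forms only.
  have key : ∀ T : Finset S,
      DForm.IsSmooth (∑ c ∈ T, fun x => chartPartition (m + 1) S c x • β x) ∧
      DForm.integral o (DForm.d (∑ c ∈ T, fun x => chartPartition (m + 1) S c x • β x)) = 0 := by
    intro T
    induction T using Finset.cons_induction with
    | empty =>
      rw [Finset.sum_empty, DForm.d_zero]
      exact ⟨DForm.isSmooth_zero _, DForm.integral_zero o⟩
    | cons c T hc ih =>
      rw [Finset.sum_cons]
      refine ⟨(hs c).add ih.1, ?_⟩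
      rw [DForm.d_add (hs c) ih.1, DForm.integral_add o (hs c).d ih.1.d, ih.2, add_zero]
      refine integral_d_eq_zero_of_chart o (hs c) (isClosed_tsupport (chartPartition (m + 1) S c))
        (chartPartition_tsupport c) fun p hp => ?_
      rw [image_eq_zero_of_notMem_tsupport hp, zero_smul]
  have h := (key (activeCharts (m + 1) S)).2
  have h2 : (∑ c ∈ activeCharts (m + 1) S, fun x => chartPartition (m + 1) S c x • β x) = β := by
    funext x
    rw [Finset.sum_apply, ← Finset.sum_smul, sum_chartPartition, one_smul]
  rwa [h2] at h

end Stokes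

/-! ### Differentiation under the integral sign -/

section Differentiation

variable {m : ℕ} {S : Type*} [TopologicalSpace S] [ChartedSpace (EuclideanSpace ℝ (Fin m)) S]
  [IsManifold (𝓡 m) ∞ S] [T2Space S] [CompactSpace S]

/-- Differentiation under the integral sign for a smooth family of forms. -/
theorem DForm.hasDerivAt_integral (o : OrientationForm m S)
    {θ : ℝ → DForm (EuclideanSpace ℝ (Fin m)) S m} {D : DForm (EuclideanSpace ℝ (Fin m)) S m}
    {t : ℝ}
    (hθ : ∀ (c : S), ∀ y ∈ (extChartAt (𝓡 m) c).target, ∀ r : ℝ, ContDiffAt ℝ ∞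
      (fun q : ℝ × EuclideanSpace ℝ (Fin m) => (θ q.1).coeff c q.2) (r, y))
    (hD : ∀ x v, HasDerivAt (fun r => θ r x v) (D x v) t) :
    HasDerivAt (fun r => DForm.integral o (θ r)) (DForm.integral o D) t := by
  simp only [DForm.integral_eq_sum]
  refine HasDerivAt.fun_sum fun c _ => ?_
  set U := (extChartAt (𝓡 m) c).target with hU
  have hUo : IsOpen U := isOpen_extChartAt_target c
  set ρ : EuclideanSpace ℝ (Fin m) → ℝ :=
    fun y => chartPartition m S c ((extChartAt (𝓡 m) c).symm y) with hρ
  set g : ℝ × EuclideanSpace ℝ (Fin m) → ℝ := fun q => (θ q.1).coeff c q.2 with hg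
  set g' : ℝ × EuclideanSpace ℝ (Fin m) → ℝ :=
    fun q => fderiv ℝ g q ((1 : ℝ), (0 : EuclideanSpace ℝ (Fin m))) with hg'
  have hgc : ContinuousOn g (univ ×ˢ U) := fun q hq =>
    (hθ c q.2 hq.2 q.1).continuousAt.continuousWithinAt
  have hg'c : ContinuousOn g' (univ ×ˢ U) := fun q hq => by
    have h1 : ContDiffAt ℝ ∞ (fderiv ℝ g) q := (hθ c q.2 hq.2 q.1).fderiv_right (by simp)
    exact (h1.continuousAt.clm_apply continuousAt_const).continuousWithinAt
  have hslice : ∀ r : ℝ, ContinuousOn (fun y => ((r, y) : ℝ × EuclideanSpace ℝ (Fin m))) U :=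
    fun r => by fun_prop
  have hmaps : ∀ r : ℝ, MapsTo (fun y => ((r, y) : ℝ × EuclideanSpace ℝ (Fin m))) U (univ ×ˢ U) :=
    fun r y hy => ⟨mem_univ _, hy⟩
  have hdiff : ∀ y ∈ U, ∀ r, HasDerivAt (fun r => g (r, y)) (g' (r, y)) r := fun y hy r => by
    have h1 := ((hθ c y hy r).differentiableAt (by simp)).hasFDerivAt
    have h2 : HasDerivAt (fun r : ℝ => ((r, y) : ℝ × EuclideanSpace ℝ (Fin m)))
        ((1 : ℝ), (0 : EuclideanSpace ℝ (Fin m))) r :=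
      (hasDerivAt_id r).prodMk (hasDerivAt_const r y)
    exact h1.comp_hasDerivAt r h2
  -- The hypothesis on `D` fixes the vectors inserted into the form, so it applies to the coordinate
  -- vectors at a fixed point; uniqueness of derivatives identifies the two expressions.
  have hgD : ∀ y ∈ U, g' (t, y) = D.coeff c y := fun y hy =>
    (hdiff y hy t).unique (hD ((extChartAt (𝓡 m) c).symm y) (fun i =>
      tanMap (E := EuclideanSpace ℝ (Fin m)) (E' := EuclideanSpace ℝ (Fin m))
        (extChartAt (𝓡 m) c).symm y (EuclideanSpace.single i (1 : ℝ))))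
  have hKi := isCompact_image_chart (isClosed_tsupport (chartPartition m S c))
    (chartPartition_tsupport c)
  set K := extChartAt (𝓡 m) c '' tsupport (chartPartition m S c) with hK
  -- The dominating function is a constant on the compact support of the partition function in the
  -- chart, with times restricted to a compact interval about `t`; off that support the integrand is
  -- zero.
  obtain ⟨C, hC⟩ := ((isCompact_Icc (a := t - 1) (b := t + 1)).prod hKi.1).exists_bound_of_continuousOn
    (f := fun q : ℝ × EuclideanSpace ℝ (Fin m) => o.chartSign c q.2 * (ρ q.2 * g' q)) (by
      have h1 : ContinuousOn (fun y => o.chartSign c y) U := o.continuousOn_chartSign c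
      have h2 : ContinuousOn ρ U :=
        continuousOn_comp_chart_symm (chartPartition m S c).contMDiff.continuous c
      have h3 : MapsTo (fun q : ℝ × EuclideanSpace ℝ (Fin m) => q.2)
        (Icc (t - 1) (t + 1) ×ˢ K) U := fun q hq => hKi.2 hq.2
      refine (h1.comp continuousOn_snd h3).mul ((h2.comp continuousOn_snd h3).mul (hg'c.mono ?_))
      exact fun q hq => ⟨mem_univ _, h3 hq⟩)
  have hmain := hasDerivAt_integral_of_dominated_loc_of_deriv_le (μ := volume.restrict U)
    (F := fun r y => o.chartSign c y * (ρ y * g (r, y)))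
    (F' := fun r y => o.chartSign c y * (ρ y * g' (r, y)))
    (bound := K.indicator fun _ => C) (x₀ := t) (s := Icc (t - 1) (t + 1))
    (Icc_mem_nhds (by linarith) (by linarith))
    (Eventually.of_forall fun r => (integrableOn_chartPartition_density o
      (hgc.comp (hslice r) (hmaps r))).aestronglyMeasurable)
    (integrableOn_chartPartition_density o (hgc.comp (hslice t) (hmaps t)))
    (integrableOn_chartPartition_density o (hg'c.comp (hslice t) (hmaps t))).aestronglyMeasurable
    (by
      refine (ae_restrict_mem hUo.measurableSet).mono fun y hy r hr => ?_
      by_cases hyK : y ∈ K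
      · rw [indicator_of_mem hyK]
        exact hC (r, y) ⟨hr, hyK⟩
      · have h1 := image_eq_zero_of_notMem_tsupport (notMem_of_notMem_image_chart hy hyK)
        change ρ y = 0 at h1
        simp [indicator_of_notMem hyK, h1])
    ((integrable_indicator_iff hKi.1.measurableSet).2
      (integrableOn_const (by
        rw [Measure.restrict_apply hKi.1.measurableSet]
        exact ((measure_mono inter_subset_left).trans_lt hKi.1.measure_lt_top).ne)))
    (by
      refine (ae_restrict_mem hUo.measurableSet).mono fun y hy r _ => ?_
      exact ((hdiff y hy r).const_mul (ρ y)).const_mul (o.chartSign c y))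
  refine hmain.2.congr_deriv ?_
  refine setIntegral_congr_fun hUo.measurableSet fun y hy => ?_
  simp only [hgD y hy]
  rfl

end Differentiation

/-! ### Vector fields along maps -/

section VectorFieldsAlong

variable {A : Type*} [NormedAddCommGroup A] [NormedSpace ℝ A]
  {H : Type*} [TopologicalSpace H] {I : ModelWithCorners ℝ A H}
  {L : Type*} [TopologicalSpace L] [ChartedSpace H L]
  {E' : Type*} [NormedAddCommGroup E'] [NormedSpace ℝ E']
  {N : Type*} [TopologicalSpace N] [ChartedSpace E' N] [IsManifold 𝓘(ℝ, E') ∞ N]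
  {E'' : Type*} [NormedAddCommGroup E''] [NormedSpace ℝ E'']

theorem contMDiffAt_along_smul {f : L → N} {u : L → E'} {a : L} {r : L → ℝ}
    (hr : ContMDiffAt I 𝓘(ℝ, ℝ) ∞ r a) (hu : ContMDiffAt I 𝓘(ℝ, E').tangent ∞
      (fun y => (⟨f y, u y⟩ : TangentBundle 𝓘(ℝ, E') N)) a) :
    ContMDiffAt I 𝓘(ℝ, E').tangent ∞
      (fun y => (⟨f y, r y • u y⟩ : TangentBundle 𝓘(ℝ, E') N)) a := by
  obtain ⟨h1, h2⟩ := contMDiffAt_along_iff.1 hu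
  refine contMDiffAt_along_iff.2 ⟨h1, (hr.smul h2).congr_of_eventuallyEq ?_⟩
  exact Eventually.of_forall fun y => map_smul
    (tanMap (E := E') (E' := E') (extChartAt 𝓘(ℝ, E') (f a)) (f y)) (r y) (u y)

theorem contMDiffAt_along_zero {f : L → N} {a : L} (hf : ContMDiffAt I 𝓘(ℝ, E') ∞ f a) :
    ContMDiffAt I 𝓘(ℝ, E').tangent ∞
      (fun y => (⟨f y, (0 : E')⟩ : TangentBundle 𝓘(ℝ, E') N)) a := by
  refine contMDiffAt_along_iff.2 ⟨hf, (contMDiffAt_const (c := (0 : E'))).congr_of_eventuallyEq ?_⟩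
  exact Eventually.of_forall fun y => map_zero
    (tanMap (E := E') (E' := E') (extChartAt 𝓘(ℝ, E') (f a)) (f y))

/-- The chain rule through a chart at `f a` writes the field as the derivative of the coordinate
expression of `g` applied to the coordinates of `u`, both smooth. -/
theorem contMDiffAt_tanMap_along {f : L → N} {u : L → E'} {a : L}
    (hu : ContMDiffAt I 𝓘(ℝ, E').tangent ∞
      (fun y => (⟨f y, u y⟩ : TangentBundle 𝓘(ℝ, E') N)) a) {g : N → E''}
    (hg : ContMDiffAt 𝓘(ℝ, E') 𝓘(ℝ, E'') ∞ g (f a)) :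
    ContMDiffAt I 𝓘(ℝ, E'') ∞ (fun y => tanMap (E := E') (E' := E'') g (f y) (u y)) a := by
  obtain ⟨h1, h2⟩ := contMDiffAt_along_iff.1 hu
  set φ := extChartAt 𝓘(ℝ, E') (f a) with hφ
  have hφt : φ (f a) ∈ φ.target := mem_extChartAt_target (f a)
  have hφs : f a ∈ φ.source := mem_extChartAt_source (f a)
  have hgφ : ContDiffAt ℝ ∞ (fun z => g (φ.symm z)) (φ (f a)) := by
    refine (ContMDiffAt.comp (φ (f a)) (g := g) ?_ (contMDiffAt_chart_symm hφt)).contDiffAt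
    rw [hφ, extChartAt_to_inv]
    exact hg
  have h3 : ContMDiffAt 𝓘(ℝ, E') 𝓘(ℝ, E' →L[ℝ] E'') ∞
      (fderiv ℝ (fun z => g (φ.symm z))) (φ (f a)) :=
    (hgφ.fderiv_right (m := ∞) (by simp)).contMDiffAt
  have h4 : ContMDiffAt I 𝓘(ℝ, E' →L[ℝ] E'') ∞
      (fun y => fderiv ℝ (fun z => g (φ.symm z)) (φ (f y))) a :=
    ContMDiffAt.comp a h3 (ContMDiffAt.comp a (contMDiffAt_chart hφs) h1)
  refine (h4.clm_apply h2).congr_of_eventuallyEq ?_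
  filter_upwards [h1.continuousAt.eventually ((isOpen_extChartAt_source (f a)).mem_nhds hφs),
    h1.continuousAt.eventually (eventually_mdifferentiableAt hg)] with y hy hgy
  have hyt := φ.map_source hy
  have e1 : φ.symm (φ (f y)) = f y := φ.left_inv hy
  rw [← tanMap_eq_fderiv, tanMap_comp (by rw [e1]; exact hgy) (mdifferentiableAt_chart_symm hyt),
    e1]
  have e2 := congrArg (fun l : E' →L[ℝ] E' => l (u y)) (tanMap_symm_comp_chart hy)
  exact (congrArg (tanMap (E := E') (E' := E'') g (f y)) e2).symm

end VectorFieldsAlong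

/-! ### Adapted charts of a submersion and vertical extensions -/

section Submersions

variable {EB : Type*} [NormedAddCommGroup EB] [NormedSpace ℝ EB]
  {B : Type*} [TopologicalSpace B] [ChartedSpace EB B] [IsManifold 𝓘(ℝ, EB) ∞ B]
  {EF : Type*} [NormedAddCommGroup EF] [NormedSpace ℝ EF]
  {F : Type*} [TopologicalSpace F] [ChartedSpace EF F] [IsManifold 𝓘(ℝ, EF) ∞ F]

theorem contMDiffAt_of_mem_maximalAtlas' {φ : OpenPartialHomeomorph F EF}
    (hφ : φ ∈ IsManifold.maximalAtlas 𝓘(ℝ, EF) ∞ F) {q : F} (hq : q ∈ φ.source) :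
    ContMDiffAt 𝓘(ℝ, EF) 𝓘(ℝ, EF) ∞ φ q :=
  (contMDiffOn_of_mem_maximalAtlas hφ).contMDiffAt (φ.open_source.mem_nhds hq)

theorem contMDiffAt_symm_of_mem_maximalAtlas' {φ : OpenPartialHomeomorph F EF}
    (hφ : φ ∈ IsManifold.maximalAtlas 𝓘(ℝ, EF) ∞ F) {y : EF} (hy : y ∈ φ.target) :
    ContMDiffAt 𝓘(ℝ, EF) 𝓘(ℝ, EF) ∞ φ.symm y :=
  (contMDiffOn_symm_of_mem_maximalAtlas hφ).contMDiffAt (φ.open_target.mem_nhds hy)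

theorem tanMap_symm_comp_of_mem_maximalAtlas {φ : OpenPartialHomeomorph F EF}
    (hφ : φ ∈ IsManifold.maximalAtlas 𝓘(ℝ, EF) ∞ F) {q : F} (hq : q ∈ φ.source) (v : EF) :
    tanMap (E := EF) (E' := EF) φ.symm (φ q) (tanMap (E := EF) (E' := EF) φ q v) = v := by
  have h := tanMap_comp (f := φ) (g := φ.symm) (x := q)
    ((contMDiffAt_symm_of_mem_maximalAtlas' hφ (φ.map_source hq)).mdifferentiableAt (by simp))
    ((contMDiffAt_of_mem_maximalAtlas' hφ hq).mdifferentiableAt (by simp))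
  rw [tanMap_id_of_eventuallyEq (by
    filter_upwards [φ.open_source.mem_nhds hq] with z hz
    exact φ.left_inv hz)] at h
  exact (congrArg (fun l : EF →L[ℝ] EF => l v) h).symm

theorem tanMap_comp_symm_of_mem_maximalAtlas {φ : OpenPartialHomeomorph F EF}
    (hφ : φ ∈ IsManifold.maximalAtlas 𝓘(ℝ, EF) ∞ F) {y : EF} (hy : y ∈ φ.target) (w : EF) :
    tanMap (E := EF) (E' := EF) φ (φ.symm y) (tanMap (E := EF) (E' := EF) φ.symm y w) = w := by
  have h := tanMap_comp (f := φ.symm) (g := φ) (x := y)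
    ((contMDiffAt_of_mem_maximalAtlas' hφ (φ.map_target hy)).mdifferentiableAt (by simp))
    ((contMDiffAt_symm_of_mem_maximalAtlas' hφ hy).mdifferentiableAt (by simp))
  rw [tanMap_id_of_eventuallyEq (by
    filter_upwards [φ.open_target.mem_nhds hy] with z hz
    exact φ.right_inv hz)] at h
  exact (congrArg (fun l : EF →L[ℝ] EF => l w) h).symm

/-- In adapted charts a submersion is a linear map. -/
structure AdaptedCharts (π : F → B) (φ : OpenPartialHomeomorph F EF)
    (ψ : OpenPartialHomeomorph B EB) (L : EF →L[ℝ] EB) : Prop where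
  domChart : φ ∈ IsManifold.maximalAtlas 𝓘(ℝ, EF) ∞ F
  codChart : ψ ∈ IsManifold.maximalAtlas 𝓘(ℝ, EB) ∞ B
  mapsTo : ∀ q ∈ φ.source, π q ∈ ψ.source
  eq : ∀ q ∈ φ.source, ψ (π q) = L (φ q)

theorem IsBundle.contMDiff {π : F → B} (hπ : IsBundle EB EF π) :
    ContMDiff 𝓘(ℝ, EF) 𝓘(ℝ, EB) ∞ π := hπ.submersion.contMDiff

/-- The local normal form of a submersion is the projection of a product; composed with the linear
identification of `EF` with that product, it is the linear map `L`. -/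
theorem IsBundle.exists_adaptedCharts {π : F → B} (hπ : IsBundle EB EF π) (p : F) :
    ∃ (φ : OpenPartialHomeomorph F EF) (ψ : OpenPartialHomeomorph B EB) (L : EF →L[ℝ] EB),
      p ∈ φ.source ∧ AdaptedCharts π φ ψ L := by
  have h := hπ.submersion.isSubmersionOfComplement_complement p
  refine ⟨h.domChart, h.codChart, (ContinuousLinearMap.fst ℝ EB hπ.submersion.complement).comp
    (h.equiv : EF →L[ℝ] EB × hπ.submersion.complement), h.mem_domChart_source, h.domChart_mem_maximalAtlas,
    h.codChart_mem_maximalAtlas, fun q hq => h.source_subset_preimage_source hq, fun q hq => ?_⟩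
  have hq' : h.domChart q ∈ (h.domChart.extend 𝓘(ℝ, EF)).target := by
    simpa using h.domChart.map_source hq
  have h1 := h.writtenInCharts hq'
  simpa [h.domChart.left_inv hq] using h1

/-- Differentiate `ψ ∘ π = L ∘ φ` and use that the tangent map of the chart `ψ` is injective. -/
theorem AdaptedCharts.isVertical_iff {π : F → B} (hπ : ContMDiff 𝓘(ℝ, EF) 𝓘(ℝ, EB) ∞ π)
    {φ : OpenPartialHomeomorph F EF} {ψ : OpenPartialHomeomorph B EB} {L : EF →L[ℝ] EB}
    (h : AdaptedCharts π φ ψ L) {q : F} (hq : q ∈ φ.source) (v : EF) :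
    IsVertical EB π q v ↔ L (tanMap (E := EF) (E' := EF) φ q v) = 0 := by
  have hψ := contMDiffAt_of_mem_maximalAtlas' h.codChart (h.mapsTo q hq)
  have h1 := tanMap_comp (f := π) (g := ψ) (x := q) (hψ.mdifferentiableAt (by simp))
    ((hπ q).mdifferentiableAt (by simp))
  have h2 := tanMap_comp (f := φ) (g := L) (x := q)
    (L.differentiableAt.mdifferentiableAt)
    ((contMDiffAt_of_mem_maximalAtlas' h.domChart hq).mdifferentiableAt (by simp))
  have h3 : tanMap (E := EF) (E' := EB) (fun y => ψ (π y)) q =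
      tanMap (E := EF) (E' := EB) (fun y => L (φ y)) q := by
    apply Filter.EventuallyEq.mfderiv_eq
    filter_upwards [φ.open_source.mem_nhds hq] with z hz
    exact h.eq z hz
  rw [tanMap_eq_fderiv, L.fderiv] at h2
  have h4 : tanMap (E := EB) (E' := EB) ψ (π q) (tanMap (E := EF) (E' := EB) π q v) =
      L (tanMap (E := EF) (E' := EF) φ q v) :=
    congrArg (fun l : EF →L[ℝ] EB => l v) ((h1.symm.trans h3).trans h2)
  rw [← h4]
  refine ⟨fun hv => ?_, fun hv => ?_⟩
  · unfold IsVertical at hv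
    rw [hv, map_zero]
  · have h5 := tanMap_symm_comp_of_mem_maximalAtlas h.codChart (h.mapsTo q hq)
      (tanMap (E := EF) (E' := EB) π q v)
    rw [hv, map_zero] at h5
    exact h5.symm

/-- Every vertical vector extends to a smooth vertical vector field. -/
theorem IsBundle.exists_vertical_extension [FiniteDimensional ℝ EF] [T2Space F] {π : F → B}
    (hπ : IsBundle EB EF π) {p : F} {v : EF} (hv : IsVertical EB π p v) :
    ∃ Z : F → EF, ContMDiff 𝓘(ℝ, EF) 𝓘(ℝ, EF).tangent ∞
        (fun q => (⟨q, Z q⟩ : TangentBundle 𝓘(ℝ, EF) F)) ∧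
      (∀ q, IsVertical EB π q (Z q)) ∧ Z p = v := by
  classical
  obtain ⟨φ, ψ, L, hp, h⟩ := hπ.exists_adaptedCharts p
  obtain ⟨χ, -, hχ⟩ := (SmoothBumpFunction.nhds_basis_tsupport (I := 𝓘(ℝ, EF)) p).mem_iff.1
    (φ.open_source.mem_nhds hp)
  set w := tanMap (E := EF) (E' := EF) φ p v with hw
  have hLw : L w = 0 := (h.isVertical_iff hπ.contMDiff hp v).1 hv
  -- In the adapted chart this is a constant field in the kernel of `L`, hence vertical throughout
  -- the chart, cut off by a bump function that equals `1` at `p`.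
  set Z : F → EF := fun q => χ q • tanMap (E := EF) (E' := EF) φ.symm (φ q) w with hZ
  have hχ0 : ∀ q ∉ φ.source, χ q = 0 := fun q hq =>
    image_eq_zero_of_notMem_tsupport fun hq' => hq (hχ hq')
  refine ⟨Z, fun q => ?_, fun q => ?_, ?_⟩
  · by_cases hq : q ∈ φ.source
    · refine contMDiffAt_along_smul χ.contMDiffAt ?_
      have h1 := contMDiffAt_along_tanMap
        (contMDiffAt_symm_of_mem_maximalAtlas' h.domChart (φ.map_source hq)) w
      have h2 := ContMDiffAt.comp q h1 (contMDiffAt_of_mem_maximalAtlas' h.domChart hq)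
      refine h2.congr_of_eventuallyEq ?_
      filter_upwards [φ.open_source.mem_nhds hq] with z hz
      have h3 : ∀ z', z' = z → (⟨z', tanMap (E := EF) (E' := EF) φ.symm (φ z) w⟩ :
          TangentBundle 𝓘(ℝ, EF) F) = ⟨z, tanMap (E := EF) (E' := EF) φ.symm (φ z) w⟩ := by
        rintro _ rfl
        rfl
      exact (h3 _ (φ.left_inv hz)).symm
    · refine (contMDiffAt_along_zero contMDiffAt_id).congr_of_eventuallyEq ?_
      filter_upwards [(isClosed_tsupport χ).isOpen_compl.mem_nhds fun hq' => hq (hχ hq')]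
        with z hz
      have h1 : Z z = 0 := by
        rw [hZ]
        simp only
        rw [image_eq_zero_of_notMem_tsupport hz, zero_smul]
      rw [h1]
      rfl
  · by_cases hq : q ∈ φ.source
    · rw [h.isVertical_iff hπ.contMDiff hq, hZ]
      simp only
      have h1 := tanMap_comp_symm_of_mem_maximalAtlas h.domChart (φ.map_source hq) w
      rw [φ.left_inv hq] at h1
      rw [map_smul, map_smul, h1, hLw, smul_zero]
    · have h1 : Z q = 0 := by
        rw [hZ]
        simp only
        rw [hχ0 q hq, zero_smul]
      rw [h1]
      exact map_zero _
  · have h1 := tanMap_symm_comp_of_mem_maximalAtlas h.domChart hp v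
    rw [hZ]
    simp only
    rw [χ.eq_one, one_smul]
    exact h1

end Submersions

/-! ### Existence of variations and uniqueness of differentials -/

section Variations

variable {ES : Type*} [NormedAddCommGroup ES] [NormedSpace ℝ ES]
  {S : Type*} [TopologicalSpace S] [ChartedSpace ES S] [IsManifold 𝓘(ℝ, ES) ∞ S]
  {EK : Type*} [NormedAddCommGroup EK] [NormedSpace ℝ EK]
  {K : Type*} [TopologicalSpace K] [ChartedSpace EK K] [IsManifold 𝓘(ℝ, EK) ∞ K]
  {π : K → S}

theorem BundleSection.ext_toFun {σ σ' : BundleSection ES EK π} (h : ∀ x, σ x = σ' x) : σ = σ' := by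
  cases σ
  cases σ'
  congr
  exact funext h

/-- The product of a vertical field along a section with a smooth function. -/
def BundleSection.smulTangent {σ : BundleSection ES EK π} {f : S → ℝ}
    (hf : ContMDiff 𝓘(ℝ, ES) 𝓘(ℝ, ℝ) ∞ f) (V : σ.tangent) : σ.tangent :=
  ⟨fun x => f x • V.1 x, fun x => contMDiffAt_along_smul (hf x) (V.2.1 x), fun x => by
    have h := V.2.2 x
    unfold IsVertical at h ⊢
    rw [map_smul, h, smul_zero]⟩

/-- A bounded reparametrization of time with unit speed at `0`: variations must be defined for all
real times, while the motion along straight lines stays in the chart only for short times. A sine of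
amplitude `δ / 2` makes the bound strict. -/
theorem exists_cutoff {δ : ℝ} (hδ : 0 < δ) : ∃ s : ℝ → ℝ, ContDiff ℝ ∞ s ∧ s 0 = 0 ∧
    HasDerivAt s 1 0 ∧ ∀ t, |s t| < δ := by
  have hε : 0 < δ / 2 := by linarith
  refine ⟨fun t => δ / 2 * Real.sin (t / (δ / 2)), ?_, by simp, ?_, fun t => ?_⟩
  · exact contDiff_const.mul (Real.contDiff_sin.comp (contDiff_id.div_const _))
  · have h1 : HasDerivAt (fun t : ℝ => t / (δ / 2)) (1 / (δ / 2)) 0 :=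
      (hasDerivAt_id (0 : ℝ)).div_const _
    have h2 := (h1.sin).const_mul (δ / 2)
    refine h2.congr_deriv ?_
    rw [zero_div, Real.cos_zero]
    field_simp
  · rw [abs_mul, abs_of_pos hε]
    have := Real.abs_sin_le_one (t / (δ / 2))
    nlinarith

/-- A vertical field supported where the section lies in one adapted chart is the velocity of a
variation. -/
theorem exists_variation_of_tsupport_subset [CompactSpace S]
    (hπ : ContMDiff 𝓘(ℝ, EK) 𝓘(ℝ, ES) ∞ π) {φ : OpenPartialHomeomorph K EK}
    {ψ : OpenPartialHomeomorph S ES} {L : EK →L[ℝ] ES} (h : AdaptedCharts π φ ψ L)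
    (σ : BundleSection ES EK π) (V : σ.tangent) (hV : tsupport V.1 ⊆ σ ⁻¹' φ.source) :
    ∃ γ : ℝ → BundleSection ES EK π, IsVariation σ V γ := by
  classical
  set U : Set S := σ ⁻¹' φ.source with hU
  have hUo : IsOpen U := φ.open_source.preimage σ.smooth.continuous
  set a : S → EK := fun x => φ (σ x) with ha
  set w : S → EK := fun x => tanMap (E := EK) (E' := EK) φ (σ x) (V.1 x) with hw
  have hφs : ∀ x ∈ U, ContMDiffAt 𝓘(ℝ, EK) 𝓘(ℝ, EK) ∞ φ (σ x) := fun x hx =>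
    contMDiffAt_of_mem_maximalAtlas' h.domChart hx
  have hac : ∀ x ∈ U, ContMDiffAt 𝓘(ℝ, ES) 𝓘(ℝ, EK) ∞ a x := fun x hx =>
    ContMDiffAt.comp x (hφs x hx) (σ.smooth x)
  have hwc : ∀ x ∈ U, ContMDiffAt 𝓘(ℝ, ES) 𝓘(ℝ, EK) ∞ w x := fun x hx =>
    contMDiffAt_tanMap_along (V.2.1 x) (hφs x hx)
  have hw0 : ∀ x ∉ tsupport V.1, w x = 0 := fun x hx => by
    rw [hw]
    simp only
    rw [image_eq_zero_of_notMem_tsupport hx]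
    exact map_zero _
  have hat : ∀ x ∈ U, a x ∈ φ.target := fun x hx => φ.map_source hx
  have hLw : ∀ x ∈ U, L (w x) = 0 := fun x hx => (h.isVertical_iff hπ hx _).1 (V.2.2 x)
  -- Compactness of the support gives one time bound that works at all its points.
  have hev : ∀ᶠ r : ℝ in 𝓝 0, ∀ x ∈ tsupport V.1, a x + r • w x ∈ φ.target := by
    refine (isClosed_tsupport V.1).isCompact.eventually_forall_of_forall_eventually fun x hx => ?_
    have hxU := hV hx
    have h1 : ContinuousAt (fun z : ℝ × S => a z.2 + z.1 • w z.2) (0, x) :=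
      (ContinuousAt.comp (x := ((0 : ℝ), x)) (hac x hxU).continuousAt continuousAt_snd).add
        (continuousAt_fst.smul
          (ContinuousAt.comp (x := ((0 : ℝ), x)) (hwc x hxU).continuousAt continuousAt_snd))
    refine h1.eventually (φ.open_target.mem_nhds ?_)
    simpa using hat x hxU
  obtain ⟨δ, hδ, hball⟩ := Metric.eventually_nhds_iff.1 hev
  obtain ⟨s, hs, hs0, hs1, hsδ⟩ := exists_cutoff hδ
  have htarget : ∀ t, ∀ x ∈ U, a x + s t • w x ∈ φ.target := fun t x hx => by
    by_cases hxV : x ∈ tsupport V.1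
    · exact hball (by simpa using hsδ t) x hxV
    · rw [hw0 x hxV, smul_zero, add_zero]
      exact hat x hx
  -- The two branches agree off the support of `V`, where `w` vanishes, so they glue smoothly.
  set g : ℝ → S → K := fun t x => if x ∈ U then φ.symm (a x + s t • w x) else σ x with hg
  have hgU : ∀ t, ∀ x ∈ U, g t x = φ.symm (a x + s t • w x) := fun t x hx => if_pos hx
  have hgV : ∀ t, ∀ x ∉ tsupport V.1, g t x = σ x := fun t x hx => by
    by_cases hxU : x ∈ U
    · rw [hgU t x hxU, hw0 x hx, smul_zero, add_zero]
      exact φ.left_inv hxU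
    · exact if_neg hxU
  have hsm : ContMDiff (𝓘(ℝ, ℝ).prod 𝓘(ℝ, ES)) 𝓘(ℝ, EK) ∞ (fun q : ℝ × S => g q.1 q.2) := by
    rintro ⟨t, x⟩
    by_cases hx : x ∈ tsupport V.1
    · have hxU : x ∈ U := hV hx
      have h1 : ContMDiffAt (𝓘(ℝ, ℝ).prod 𝓘(ℝ, ES)) 𝓘(ℝ, EK) ∞ (fun q : ℝ × S => a q.2) (t, x) :=
        ContMDiffAt.comp (t, x) (g := a) (f := Prod.snd) (hac x hxU) contMDiffAt_snd
      have h2 : ContMDiffAt (𝓘(ℝ, ℝ).prod 𝓘(ℝ, ES)) 𝓘(ℝ, EK) ∞ (fun q : ℝ × S => w q.2) (t, x) :=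
        ContMDiffAt.comp (t, x) (g := w) (f := Prod.snd) (hwc x hxU) contMDiffAt_snd
      have h3 : ContMDiffAt (𝓘(ℝ, ℝ).prod 𝓘(ℝ, ES)) 𝓘(ℝ, ℝ) ∞ (fun q : ℝ × S => s q.1) (t, x) :=
        ContMDiffAt.comp (t, x) hs.contMDiff.contMDiffAt contMDiffAt_fst
      have h4 : ContMDiffAt (𝓘(ℝ, ℝ).prod 𝓘(ℝ, ES)) 𝓘(ℝ, EK) ∞
          (fun q : ℝ × S => φ.symm (a q.2 + s q.1 • w q.2)) (t, x) :=
        ContMDiffAt.comp (t, x) (contMDiffAt_symm_of_mem_maximalAtlas' h.domChart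
          (htarget t x hxU)) (h1.add (h3.smul h2))
      refine h4.congr_of_eventuallyEq ?_
      filter_upwards [continuousAt_snd.eventually (hUo.mem_nhds hxU)] with q hq
      exact hgU q.1 q.2 hq
    · have h1 : ContMDiffAt (𝓘(ℝ, ℝ).prod 𝓘(ℝ, ES)) 𝓘(ℝ, EK) ∞ (fun q : ℝ × S => σ q.2) (t, x) :=
        (σ.smooth.comp contMDiff_snd).contMDiffAt
      refine h1.congr_of_eventuallyEq ?_
      filter_upwards [continuousAt_snd.eventually
        ((isClosed_tsupport V.1).isOpen_compl.mem_nhds hx)] with q hq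
      exact hgV q.1 q.2 hq
  have hsec : ∀ t x, π (g t x) = x := fun t x => by
    by_cases hxU : x ∈ U
    · have hz := φ.map_target (htarget t x hxU)
      rw [hgU t x hxU]
      have h1 := h.mapsTo _ hz
      have h2 := h.mapsTo _ hxU
      -- The direction `w x` lies in the kernel of `L`, so the motion stays in the fibre and the
      -- family consists of sections.
      have h3 : ψ (π (φ.symm (a x + s t • w x))) = ψ (π (σ x)) := by
        rw [h.eq _ hz, h.eq _ hxU, φ.right_inv (htarget t x hxU), map_add, map_smul, hLw x hxU,
          smul_zero, add_zero]
      rw [ψ.injOn h1 h2 h3, σ.section_eq]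
    · rw [hgV t x fun hx => hxU (hV hx), σ.section_eq]
  refine ⟨fun t => ⟨g t, fun x => ContMDiffAt.comp x (hsm (t, x))
    (contMDiffAt_const.prodMk contMDiffAt_id), hsec t⟩, hsm, ?_, fun x => ?_⟩
  · refine BundleSection.ext_toFun fun x => ?_
    by_cases hxU : x ∈ U
    · refine (hgU 0 x hxU).trans ?_
      rw [hs0, zero_smul, add_zero]
      exact φ.left_inv hxU
    · exact hgV 0 x fun hx => hxU (hV hx)
  · by_cases hxU : x ∈ U
    · have h1 : HasDerivAt (fun t => a x + s t • w x) (w x) 0 := by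
        simpa using (hs1.smul_const (w x)).const_add (a x)
      have h2 := tanMap_comp (f := fun t : ℝ => a x + s t • w x) (g := φ.symm) (x := 0)
        ((contMDiffAt_symm_of_mem_maximalAtlas' h.domChart
          (htarget 0 x hxU)).mdifferentiableAt (by simp))
        h1.differentiableAt.mdifferentiableAt
      rw [tanMap_eq_fderiv, h1.hasFDerivAt.fderiv] at h2
      have h3 := congrArg (fun l : ℝ →L[ℝ] EK => l 1) h2
      have h4 := tanMap_symm_comp_of_mem_maximalAtlas h.domChart hxU (V.1 x)
      have h5 : a x + s 0 • w x = φ (σ x) := by rw [hs0, zero_smul, add_zero]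
      have h6 : (fun t => g t x) = fun t => φ.symm (a x + s t • w x) :=
        funext fun t => hgU t x hxU
      change tanMap (E := ℝ) (E' := EK) (fun t => g t x) 0 1 = V.1 x
      rw [h6]
      refine h3.trans ?_
      simp only [ContinuousLinearMap.comp_apply]
      rw [h5]
      simpa using h4
    · have hxV : x ∉ tsupport V.1 := fun hx => hxU (hV hx)
      have h6 : (fun t => g t x) = fun _ => σ x := funext fun t => hgV t x hxV
      change tanMap (E := ℝ) (E' := EK) (fun t => g t x) 0 1 = V.1 x
      rw [h6, image_eq_zero_of_notMem_tsupport hxV]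
      unfold tanMap
      rw [mfderiv_const]
      rfl

/-- A differential of a functional on the space of sections is unique. -/
theorem HasDifferentialAt.unique [FiniteDimensional ℝ ES] [CompactSpace S] [T2Space S]
    (hπ : IsBundle ES EK π) {Φ : BundleSection ES EK π → ℝ} {σ : BundleSection ES EK π}
    {D D' : σ.tangent →ₗ[ℝ] ℝ} (hD : HasDifferentialAt Φ σ D) (hD' : HasDifferentialAt Φ σ D') :
    D = D' := by
  choose φ ψ L hmem hch using fun x => hπ.exists_adaptedCharts (σ x)
  obtain ⟨ρ, hρ⟩ := SmoothPartitionOfUnity.exists_isSubordinate 𝓘(ℝ, ES) (isClosed_univ (X := S))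
    (fun x => σ ⁻¹' (φ x).source)
    (fun x => (φ x).open_source.preimage σ.smooth.continuous)
    (fun x _ => mem_iUnion.2 ⟨x, hmem x⟩)
  have hfin : {i | (Function.support (ρ i)).Nonempty}.Finite :=
    ρ.locallyFinite.finite_nonempty_of_compact
  have hsum : ∀ x, ∑ i ∈ hfin.toFinset, ρ i x = 1 := fun x => by
    rw [← ρ.sum_eq_one (mem_univ x)]
    refine (finsum_eq_sum_of_support_subset _ fun i hi => ?_).symm
    exact hfin.mem_toFinset.2 ⟨x, hi⟩
  refine LinearMap.ext fun V => ?_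
  -- The definition of a differential constrains its values only on velocities of variations. Each
  -- summand is one, and linearity of `D` and `D'` extends the agreement to `V`.
  have hV : V = ∑ i ∈ hfin.toFinset, BundleSection.smulTangent (ρ i).contMDiff V := by
    apply Subtype.ext
    funext x
    rw [AddSubmonoidClass.coe_finsetSum, Finset.sum_apply]
    change V.1 x = ∑ i ∈ hfin.toFinset, ρ i x • V.1 x
    rw [← Finset.sum_smul, hsum, one_smul]
  rw [hV, map_sum, map_sum]
  refine Finset.sum_congr rfl fun i _ => ?_
  obtain ⟨γ, hγ⟩ := exists_variation_of_tsupport_subset hπ.contMDiff (hch i) σ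
    (BundleSection.smulTangent (ρ i).contMDiff V)
    ((tsupport_smul_subset_left (ρ i) V.1).trans (hρ i))
  exact (hD _ γ hγ).unique (hD' _ γ hγ)

end Variations

/-! ### The first variation of an integral -/

section VariationDerivative

variable {m : ℕ} {S : Type*} [TopologicalSpace S] [ChartedSpace (EuclideanSpace ℝ (Fin m)) S]
  [IsManifold (𝓡 m) ∞ S] [T2Space S] [CompactSpace S]
  {N : Type*} {E' : Type*} [NormedAddCommGroup E'] [NormedSpace ℝ E']
  [TopologicalSpace N] [ChartedSpace E' N] [IsManifold 𝓘(ℝ, E') ∞ N]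

theorem DForm.IsSmooth.contDiffAt_coeff_family {G : ℝ × S → N}
    (hG : ContMDiff (𝓘(ℝ, ℝ).prod (𝓡 m)) 𝓘(ℝ, E') ∞ G) {θ : DForm E' N m} (hθ : θ.IsSmooth)
    {c : S} {y : EuclideanSpace ℝ (Fin m)} (hy : y ∈ (extChartAt (𝓡 m) c).target) (t : ℝ) :
    ContDiffAt ℝ ∞ (fun q : ℝ × EuclideanSpace ℝ (Fin m) =>
      (DForm.pullback (E := EuclideanSpace ℝ (Fin m)) (fun x => G (q.1, x)) θ).coeff c q.2)
      (t, y) := by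
  have hF := contMDiffAt_familyInChart hG hy t
  have h := hθ.contDiffAt_along hF (fun i => contMDiffAt_along_tanMap hF
    ((0 : ℝ), (EuclideanSpace.single i (1 : ℝ) : EuclideanSpace ℝ (Fin m))))
  refine h.congr_of_eventuallyEq ?_
  filter_upwards [(continuousAt_snd (p := (t, y))).eventually
    (extChartAt_target_mem_nhds_of_mem hy)] with q hq
  exact (DForm.pullback_familyInChart_apply hG θ hq q.1 _).symm

/-- The first variation formula: the boundary term is exact and integrates to zero. -/
theorem DForm.IsSmooth.hasDerivAt_integral_pullback (o : OrientationForm m S) {G : ℝ × S → N}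
    (hG : ContMDiff (𝓘(ℝ, ℝ).prod (𝓡 m)) 𝓘(ℝ, E') ∞ G) {θ : DForm E' N m} (hθ : θ.IsSmooth)
    (t : ℝ) :
    HasDerivAt (fun r => DForm.integral o
        (DForm.pullback (E := EuclideanSpace ℝ (Fin m)) (fun x => G (r, x)) θ))
      (DForm.integral o (DForm.pullbackAlong (E := EuclideanSpace ℝ (Fin m)) (fun x => G (t, x))
        (timeVelocity E' G t) θ.d)) t := by
  have hs : ∀ (c : S), ∀ y ∈ (extChartAt (𝓡 m) c).target, ∀ r : ℝ, ContDiffAt ℝ ∞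
      (fun q : ℝ × EuclideanSpace ℝ (Fin m) =>
        (DForm.pullback (E := EuclideanSpace ℝ (Fin m)) (fun x => G (q.1, x)) θ).coeff c q.2)
      (r, y) := fun c y hy r => hθ.contDiffAt_coeff_family hG hy r
  have hGt := contMDiff_family_slice hG t
  have hV := contMDiff_along_timeVelocity hG t
  -- On a manifold of dimension zero `θ` is a function and there is no contraction `V ⌟ θ`, hence no
  -- boundary term and no use of Stokes' theorem.
  cases m with
  | zero =>
    exact DForm.hasDerivAt_integral o hs fun x v => hθ.hasDerivAt_pullback_family_zero hG t x v
  | succ k =>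
    have hβ := hθ.pullbackAlong hGt hV
    have h := DForm.hasDerivAt_integral o (D := DForm.pullbackAlong (fun x => G (t, x))
      (timeVelocity E' G t) θ.d + (DForm.pullbackAlong (fun x => G (t, x))
      (timeVelocity E' G t) θ).d) hs fun x v => hθ.hasDerivAt_pullback_family hG t x v
    rwa [DForm.integral_add o (hθ.d.pullbackAlong hGt hV) hβ.d, hβ.integral_d_eq_zero o,
      add_zero] at h

variable {π : N → S}

/-- The linear form `V ↦ ∫ σ^* (V ⌟ dθ)`. -/
def BundleSection.firstVariation (o : OrientationForm m S)
    (σ : BundleSection (EuclideanSpace ℝ (Fin m)) E' π) {θ : DForm E' N m} (hθ : θ.IsSmooth) :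
    σ.tangent →ₗ[ℝ] ℝ where
  toFun V := DForm.integral o
    (DForm.pullbackAlong (E := EuclideanSpace ℝ (Fin m)) σ.toFun V.1 θ.d)
  map_add' V W := by
    rw [← DForm.integral_add o (hθ.d.pullbackAlong σ.smooth V.2.1)
      (hθ.d.pullbackAlong σ.smooth W.2.1)]
    congr 1
    funext x
    ext v
    unfold DForm.pullbackAlong
    change (θ.d (σ x)).curryLeft (V.1 x + W.1 x) _ = _
    rw [map_add]
    rfl
  map_smul' a V := by
    rw [RingHom.id_apply, smul_eq_mul, ← DForm.integral_smul]
    congr 1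
    funext x
    ext v
    unfold DForm.pullbackAlong
    change (θ.d (σ x)).curryLeft (a • V.1 x) _ = _
    rw [map_smul]
    rfl

theorem BundleSection.hasDifferentialAt_firstVariation (o : OrientationForm m S)
    (σ : BundleSection (EuclideanSpace ℝ (Fin m)) E' π) {θ : DForm E' N m} (hθ : θ.IsSmooth) :
    HasDifferentialAt (fun σ : BundleSection (EuclideanSpace ℝ (Fin m)) E' π =>
      DForm.integral o (DForm.pullback (E := EuclideanSpace ℝ (Fin m)) σ.toFun θ)) σ
      (σ.firstVariation o hθ) := by
  intro V γ hγ
  have h := hθ.hasDerivAt_integral_pullback o hγ.smooth 0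
  have h1 : timeVelocity E' (fun q : ℝ × S => (γ q.1).toFun q.2) 0 = V.1 :=
    funext fun x => hγ.velocity x
  have h2 : (fun x => (γ 0).toFun x) = σ.toFun := by rw [hγ.start]
  rw [h1] at h
  simp only [h2] at h
  exact h

end VariationDerivative

/-! ### Smooth dependence of pullbacks on the parameter -/

section FamiliesOfForms

variable {E : Type*} [NormedAddCommGroup E] [NormedSpace ℝ E] [FiniteDimensional ℝ E]
  {M : Type*} [TopologicalSpace M] [ChartedSpace E M] [IsManifold 𝓘(ℝ, E) ∞ M]
  {E' : Type*} [NormedAddCommGroup E'] [NormedSpace ℝ E']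
  {N : Type*} [TopologicalSpace N] [ChartedSpace E' N] [IsManifold 𝓘(ℝ, E') ∞ N]

/-- It makes the `deriv` in the definition of `timeLieDeriv` a genuine derivative, so that its
vanishing is not an artefact of the default value `0`. -/
theorem DForm.IsSmooth.contDiffAt_pullback_family {G : ℝ × M → N}
    (hG : ContMDiff (𝓘(ℝ, ℝ).prod 𝓘(ℝ, E)) 𝓘(ℝ, E') ∞ G) {k : ℕ} {η : DForm E' N k}
    (hη : η.IsSmooth) (t : ℝ) (x : M) :
    ContDiffAt ℝ ∞ (fun r => DForm.pullback (E := E) (fun z => G (r, z)) η x) t := by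
  refine contDiffAt_alternating_of_apply fun v => ?_
  have hx := mem_extChartAt_target (I := 𝓘(ℝ, E)) x
  have hF := contMDiffAt_familyInChart hG hx t
  have h := hη.contDiffAt_along hF (fun i => contMDiffAt_along_tanMap hF ((0 : ℝ), v i))
  have h1 : ContDiffAt ℝ ∞ (fun r : ℝ => ((r, extChartAt 𝓘(ℝ, E) x x) : ℝ × E)) t :=
    contDiffAt_id.prodMk contDiffAt_const
  refine (ContDiffAt.comp t h h1).congr_of_eventuallyEq (Eventually.of_forall fun r => ?_)
  exact ((DForm.pullback_familyInChart_apply hG η hx r v).trans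
    (congrArg (fun l : E [⋀^Fin k]→L[ℝ] ℝ => l v) (DForm.inChart_self _ x))).symm

end FamiliesOfForms

/-! ### The forms on a time slice -/

section SlicingForms

variable {ES : Type*} [NormedAddCommGroup ES] [NormedSpace ℝ ES]
  {S : Type*} [TopologicalSpace S] [ChartedSpace ES S]
  {EK : Type*} [NormedAddCommGroup EK] [NormedSpace ℝ EK]
  {K : Type*} [TopologicalSpace K] [ChartedSpace EK K] [IsManifold 𝓘(ℝ, EK) ∞ K]
  {EB : Type*} [NormedAddCommGroup EB] [NormedSpace ℝ EB]
  {B : Type*} [TopologicalSpace B] [ChartedSpace EB B]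
  {EF : Type*} [NormedAddCommGroup EF] [NormedSpace ℝ EF]
  {F : Type*} [TopologicalSpace F] [ChartedSpace EF F] [IsManifold 𝓘(ℝ, EF) ∞ F]
  {πK : K → S} {πF : F → B}

namespace Slicing

variable (s : Slicing ES EK EB EF πK πF)

theorem contMDiff_sF : ContMDiff (𝓘(ℝ, ℝ).prod 𝓘(ℝ, EK)) 𝓘(ℝ, EF) ∞ (fun q => s.sF q) :=
  s.sF.contMDiff

theorem contMDiff_incl (τ : ℝ) : ContMDiff 𝓘(ℝ, EK) 𝓘(ℝ, EF) ∞ (s.incl τ) :=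
  contMDiff_family_slice s.contMDiff_sF τ

/-- The slicing is itself a family of maps `K → F` with velocity `∂₀`; this lets the homotopy
formula for families be applied to `𝓗_τ`. -/
theorem timeField_incl (τ : ℝ) (k : K) :
    s.timeField (s.incl τ k) = timeVelocity EF (fun q => s.sF q) τ k := by
  unfold timeField incl timeVelocity
  rw [s.sF.symm_apply_apply]

theorem hamForm_eq {k : ℕ} (lam : DForm EF F (k + 1)) (τ : ℝ) :
    s.hamForm lam τ = DForm.pullbackAlong (E := EK) (fun z => s.sF (τ, z))
      (timeVelocity EF (fun q => s.sF q) τ) lam := by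
  funext z
  unfold hamForm DForm.pullback DForm.interior
  rw [s.timeField_incl]
  rfl

theorem isSmooth_hamForm [FiniteDimensional ℝ EK] {k : ℕ} {lam : DForm EF F (k + 1)}
    (hlam : lam.IsSmooth) (τ : ℝ) : (s.hamForm lam τ).IsSmooth := by
  rw [hamForm_eq]
  exact hlam.pullbackAlong (contMDiff_family_slice s.contMDiff_sF τ)
    (contMDiff_along_timeVelocity s.contMDiff_sF τ)

theorem isSmooth_Omega [FiniteDimensional ℝ EK] {k : ℕ} {lam : DForm EF F k}
    (hlam : lam.IsSmooth) (τ : ℝ) : (s.Omega lam τ).IsSmooth :=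
  hlam.d.pullback (s.contMDiff_incl τ)

theorem contMDiff_flow :
    ContMDiff (𝓘(ℝ, ℝ).prod 𝓘(ℝ, EF)) 𝓘(ℝ, EF) ∞ (fun q : ℝ × F => s.flow q.1 q.2) := by
  have h1 : ContMDiff (𝓘(ℝ, ℝ).prod 𝓘(ℝ, EF)) (𝓘(ℝ, ℝ).prod 𝓘(ℝ, EK)) ∞
      (fun q : ℝ × F => s.sF.symm q.2) := s.sF.symm.contMDiff.comp contMDiff_snd
  exact s.contMDiff_sF.comp (((contMDiff_fst.comp h1).add contMDiff_fst).prodMk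
    (contMDiff_snd.comp h1))

theorem flow_incl (τ r : ℝ) (k : K) : s.flow r (s.incl τ k) = s.incl (τ + r) k := by
  unfold flow incl
  rw [s.sF.symm_apply_apply]

/-- Cartan's formula on a time slice, for a form that is invariant under the flow. -/
theorem hamForm_d_eq_neg_d_hamForm [FiniteDimensional ℝ EK] [FiniteDimensional ℝ EF] {k : ℕ}
    {lam : DForm EF F (k + 1)} (hlam : lam.IsSmooth) (h : s.timeLieDeriv lam = 0) (τ : ℝ) (z : K)
    (v : Fin (k + 1) → EK) :
    s.hamForm lam.d τ z v = -(s.hamForm lam τ).d z v := by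
  have h1 := hlam.hasDerivAt_pullback_family s.contMDiff_sF τ z v
  rw [← hamForm_eq, ← hamForm_eq] at h1
  have h2 : HasDerivAt (fun r => DForm.pullback (E := EF) (s.flow r) lam (s.incl τ z)) 0 0 := by
    have h3 := (hlam.contDiffAt_pullback_family s.contMDiff_flow 0 (s.incl τ z)).differentiableAt
      (by simp)
    have h4 := congrFun h (s.incl τ z)
    unfold timeLieDeriv at h4
    have h5 := h3.hasDerivAt
    rwa [show deriv (fun r => DForm.pullback (E := EF) (fun z => s.flow r z) lam (s.incl τ z)) 0 = 0
      from h4] at h5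
  -- The slice at time `τ + r` is the slice at `τ` moved by the flow, so invariance of `lam` makes
  -- its restriction stationary.
  have h6 : HasDerivAt (fun r => DForm.pullback (E := EK) (s.incl (τ + r)) lam z v) 0 0 := by
    have h7 := (ContinuousAlternatingMap.apply ℝ EF ℝ
      (fun i => tanMap (E := EK) (E' := EF) (s.incl τ) z (v i))).hasFDerivAt.comp_hasDerivAt 0 h2
    rw [map_zero] at h7
    refine h7.congr_of_eventuallyEq (Eventually.of_forall fun r => ?_)
    beta_reduce
    have h8 : s.incl (τ + r) = fun y => s.flow r (s.incl τ y) :=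
      funext fun y => (s.flow_incl τ r y).symm
    rw [h8, DForm.pullback_comp_apply lam
      ((contMDiff_family_slice s.contMDiff_flow r _).mdifferentiableAt (by simp))
      ((s.contMDiff_incl τ z).mdifferentiableAt (by simp))]
    rfl
  have h9 : HasDerivAt (fun r => DForm.pullback (E := EK) (s.incl r) lam z v) 0 τ := by
    have := HasDerivAt.comp_sub_const (f := fun r => DForm.pullback (E := EK) (s.incl (τ + r)) lam z v)
      (f' := 0) τ τ (by rwa [sub_self])
    simpa using this
  exact eq_neg_of_add_eq_zero_left (h1.unique h9)

end Slicing

end SlicingForms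

/-! ### The Hamilton equations in integrated and pointwise form -/

section HamiltonEquations

variable {m : ℕ}
  {S : Type*} [TopologicalSpace S] [ChartedSpace (EuclideanSpace ℝ (Fin m)) S]
  [IsManifold (𝓡 m) ∞ S] [T2Space S] [CompactSpace S]
  {EK : Type*} [NormedAddCommGroup EK] [NormedSpace ℝ EK] [FiniteDimensional ℝ EK]
  {K : Type*} [TopologicalSpace K] [ChartedSpace EK K] [IsManifold 𝓘(ℝ, EK) ∞ K]
  {EB : Type*} [NormedAddCommGroup EB] [NormedSpace ℝ EB]
  {B : Type*} [TopologicalSpace B] [ChartedSpace EB B]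
  {EF : Type*} [NormedAddCommGroup EF] [NormedSpace ℝ EF]
  {F : Type*} [TopologicalSpace F] [ChartedSpace EF F] [IsManifold 𝓘(ℝ, EF) ∞ F]
  {πK : K → S} {πF : F → B}

namespace Slicing

variable (s : Slicing (EuclideanSpace ℝ (Fin m)) EK EB EF πK πF)

theorem hamEqForm_eq_sub (lam : DForm EF F (m + 1)) (τ : ℝ)
    (σ : BundleSection (EuclideanSpace ℝ (Fin m)) EK πK) (X V : σ.tangent) :
    s.hamEqForm lam τ σ X V =
      DForm.pullbackAlong₂ (E := EuclideanSpace ℝ (Fin m)) σ.toFun X.1 V.1 (s.Omega lam τ) -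
      DForm.pullbackAlong (E := EuclideanSpace ℝ (Fin m)) σ.toFun V.1 (s.hamForm lam τ).d := by
  funext x
  ext v
  rfl

theorem isSmooth_hamEqForm {lam : DForm EF F (m + 1)} (hlam : lam.IsSmooth) (τ : ℝ)
    (σ : BundleSection (EuclideanSpace ℝ (Fin m)) EK πK) (X V : σ.tangent) :
    (s.hamEqForm lam τ σ X V).IsSmooth := by
  rw [hamEqForm_eq_sub]
  exact ((s.isSmooth_Omega hlam τ).pullbackAlong₂ σ.smooth X.2.1 V.2.1).sub
    ((s.isSmooth_hamForm hlam τ).d.pullbackAlong σ.smooth V.2.1)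

theorem integral_hamEqForm (o : OrientationForm m S) {lam : DForm EF F (m + 1)}
    (hlam : lam.IsSmooth) (τ : ℝ) (σ : BundleSection (EuclideanSpace ℝ (Fin m)) EK πK)
    (X V : σ.tangent) :
    DForm.integral o (s.hamEqForm lam τ σ X V) =
      s.presymplectic o lam τ σ X V - σ.firstVariation o (s.isSmooth_hamForm hlam τ) V := by
  rw [hamEqForm_eq_sub, DForm.integral_sub o
    ((s.isSmooth_Omega hlam τ).pullbackAlong₂ σ.smooth X.2.1 V.2.1)
    ((s.isSmooth_hamForm hlam τ).d.pullbackAlong σ.smooth V.2.1)]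
  rfl

/-- The field `V` enters the integrand pointwise and linearly, so replacing it by `f • V` multiplies
the integrand by `f`, and the fundamental lemma applies. -/
theorem presymplectic_eq_firstVariation_iff (o : OrientationForm m S) {lam : DForm EF F (m + 1)}
    (hlam : lam.IsSmooth) (τ : ℝ) (σ : BundleSection (EuclideanSpace ℝ (Fin m)) EK πK)
    (X : σ.tangent) :
    (∀ V : σ.tangent, s.presymplectic o lam τ σ X V =
      σ.firstVariation o (s.isSmooth_hamForm hlam τ) V) ↔
      ∀ V : σ.tangent, s.hamEqForm lam τ σ X V = 0 := by
  refine ⟨fun h V => ?_, fun h V => ?_⟩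
  · refine (s.isSmooth_hamEqForm hlam τ σ X V).eq_zero_of_integral_smul o fun f hf => ?_
    have h1 : (fun x => f x • s.hamEqForm lam τ σ X V x) =
        s.hamEqForm lam τ σ X (BundleSection.smulTangent hf V) := by
      funext x
      ext v
      unfold hamEqForm
      refine Eq.trans ?_ (congrArg (fun l : EK [⋀^Fin m]→L[ℝ] ℝ => l _) (map_smul
        (ContinuousAlternatingMap.curryLeft ((s.Omega lam τ (σ x)).curryLeft (X.1 x) -
          (s.hamForm lam τ).d (σ x))) (f x) (V.1 x)).symm)
      rfl
    rw [h1, s.integral_hamEqForm o hlam, h, sub_self]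
  · rw [← sub_eq_zero, ← s.integral_hamEqForm o hlam, h V, DForm.integral_zero]

end Slicing

end HamiltonEquations

/-! ### Integral elements of systems generated in high degree -/

section ExteriorDifferentialSystems

variable {E : Type*} [NormedAddCommGroup E] [NormedSpace ℝ E] [FiniteDimensional ℝ E]
  {M : Type*} [TopologicalSpace M] [ChartedSpace E M] [IsManifold 𝓘(ℝ, E) ∞ M]
  {G : (k : ℕ) → DForm E M k → Prop} {p : ℕ}

/-- More vectors than the dimension of `W` are linearly dependent. -/
theorem alternating_eq_zero_of_finrank_lt {k : ℕ} (α : E [⋀^Fin k]→L[ℝ] ℝ) {W : Submodule ℝ E}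
    (hW : Module.finrank ℝ W < k) {v : Fin k → E} (hv : ∀ i, v i ∈ W) : α v = 0 := by
  refine α.toAlternatingMap.map_linearDependent v fun h => ?_
  have h1 : LinearIndependent ℝ (fun i => (⟨v i, hv i⟩ : W)) :=
    LinearIndependent.of_comp W.subtype h
  have h2 := h1.fintype_card_le_finrank
  rw [Fintype.card_fin] at h2
  omega

/-- A system generated in degrees above `p` has no nonzero forms up to degree `p`. -/
theorem DiffIdeal.eq_zero_of_le (hG : ∀ k α, G k α → p < k) {k : ℕ} {α : DForm E M k}
    (hα : DiffIdeal G k α) (hk : k ≤ p) : α = 0 := by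
  induction hα with
  | gen h => exact absurd (hG _ _ h) (by omega)
  | zero k => rfl
  | add _ _ h1 h2 => rw [h1 hk, h2 hk, add_zero]
  | wedge _ _ hw h =>
    funext x
    ext v
    rw [hw x v, h (by omega)]
    simp
  | d _ h => rw [h (by omega), DForm.d_zero]

/-- Up to dimension `p + 1` closure under `d` imposes nothing new: either the form has degree at
most `p` and is zero, together with its derivative, or its derivative has degree above `p + 1` and
vanishes on `W` for reasons of dimension. -/
theorem DiffIdeal.apply_eq_zero (hG : ∀ k α, G k α → p < k) {x : M} {W : Submodule ℝ E}
    (hW : Module.finrank ℝ W ≤ p + 1)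
    (hgen : ∀ k α, G k α → ∀ v : Fin k → E, (∀ i, v i ∈ W) → α x v = 0) {k : ℕ}
    {α : DForm E M k} (hα : DiffIdeal G k α) {v : Fin k → E} (hv : ∀ i, v i ∈ W) : α x v = 0 := by
  induction hα with
  | gen h => exact hgen _ _ h v hv
  | zero k => rfl
  | add _ _ h1 h2 =>
    rw [Pi.add_apply, ContinuousAlternatingMap.add_apply, h1 hv, h2 hv, add_zero]
  | wedge _ _ hw h =>
    rw [hw x v, Finset.sum_eq_zero, mul_zero]
    intro π _
    rw [h fun j => hv _, mul_zero, mul_zero]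
  | @d k α hα h =>
    by_cases hk : k ≤ p
    · rw [hα.eq_zero_of_le hG hk, DForm.d_zero]
      rfl
    · exact alternating_eq_zero_of_finrank_lt _ (by omega) hv

theorem isIntegralElement_of_finrank_eq (hG : ∀ k α, G k α → p < k) (x : M)
    {W : Submodule ℝ E} (hW : Module.finrank ℝ W = p) : IsIntegralElement (DiffIdeal G) p x W :=
  ⟨hW, fun _ _ hα _ hv => hα.apply_eq_zero hG (by omega) (fun k α h _ hv =>
    alternating_eq_zero_of_finrank_lt _ (by have := hG k α h; omega) hv) hv⟩

theorem isIntegralElement_succ_iff (hG : ∀ k α, G k α → p < k) (x : M) {W : Submodule ℝ E} :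
    IsIntegralElement (DiffIdeal G) (p + 1) x W ↔ Module.finrank ℝ W = p + 1 ∧
      ∀ k α, G k α → ∀ v : Fin k → E, (∀ i, v i ∈ W) → α x v = 0 :=
  ⟨fun h => ⟨h.1, fun k α hα => h.2 k α (DiffIdeal.gen hα)⟩,
    fun h => ⟨h.1, fun _ _ hα _ hv => hα.apply_eq_zero hG h.1.le h.2 hv⟩⟩

/-- On the `k`-dimensional span, a `k`-form is determined by its value on the basis `b`. -/
theorem alternating_eq_zero_of_mem_span_range {k : ℕ} {α : E [⋀^Fin k]→L[ℝ] ℝ} {b : Fin k → E}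
    (hb : LinearIndependent ℝ b) (h : α b = 0) {v : Fin k → E}
    (hv : ∀ i, v i ∈ Submodule.span ℝ (range b)) : α v = 0 := by
  have h1 : (α.toAlternatingMap.compLinearMap (Submodule.span ℝ (range b)).subtype)
      (Module.Basis.span hb) = 0 := by
    rw [AlternatingMap.compLinearMap_apply]
    refine Eq.trans (congrArg α (funext fun i => ?_)) h
    exact congrArg Subtype.val (Module.Basis.span_apply hb i)
  have h2 := (AlternatingMap.map_basis_eq_zero_iff (Module.Basis.span hb) _).1 h1
  exact congrArg (fun f => f (fun i => (⟨v i, hv i⟩ : Submodule.span ℝ (range b)))) h2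

end ExteriorDifferentialSystems

/-! ### Tangent vectors and the splitting into time and slice -/

section SlicingTangents

variable {ES : Type*} [NormedAddCommGroup ES] [NormedSpace ℝ ES]
  {S : Type*} [TopologicalSpace S] [ChartedSpace ES S]
  {EK : Type*} [NormedAddCommGroup EK] [NormedSpace ℝ EK]
  {K : Type*} [TopologicalSpace K] [ChartedSpace EK K]
  {EB : Type*} [NormedAddCommGroup EB] [NormedSpace ℝ EB]
  {B : Type*} [TopologicalSpace B] [ChartedSpace EB B]
  {EF : Type*} [NormedAddCommGroup EF] [NormedSpace ℝ EF]
  {F : Type*} [TopologicalSpace F] [ChartedSpace EF F]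
  {πK : K → S} {πF : F → B}

namespace Slicing

variable (s : Slicing ES EK EB EF πK πF)

/-- The time coordinate on `F`. -/
def time (p : F) : ℝ := (s.sF.symm p).1

/-- The projection of `F` to `K` along the flow of `∂₀`. -/
def toSlice (p : F) : K := (s.sF.symm p).2

@[simp] theorem time_incl (τ : ℝ) (z : K) : s.time (s.incl τ z) = τ := by
  unfold time incl
  rw [s.sF.symm_apply_apply]

@[simp] theorem toSlice_incl (τ : ℝ) (z : K) : s.toSlice (s.incl τ z) = z := by
  unfold toSlice incl
  rw [s.sF.symm_apply_apply]

theorem mdifferentiableAt_sF (q : ℝ × K) :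
    MDifferentiableAt (𝓘(ℝ, ℝ).prod 𝓘(ℝ, EK)) 𝓘(ℝ, EF) (fun q => s.sF q) q :=
  (s.sF.contMDiff q).mdifferentiableAt (by simp)

theorem mdifferentiableAt_incl (τ : ℝ) (z : K) :
    MDifferentiableAt 𝓘(ℝ, EK) 𝓘(ℝ, EF) (s.incl τ) z :=
  MDifferentiableAt.comp (I' := 𝓘(ℝ, ℝ).prod 𝓘(ℝ, EK)) z (s.mdifferentiableAt_sF (τ, z))
    (mdifferentiableAt_const.prodMk mdifferentiableAt_id)

theorem mdifferentiableAt_curve (z : K) (t : ℝ) :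
    MDifferentiableAt 𝓘(ℝ, ℝ) 𝓘(ℝ, EF) (fun r : ℝ => s.sF (r, z)) t :=
  MDifferentiableAt.comp (I' := 𝓘(ℝ, ℝ).prod 𝓘(ℝ, EK)) t (s.mdifferentiableAt_sF (t, z))
    (mdifferentiableAt_id.prodMk mdifferentiableAt_const)

theorem mdifferentiableAt_time (p : F) : MDifferentiableAt 𝓘(ℝ, EF) 𝓘(ℝ, ℝ) s.time p :=
  ((contMDiff_fst.comp s.sF.symm.contMDiff) p).mdifferentiableAt (by simp)

theorem mdifferentiableAt_toSlice (p : F) : MDifferentiableAt 𝓘(ℝ, EF) 𝓘(ℝ, EK) s.toSlice p :=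
  ((contMDiff_snd.comp s.sF.symm.contMDiff) p).mdifferentiableAt (by simp)

theorem tanMap_time_incl (τ : ℝ) (z : K) (v : EK) :
    tanMap (E := EF) (E' := ℝ) s.time (s.incl τ z)
      (tanMap (E := EK) (E' := EF) (s.incl τ) z v) = 0 := by
  have h := tanMap_comp (s.mdifferentiableAt_time (s.incl τ z)) (s.mdifferentiableAt_incl τ z)
  simp only [time_incl] at h
  have h2 := congrArg (fun l : EK →L[ℝ] ℝ => l v) h
  refine h2.symm.trans ?_
  unfold tanMap
  rw [mfderiv_const]
  rfl

theorem tanMap_time_timeField (τ : ℝ) (z : K) :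
    tanMap (E := EF) (E' := ℝ) s.time (s.incl τ z) (s.timeField (s.incl τ z)) = 1 := by
  have h := tanMap_comp (f := fun r : ℝ => s.sF (r, z)) (x := τ)
    (s.mdifferentiableAt_time (s.incl τ z)) (s.mdifferentiableAt_curve z τ)
  have h1 : (fun r : ℝ => s.time (s.sF (r, z))) = id := funext fun r => s.time_incl r z
  have h2 := congrArg (fun l : ℝ →L[ℝ] ℝ => l 1) h
  have h3 : s.timeField (s.incl τ z) = tanMap (E := ℝ) (E' := EF) (fun r : ℝ => s.sF (r, z)) τ 1 := by
    unfold timeField incl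
    rw [s.sF.symm_apply_apply]
  rw [h3]
  refine h2.symm.trans ?_
  rw [h1]
  unfold tanMap
  rw [mfderiv_id]
  rfl

/-- Differentiating `sF (time p, toSlice p) = p` splits a vector into a time part and a part tangent
to the slice; here the time part is absent. -/
theorem eq_tanMap_incl_of_tanMap_time_eq_zero {τ : ℝ} {z : K} {v : EF}
    (hv : tanMap (E := EF) (E' := ℝ) s.time (s.incl τ z) v = 0) :
    tanMap (E := EK) (E' := EF) (s.incl τ) z
      (tanMap (E := EF) (E' := EK) s.toSlice (s.incl τ z) v) = v := by
  have h1 : (fun p => s.sF (s.time p, s.toSlice p)) = id :=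
    funext fun p => s.sF.apply_symm_apply p
  have hq : (s.time (s.incl τ z), s.toSlice (s.incl τ z)) = (τ, z) := by simp
  have h2 := mfderiv_comp_of_eq (I := 𝓘(ℝ, EF)) (I' := 𝓘(ℝ, ℝ).prod 𝓘(ℝ, EK)) (I'' := 𝓘(ℝ, EF))
    (f := fun p => (s.time p, s.toSlice p)) (x := s.incl τ z) (g := fun q => s.sF q) (y := (τ, z))
    (s.mdifferentiableAt_sF (τ, z))
    ((s.mdifferentiableAt_time _).prodMk (s.mdifferentiableAt_toSlice _)) hq
  have h3 : (fun q => s.sF q) ∘ (fun p => (s.time p, s.toSlice p)) = id := h1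
  rw [h3, mfderiv_id, MDifferentiableAt.mfderiv_prod (s.mdifferentiableAt_time _)
    (s.mdifferentiableAt_toSlice _)] at h2
  have h4 := congrArg (fun l : EF →L[ℝ] EF => l v) h2
  have h5 := mfderiv_prod_eq_add_apply (I := 𝓘(ℝ, ℝ)) (I' := 𝓘(ℝ, EK)) (I'' := 𝓘(ℝ, EF))
    (v := ((0 : ℝ), tanMap (E := EF) (E' := EK) s.toSlice (s.incl τ z) v))
    (s.mdifferentiableAt_sF (τ, z))
  have h6 : ∀ q, (s.time (s.incl τ z), s.toSlice (s.incl τ z)) = q →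
      mfderiv (𝓘(ℝ, ℝ).prod 𝓘(ℝ, EK)) 𝓘(ℝ, EF) (fun q => s.sF q) q
      (tanMap (E := EF) (E' := ℝ) s.time (s.incl τ z) v,
        tanMap (E := EF) (E' := EK) s.toSlice (s.incl τ z) v) = v := by
    rintro _ rfl
    exact h4.symm
  replace h6 := h6 (τ, z) hq
  rw [hv] at h6
  have h7 := h5.symm.trans h6
  refine Eq.trans ?_ h7
  refine Eq.trans (zero_add _).symm (congrArg₂ (· + ·) ?_ rfl)
  exact (map_zero (mfderiv 𝓘(ℝ, ℝ) 𝓘(ℝ, EF) (fun r : ℝ => s.sF (r, z)) τ)).symm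

theorem proj_eq (p : F) : πF p = s.sB (s.time p, πK (s.toSlice p)) := by
  rw [← s.compat]
  exact congrArg πF (s.sF.apply_symm_apply p).symm

theorem time_eq (p : F) : s.time p = (s.sB.symm (πF p)).1 := by
  rw [s.proj_eq, s.sB.symm_apply_apply]

theorem proj_toSlice (p : F) : πK (s.toSlice p) = (s.sB.symm (πF p)).2 := by
  rw [s.proj_eq, s.sB.symm_apply_apply]

/-- By compatibility of the slicing, time is a function on `B` pulled back by `πF`, so vertical
vectors do not change it. -/
theorem tanMap_time_of_isVertical {p : F} (hπ : MDifferentiableAt 𝓘(ℝ, EF) 𝓘(ℝ, EB) πF p) {v : EF}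
    (hv : IsVertical EB πF p v) : tanMap (E := EF) (E' := ℝ) s.time p v = 0 := by
  have h1 : s.time = fun p => (s.sB.symm (πF p)).1 := funext s.time_eq
  have hT : MDifferentiableAt 𝓘(ℝ, EB) 𝓘(ℝ, ℝ) (fun b => (s.sB.symm b).1) (πF p) :=
    ((contMDiff_fst.comp s.sB.symm.contMDiff) _).mdifferentiableAt (by simp)
  have h2 := congrArg (fun l : EF →L[ℝ] ℝ => l v) (tanMap_comp hT hπ)
  rw [h1]
  refine h2.trans ?_
  refine Eq.trans ?_ (map_zero (tanMap (E := EB) (E' := ℝ) (fun b => (s.sB.symm b).1) (πF p)))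
  exact congrArg _ hv

theorem isVertical_tanMap_toSlice {p : F} (hπ : MDifferentiableAt 𝓘(ℝ, EF) 𝓘(ℝ, EB) πF p)
    (hπK : MDifferentiableAt 𝓘(ℝ, EK) 𝓘(ℝ, ES) πK (s.toSlice p)) {v : EF}
    (hv : IsVertical EB πF p v) :
    IsVertical ES πK (s.toSlice p) (tanMap (E := EF) (E' := EK) s.toSlice p v) := by
  have h1 : (fun p => πK (s.toSlice p)) = fun p => (s.sB.symm (πF p)).2 := funext s.proj_toSlice
  have hT : MDifferentiableAt 𝓘(ℝ, EB) 𝓘(ℝ, ES) (fun b => (s.sB.symm b).2) (πF p) :=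
    ((contMDiff_snd.comp s.sB.symm.contMDiff) _).mdifferentiableAt (by simp)
  have h2 := congrArg (fun l : EF →L[ℝ] ES => l v) (tanMap_comp hT hπ)
  have h3 := congrArg (fun l : EF →L[ℝ] ES => l v) (tanMap_comp hπK (s.mdifferentiableAt_toSlice p))
  rw [h1] at h3
  refine (h3.symm.trans h2).trans ?_
  refine Eq.trans ?_ (map_zero (tanMap (E := EB) (E' := ES) (fun b => (s.sB.symm b).2) (πF p)))
  exact congrArg _ hv

theorem isVertical_tanMap_incl {τ : ℝ} {z : K}
    (hπ : MDifferentiableAt 𝓘(ℝ, EF) 𝓘(ℝ, EB) πF (s.incl τ z))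
    (hπK : MDifferentiableAt 𝓘(ℝ, EK) 𝓘(ℝ, ES) πK z) {v : EK} (hv : IsVertical ES πK z v) :
    IsVertical EB πF (s.incl τ z) (tanMap (E := EK) (E' := EF) (s.incl τ) z v) := by
  have h1 : (fun z => πF (s.incl τ z)) = fun z => s.sB (τ, πK z) := funext fun z => s.compat τ z
  have hT : MDifferentiableAt 𝓘(ℝ, ES) 𝓘(ℝ, EB) (fun y => s.sB (τ, y)) (πK z) :=
    MDifferentiableAt.comp (I' := 𝓘(ℝ, ℝ).prod 𝓘(ℝ, ES)) (πK z)
      ((s.sB.contMDiff (τ, πK z)).mdifferentiableAt (by simp))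
      (mdifferentiableAt_const.prodMk mdifferentiableAt_id)
  have h2 := congrArg (fun l : EK →L[ℝ] EB => l v) (tanMap_comp hT hπK)
  have h3 := congrArg (fun l : EK →L[ℝ] EB => l v) (tanMap_comp hπ (s.mdifferentiableAt_incl τ z))
  rw [h1] at h3
  refine (h3.symm.trans h2).trans ?_
  refine Eq.trans ?_ (map_zero (tanMap (E := ES) (E' := EB) (fun y => s.sB (τ, y)) (πK z)))
  exact congrArg _ hv

theorem tanMap_lift [IsManifold 𝓘(ℝ, EK) ∞ K] (τ : ℝ) (σ : BundleSection ES EK πK) (x : S) :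
    tanMap (E := ES) (E' := EF) (fun y => s.incl τ (σ y)) x =
      (tanMap (E := EK) (E' := EF) (s.incl τ) (σ x)).comp (tanMap (E := ES) (E' := EK) σ.toFun x) :=
  tanMap_comp (s.mdifferentiableAt_incl τ _) ((σ.smooth x).mdifferentiableAt (by simp))

/-- The lift `i_τ ∘ σ` has the smooth left inverse `πK ∘ toSlice`. -/
theorem injective_tanMap_lift [IsManifold 𝓘(ℝ, EK) ∞ K] (hπK : ContMDiff 𝓘(ℝ, EK) 𝓘(ℝ, ES) ∞ πK)
    (τ : ℝ) (σ : BundleSection ES EK πK) (x : S) :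
    Function.Injective (tanMap (E := ES) (E' := EF) (fun y => s.incl τ (σ y)) x) := by
  have hl : MDifferentiableAt 𝓘(ℝ, ES) 𝓘(ℝ, EF) (fun y => s.incl τ (σ y)) x :=
    MDifferentiableAt.comp x (g := s.incl τ) (f := σ.toFun) (s.mdifferentiableAt_incl τ _)
      ((σ.smooth x).mdifferentiableAt (by simp))
  have hr : MDifferentiableAt 𝓘(ℝ, EF) 𝓘(ℝ, ES) (fun p => πK (s.toSlice p)) (s.incl τ (σ x)) :=
    MDifferentiableAt.comp _ ((hπK _).mdifferentiableAt (by simp)) (s.mdifferentiableAt_toSlice _)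
  have h := tanMap_comp (f := fun y => s.incl τ (σ y)) hr hl
  have h1 : (fun y => πK (s.toSlice (s.incl τ (σ y)))) = id := funext fun y => by
    rw [s.toSlice_incl, σ.section_eq]
    rfl
  rw [h1, show tanMap (E := ES) (E' := ES) id x = ContinuousLinearMap.id ℝ ES from mfderiv_id] at h
  exact Function.LeftInverse.injective (g := tanMap (E := EF) (E' := ES)
    (fun p => πK (s.toSlice p)) (s.incl τ (σ x)))
    fun w => (congrArg (fun l : ES →L[ℝ] ES => l w) h).symm

end Slicing

end SlicingTangents

/-! ### Polar spaces and the Hamilton equations -/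

section PolarSpaces

variable {m : ℕ} {S : Type*} [TopologicalSpace S] [T2Space S] [CompactSpace S]
  [ChartedSpace (EuclideanSpace ℝ (Fin m)) S] [IsManifold (𝓡 m) ∞ S]
  {EB : Type*} [NormedAddCommGroup EB] [NormedSpace ℝ EB]
  {B : Type*} [TopologicalSpace B] [ChartedSpace EB B] [IsManifold 𝓘(ℝ, EB) ∞ B]
  {EK : Type*} [NormedAddCommGroup EK] [NormedSpace ℝ EK] [FiniteDimensional ℝ EK]
  {K : Type*} [TopologicalSpace K] [T2Space K] [ChartedSpace EK K] [IsManifold 𝓘(ℝ, EK) ∞ K]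
  {EF : Type*} [NormedAddCommGroup EF] [NormedSpace ℝ EF] [FiniteDimensional ℝ EF]
  {F : Type*} [TopologicalSpace F] [T2Space F] [ChartedSpace EF F] [IsManifold 𝓘(ℝ, EF) ∞ F]
  {πK : K → S} {πF : F → B}

theorem HamiltonCartanGen.lt_degree {lam : DForm EF F (m + 1)} (k : ℕ) (α : DForm EF F k)
    (h : HamiltonCartanGen EB πF lam k α) : m < k := by
  cases h
  exact Nat.lt_succ_self m

/-- It allows a condition on all sections `V` to be tested on single vertical vectors: a vertical
extension to `K` is restricted to `σ`. -/
theorem BundleSection.exists_tangent_eq (hπK : IsBundle (EuclideanSpace ℝ (Fin m)) EK πK)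
    (σ : BundleSection (EuclideanSpace ℝ (Fin m)) EK πK) (x : S) {v : EK}
    (hv : IsVertical (EuclideanSpace ℝ (Fin m)) πK (σ x) v) : ∃ V : σ.tangent, V.1 x = v := by
  obtain ⟨Z, hZ, hZv, rfl⟩ := hπK.exists_vertical_extension hv
  exact ⟨⟨fun y => Z (σ y), hZ.comp σ.smooth, fun y => hZv _⟩, rfl⟩

namespace Slicing

variable (s : Slicing (EuclideanSpace ℝ (Fin m)) EK EB EF πK πF)

/-- The frame of the lifted slice given by the standard basis. -/
def sliceFrame (τ : ℝ) (σ : BundleSection (EuclideanSpace ℝ (Fin m)) EK πK) (x : S) :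
    Fin m → EF := fun i =>
  tanMap (E := EuclideanSpace ℝ (Fin m)) (E' := EF) (fun y => s.incl τ (σ y)) x
    (EuclideanSpace.single i (1 : ℝ))

theorem sliceFrame_eq_comp_basis (τ : ℝ) (σ : BundleSection (EuclideanSpace ℝ (Fin m)) EK πK)
    (x : S) : s.sliceFrame τ σ x = (tanMap (E := EuclideanSpace ℝ (Fin m)) (E' := EF)
      (fun y => s.incl τ (σ y)) x).toLinearMap ∘ (EuclideanSpace.basisFun (Fin m) ℝ).toBasis := by
  funext i
  simp [sliceFrame]

theorem sliceElement_eq_span (τ : ℝ) (σ : BundleSection (EuclideanSpace ℝ (Fin m)) EK πK) (x : S) :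
    s.sliceElement τ σ x = Submodule.span ℝ (range (s.sliceFrame τ σ x)) := by
  rw [sliceFrame_eq_comp_basis, range_comp, Submodule.span_image, Module.Basis.span_eq,
    Submodule.map_top]
  rfl

theorem linearIndependent_sliceFrame (hπK : ContMDiff 𝓘(ℝ, EK) (𝓡 m) ∞ πK) (τ : ℝ)
    (σ : BundleSection (EuclideanSpace ℝ (Fin m)) EK πK) (x : S) :
    LinearIndependent ℝ (s.sliceFrame τ σ x) := by
  rw [sliceFrame_eq_comp_basis]
  exact (Module.Basis.linearIndependent _).map' _
    (LinearMap.ker_eq_bot.2 (s.injective_tanMap_lift hπK τ σ x))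

theorem finrank_sliceElement (hπK : ContMDiff 𝓘(ℝ, EK) (𝓡 m) ∞ πK) (τ : ℝ)
    (σ : BundleSection (EuclideanSpace ℝ (Fin m)) EK πK) (x : S) :
    Module.finrank ℝ (s.sliceElement τ σ x) = m := by
  rw [sliceElement_eq_span, finrank_span_eq_card (s.linearIndependent_sliceFrame hπK τ σ x),
    Fintype.card_fin]

theorem tanMap_time_of_mem_sliceElement {τ : ℝ}
    {σ : BundleSection (EuclideanSpace ℝ (Fin m)) EK πK} {x : S} {w : EF}
    (hw : w ∈ s.sliceElement τ σ x) :
    tanMap (E := EF) (E' := ℝ) s.time (s.incl τ (σ x)) w = 0 := by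
  obtain ⟨y, rfl⟩ := hw
  refine Eq.trans (congrArg _ ?_) (s.tanMap_time_incl τ (σ x)
    (tanMap (E := EuclideanSpace ℝ (Fin m)) (E' := EK) σ.toFun x y))
  exact congrArg (fun l : EuclideanSpace ℝ (Fin m) →L[ℝ] EF => l y) (s.tanMap_lift τ σ x)

theorem tanMap_time_evolutionVector (τ : ℝ) (σ : BundleSection (EuclideanSpace ℝ (Fin m)) EK πK)
    (X : σ.tangent) (x : S) :
    tanMap (E := EF) (E' := ℝ) s.time (s.incl τ (σ x)) (s.evolutionVector τ σ X x) = 1 := by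
  unfold evolutionVector
  refine (map_add (tanMap (E := EF) (E' := ℝ) s.time (s.incl τ (σ x))) _ _).trans ?_
  rw [tanMap_time_timeField, tanMap_time_incl, add_zero]

/-- The differential of time is `1` on `∂₀ + X` and `0` on the tangent space of the lifted slice. -/
theorem linearIndependent_evolution_sliceFrame (hπK : ContMDiff 𝓘(ℝ, EK) (𝓡 m) ∞ πK) (τ : ℝ)
    (σ : BundleSection (EuclideanSpace ℝ (Fin m)) EK πK) (X : σ.tangent) (x : S) :
    LinearIndependent ℝ (Fin.cons (s.evolutionVector τ σ X x) (s.sliceFrame τ σ x) :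
      Fin (m + 1) → EF) := by
  refine linearIndependent_finCons.2 ⟨s.linearIndependent_sliceFrame hπK τ σ x, fun h => ?_⟩
  rw [← sliceElement_eq_span] at h
  have h1 := s.tanMap_time_of_mem_sliceElement h
  rw [s.tanMap_time_evolutionVector τ σ X x] at h1
  exact one_ne_zero h1

/-- For a form that is invariant in time, the Hamilton equations are the contraction of `dλ` with
`∂₀ + X`. -/
theorem hamEqForm_apply {lam : DForm EF F (m + 1)} (hlam : lam.IsSmooth)
    (h : s.timeLieDeriv lam = 0) (τ : ℝ) (σ : BundleSection (EuclideanSpace ℝ (Fin m)) EK πK)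
    (X V : σ.tangent) (x : S) :
    s.hamEqForm lam τ σ X V x (fun i => EuclideanSpace.single i (1 : ℝ)) =
      -((lam.d (s.incl τ (σ x))).curryLeft
        (tanMap (E := EK) (E' := EF) (s.incl τ) (σ x) (V.1 x))).curryLeft
          (s.evolutionVector τ σ X x) (s.sliceFrame τ σ x) := by
  set e : Fin m → EK := fun i => tanMap (E := EuclideanSpace ℝ (Fin m)) (E' := EK) σ.toFun x
    (EuclideanSpace.single i (1 : ℝ)) with he
  set J := tanMap (E := EK) (E' := EF) (s.incl τ) (σ x) with hJ
  have hfr : ∀ i, s.sliceFrame τ σ x i = J (e i) := fun i =>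
    congrArg (fun l : EuclideanSpace ℝ (Fin m) →L[ℝ] EF => l (EuclideanSpace.single i (1 : ℝ)))
      (s.tanMap_lift τ σ x)
  have h1 : s.hamEqForm lam τ σ X V x (fun i => EuclideanSpace.single i (1 : ℝ)) =
      s.Omega lam τ (σ x) (Matrix.vecCons (X.1 x) (Matrix.vecCons (V.1 x) e)) -
        (s.hamForm lam τ).d (σ x) (Matrix.vecCons (V.1 x) e) := rfl
  have h2 := s.hamForm_d_eq_neg_d_hamForm hlam h τ (σ x) (Matrix.vecCons (V.1 x) e)
  have h3 : s.hamForm lam.d τ (σ x) (Matrix.vecCons (V.1 x) e) =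
      lam.d (s.incl τ (σ x)) (Matrix.vecCons (s.timeField (s.incl τ (σ x)))
        (Matrix.vecCons (J (V.1 x)) (s.sliceFrame τ σ x))) := by
    change lam.d _ (Matrix.vecCons _ _) = _
    congr 2
    funext i
    refine Fin.cases rfl (fun i => ?_) i
    exact (hfr i).symm
  have h4 : s.Omega lam τ (σ x) (Matrix.vecCons (X.1 x) (Matrix.vecCons (V.1 x) e)) =
      lam.d (s.incl τ (σ x)) (Matrix.vecCons (J (X.1 x))
        (Matrix.vecCons (J (V.1 x)) (s.sliceFrame τ σ x))) := by
    change lam.d _ _ = _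
    congr 1
    funext i
    refine Fin.cases rfl (Fin.cases rfl fun i => ?_) i
    exact (hfr i).symm
  have h5 : s.hamEqForm lam τ σ X V x (fun i => EuclideanSpace.single i (1 : ℝ)) =
      lam.d (s.incl τ (σ x)) (Matrix.vecCons (s.evolutionVector τ σ X x)
        (Matrix.vecCons (J (V.1 x)) (s.sliceFrame τ σ x))) := by
    rw [h1, sub_eq_add_neg, ← h2, h3, h4, add_comm]
    exact ((lam.d (s.incl τ (σ x))).toAlternatingMap.map_vecCons_add _ _ _).symm
  rw [h5, ContinuousAlternatingMap.curryLeft_apply_apply,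
    ContinuousAlternatingMap.curryLeft_apply_apply]
  -- The generators insert the vertical vector in the first slot, while the Hamilton equations
  -- insert `∂₀ + X` there; the exchange accounts for the sign.
  have h6 := (lam.d (s.incl τ (σ x))).toAlternatingMap.map_swap
    (Matrix.vecCons (J (V.1 x)) (Matrix.vecCons (s.evolutionVector τ σ X x) (s.sliceFrame τ σ x)))
    (Fin.zero_ne_one (n := m))
  refine Eq.trans (congrArg (lam.d (s.incl τ (σ x))) (funext fun i => ?_)) h6
  refine Fin.cases ?_ (Fin.cases ?_ fun i => ?_) i
  · simp
  · simp
  · have h7 : (i.succ.succ : Fin (m + 2)) ≠ 1 := by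
      intro h
      exact Fin.succ_ne_zero i (Fin.succ_injective _ (h.trans Fin.succ_zero_eq_one.symm))
    rw [Function.comp_apply, Equiv.swap_apply_of_ne_of_ne (Fin.succ_ne_zero _) h7]
    rfl

/-- The span of `E_x` and `∂₀ + X` is itself an integral element. A generator restricts to a
multiple of a volume form there, so one evaluation on the basis suffices, and that evaluation is a
Hamilton equation. -/
theorem evolutionVector_mem_polarSpace (hπK : IsBundle (EuclideanSpace ℝ (Fin m)) EK πK)
    (hπF : IsBundle EB EF πF) {lam : DForm EF F (m + 1)} (hlam : lam.IsSmooth)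
    (h : s.timeLieDeriv lam = 0) (τ : ℝ) (σ : BundleSection (EuclideanSpace ℝ (Fin m)) EK πK)
    (X : σ.tangent) (hX : ∀ V : σ.tangent, s.hamEqForm lam τ σ X V = 0) (x : S) :
    s.evolutionVector τ σ X x ∈ polarSpace (hamiltonCartan EB πF lam) m (s.incl τ (σ x))
      (s.sliceElement τ σ x) := by
  set b : Fin (m + 1) → EF := Fin.cons (s.evolutionVector τ σ X x) (s.sliceFrame τ σ x) with hb
  have hbi : LinearIndependent ℝ b :=
    s.linearIndependent_evolution_sliceFrame hπK.contMDiff τ σ X x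
  have hmem : ∀ i, b i ∈ Submodule.span ℝ (range b) := fun i =>
    Submodule.subset_span (mem_range_self i)
  suffices hW : Submodule.span ℝ (range b) ∈ {W' | IsIntegralElement (hamiltonCartan EB πF lam)
      (m + 1) (s.incl τ (σ x)) W' ∧ s.sliceElement τ σ x ≤ W'} from le_sSup hW (hmem 0)
  refine ⟨?_, ?_⟩
  · refine (isIntegralElement_succ_iff HamiltonCartanGen.lt_degree _).2 ⟨?_, ?_⟩
    · rw [finrank_span_eq_card hbi, Fintype.card_fin]
    · rintro _ _ ⟨Z, hZ, hZv⟩ v hv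
      refine alternating_eq_zero_of_mem_span_range hbi ?_ hv
      have h1 := s.tanMap_time_of_isVertical ((hπF.contMDiff _).mdifferentiableAt (by simp))
        (hZv (s.incl τ (σ x)))
      -- The value of `Z` at the point is tangent to the slice and comes from a vertical vector of
      -- `K`, which is then extended to a field `V` along `σ`.
      have h2 := s.eq_tanMap_incl_of_tanMap_time_eq_zero h1
      have h3 := s.isVertical_tanMap_toSlice ((hπF.contMDiff _).mdifferentiableAt (by simp))
        ((hπK.contMDiff _).mdifferentiableAt (by simp)) (hZv (s.incl τ (σ x)))
      rw [s.toSlice_incl] at h3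
      obtain ⟨V, hV⟩ := BundleSection.exists_tangent_eq hπK σ x h3
      have h4 := s.hamEqForm_apply hlam h τ σ X V x
      rw [hX V, hV, h2] at h4
      exact neg_eq_zero.1 h4.symm
  · rw [sliceElement_eq_span]
    refine Submodule.span_mono ?_
    rintro _ ⟨i, rfl⟩
    exact ⟨i.succ, rfl⟩

/-- The polar space is only spanned by integral elements, so `∂₀ + X` need not lie in any one of
them. Linearity of the contracted `dλ` in that slot suffices: its kernel is a subspace containing
all of them. -/
theorem hamEqForm_eq_zero_of_mem_polarSpace (hπK : IsBundle (EuclideanSpace ℝ (Fin m)) EK πK)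
    (hπF : IsBundle EB EF πF) {lam : DForm EF F (m + 1)} (hlam : lam.IsSmooth)
    (h : s.timeLieDeriv lam = 0) (τ : ℝ) (σ : BundleSection (EuclideanSpace ℝ (Fin m)) EK πK)
    (X : σ.tangent) (hX : ∀ x, s.evolutionVector τ σ X x ∈
      polarSpace (hamiltonCartan EB πF lam) m (s.incl τ (σ x)) (s.sliceElement τ σ x))
    (V : σ.tangent) : s.hamEqForm lam τ σ X V = 0 := by
  funext x
  refine alternating_eq_zero_of_single ?_
  rw [s.hamEqForm_apply hlam h, neg_eq_zero]
  have hv := s.isVertical_tanMap_incl (τ := τ) ((hπF.contMDiff _).mdifferentiableAt (by simp))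
    ((hπK.contMDiff _).mdifferentiableAt (by simp)) (V.2.2 x)
  -- The generators come from global vertical fields on `F`, so the image of `V.1 x` has to be
  -- extended to one.
  obtain ⟨Z, hZ, hZv, hZp⟩ := hπF.exists_vertical_extension hv
  set l : EF →ₗ[ℝ] ℝ := ((ContinuousAlternatingMap.apply ℝ EF ℝ (s.sliceFrame τ σ x)).comp
    ((lam.d (s.incl τ (σ x))).curryLeft
      (tanMap (E := EK) (E' := EF) (s.incl τ) (σ x) (V.1 x))).curryLeft).toLinearMap with hl
  have hle : polarSpace (hamiltonCartan EB πF lam) m (s.incl τ (σ x)) (s.sliceElement τ σ x) ≤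
      LinearMap.ker l := by
    refine sSup_le ?_
    rintro W ⟨hW, hEW⟩ w hw
    have h1 := ((isIntegralElement_succ_iff HamiltonCartanGen.lt_degree _).1 hW).2 _ _
      (HamiltonCartanGen.mk Z hZ hZv) (Fin.cons w (s.sliceFrame τ σ x))
      (Fin.cases hw fun i => hEW (LinearMap.mem_range_self _ _))
    unfold DForm.interior at h1
    rw [hZp] at h1
    exact h1
  exact hle (hX x)

end Slicing

end PolarSpaces

end FieldTheory

end
theorem mainTheorem3 {m : ℕ}
    -- the typical slice `S` of dimension `n - 1 = m`, compact and oriented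
    {S : Type*} [TopologicalSpace S] [T2Space S] [CompactSpace S]
    [ChartedSpace (EuclideanSpace ℝ (Fin m)) S] [IsManifold (𝓡 m) ∞ S]
    (o : OrientationForm m S)
    -- the base `B` of dimension `n = m + 1`
    {B : Type*} [TopologicalSpace B] [T2Space B] [SecondCountableTopology B]
    [ChartedSpace (EuclideanSpace ℝ (Fin (m + 1))) B] [IsManifold (𝓡 (m + 1)) ∞ B]
    -- the bundles `K → S` and `F → B`
    {EK : Type*} [NormedAddCommGroup EK] [NormedSpace ℝ EK] [FiniteDimensional ℝ EK]
    {K : Type*} [TopologicalSpace K] [T2Space K] [SecondCountableTopology K]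
    [ChartedSpace EK K] [IsManifold 𝓘(ℝ, EK) ∞ K]
    {EF : Type*} [NormedAddCommGroup EF] [NormedSpace ℝ EF] [FiniteDimensional ℝ EF]
    {F : Type*} [TopologicalSpace F] [T2Space F] [SecondCountableTopology F]
    [ChartedSpace EF F] [IsManifold 𝓘(ℝ, EF) ∞ F]
    (πK : K → S) (hπK : IsBundle (EuclideanSpace ℝ (Fin m)) EK πK)
    (πF : F → B) (hπF : IsBundle (EuclideanSpace ℝ (Fin (m + 1))) EF πF)
    -- the compatible slicing
    (s : Slicing (EuclideanSpace ℝ (Fin m)) EK (EuclideanSpace ℝ (Fin (m + 1))) EF πK πF)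
    -- the `n`-form `λ`
    (lam : DForm EF F (m + 1)) (hlam : lam.IsSmooth)
    (hproper : IsProperlySemibasic (EuclideanSpace ℝ (Fin (m + 1))) πF 1 lam)
    -- the time `τ` and the pair `(σ_τ, X_τ)`
    (τ : ℝ) (σ : BundleSection (EuclideanSpace ℝ (Fin m)) EK πK) (X : σ.tangent) :
    -- `H_τ` has a unique differential `dH` at `σ`, and
    -- `X ⌟ ω_τ = dH` if and only if `σ^* (V ⌟ (X ⌟ Ω_τ - d𝓗_τ)) = 0` for all `V`
    (∃ dH : σ.tangent →ₗ[ℝ] ℝ,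
      HasDifferentialAt (s.hamiltonian o lam τ) σ dH ∧
      (∀ D : σ.tangent →ₗ[ℝ] ℝ, HasDifferentialAt (s.hamiltonian o lam τ) σ D → D = dH) ∧
      ((∀ V : σ.tangent, s.presymplectic o lam τ σ X V = dH V) ↔
        ∀ V : σ.tangent, s.hamEqForm lam τ σ X V = 0)) ∧
    -- the tangent spaces of the lifted slice are integral elements of the Hamilton-Cartan system
    (∀ x, IsIntegralElement (hamiltonCartan (EuclideanSpace ℝ (Fin (m + 1))) πF lam) m
      (s.incl τ (σ x)) (s.sliceElement τ σ x)) ∧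
    -- if `λ` is invariant in time, the condition says that `∂₀ + X` lies in their polar spaces
    (s.timeLieDeriv lam = 0 →
      ((∀ V : σ.tangent, s.hamEqForm lam τ σ X V = 0) ↔
        ∀ x, s.evolutionVector τ σ X x ∈
          polarSpace (hamiltonCartan (EuclideanSpace ℝ (Fin (m + 1))) πF lam) m
            (s.incl τ (σ x)) (s.sliceElement τ σ x))) := by
  refine ⟨⟨σ.firstVariation o (s.isSmooth_hamForm hlam τ),
    σ.hasDifferentialAt_firstVariation o (s.isSmooth_hamForm hlam τ), fun D hD => ?_,
    s.presymplectic_eq_firstVariation_iff o hlam τ σ X⟩, fun x => ?_, fun h => ⟨fun hX x => ?_,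
    fun hX V => ?_⟩⟩
  · exact hD.unique hπK (σ.hasDifferentialAt_firstVariation o (s.isSmooth_hamForm hlam τ))
  · exact isIntegralElement_of_finrank_eq HamiltonCartanGen.lt_degree _
      (s.finrank_sliceElement hπK.contMDiff τ σ x)
  · exact s.evolutionVector_mem_polarSpace hπK hπF hlam h τ σ X hX x
  · exact s.hamEqForm_eq_zero_of_mem_polarSpace hπK hπF hlam h τ σ X hX V
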